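/- Let $T>0$, let $U\subset\mathbb R^m$ and $V\subset\mathbb R^l$ be compact, and let $U$ have the Whitney property: there is $C\ge 1$ such that any $u_1,u_2\in U$ are joined by an absolutely continuous path in $U$ of variation at most $C|u_1-u_2|$. For $i=0,\dots,m$ let $g_i:\mathbb R^n\times U\times V\to\mathbb R^n$ be continuous, with $(x,u)\mapsto g_i(x,u,v)$ locally Lipschitz on $\mathbb R^n\times U$ uniformly in $v\in V$, and $|g_i(x,u,v)|\le M(1+|(x,u)|)$ for some $M>0$. Let $(\bar x_0,\bar u_0)\in\mathbb R^n\times U$ and consider $$\dot x=g_0(x,u,v_1)+\sum_{i=1}^m g_i(x,u,v_2)\,\dot u_i\ \text{ a.e. on }[0,T],\qquad x(0)=\bar x_0,\quad u(0)=\bar u_0. \tag{1}$$ Let $u:[0,T]\to U$ have bounded variation with $u(0)=\bar u_0$, and let $v_1,v_2\in L^1([0,T],V)$. **Extended BVS limit solution.** An everywhere defined integrable map $x:[0,T]\to\mathbb R^n$ is an E-BVS limit solution of (1) for $(u,v_1,v_2)$ if there are absolutely continuous $u_k:[0,T]\to U$ with $u_k(0)=\bar u_0$ and $\sup_k \mathrm{Var}_{[0,T]}(u_k)<\infty$,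 and $v_{1,k},v_{2,k}\in L^1([0,T],V)$, such that: (i) the Carathéodory solutions $x_k$ of (1) for $(u_k,v_{1,k},v_{2,k})$ satisfy $(x_k,u_k)(\tau)\to(x,u)(\tau)$ for every $\tau\in[0,T]$ and $(x_k,u_k,v_{1,k},v_{2,k})\to(x,u,v_1,v_2)$ in $L^1([0,T])$; (ii) for some $\psi_2\in L^1_{loc}([0,\infty),V)$, with $\sigma_k(t):=t+\mathrm{Var}_{[0,t]}(u_k)$ one has $\displaystyle\int_0^{\sigma_k(T)}|v_{2,k}(\sigma_k^{-1}(s))-\psi_2(s)|\,ds\to0$. **Graph completion solution.** A graph completion of $(u,v_1,v_2)$ consists of $S>0$, a Lipschitz map $(\varphi_0,\varphi):[0,S]\to[0,\infty)\times U$ and $\psi_1,\psi_2\in L^1([0,S],V)$ such that $(\varphi_0,\varphi)(0)=(0,\bar u_0)$, $\varphi_0(S)=T$, $\varphi_0'\ge0$ and $\varphi_0'+|\varphi'|=1$ a.e.; for every $t\in[0,T]$ there is $s\in[0,S]$ with $(\varphi_0,\varphi)(s)=(t,u(t))$; and for a.e. $t\in[0,T]$ there is $s\in[0,S]$ with $(\varphi_0,\varphi,\psi_1,\psi_2)(s)=(t,u(t),v_1(t),v_2(t))$.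 A clock is a strictly increasing $\sigma:[0,T]\to[0,S]$ with $\sigma(0)=0$, $\sigma(T)=S$ and $(\varphi_0,\varphi)(\sigma(t))=(t,u(t))$ for every $t\in[0,T]$. A map $x:[0,T]\to\mathbb R^n$ is a graph completion solution of (1) for $(u,v_1,v_2)$ if there are a graph completion and a clock $\sigma$ such that $x=\xi\circ\sigma$ on $[0,T]$, where $\xi$ is the absolutely continuous solution of $$\xi'=g_0(\xi,\varphi,\psi_1)\varphi_0'+\sum_{i=1}^m g_i(\xi,\varphi,\psi_2)\varphi_i'\ \text{ a.e. on }[0,S],\qquad \xi(0)=\bar x_0.$$ **Theorem.** A map $x:[0,T]\to\mathbb R^n$ is an E-BVS limit solution of (1) for $(u,v_1,v_2)$ if and only if it is a graph completion solution of (1) for the same $(u,v_1,v_2)$. -/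

import Mathlib

open MeasureTheory Filter Topology Set
open scoped NNReal ENNReal

/-- The Whitney property of a set `U`: any two points are joined inside `U` by an absolutely
continuous path whose variation is at most `C` times their distance. -/
def WhitneyProperty {m : ℕ} (U : Set (EuclideanSpace ℝ (Fin m))) : Prop :=
  ∃ C : ℝ, 1 ≤ C ∧ ∀ u₁ ∈ U, ∀ u₂ ∈ U, ∃ w : ℝ → EuclideanSpace ℝ (Fin m),
    AbsolutelyContinuousOnInterval w 0 1 ∧ MapsTo w (Icc 0 1) U ∧ w 0 = u₁ ∧ w 1 = u₂ ∧
      eVariationOn w (Icc 0 1) ≤ ENNReal.ofReal (C * ‖u₁ - u₂‖)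

/-- The assumptions on the control sets and on the vector fields `g 0, …, g m`, which matter only
on `ℝⁿ × U × V`. -/
structure StandingAssumptions {n m l : ℕ} (U : Set (EuclideanSpace ℝ (Fin m)))
    (V : Set (EuclideanSpace ℝ (Fin l)))
    (g : Fin (m + 1) → EuclideanSpace ℝ (Fin n) → EuclideanSpace ℝ (Fin m) →
      EuclideanSpace ℝ (Fin l) → EuclideanSpace ℝ (Fin n)) : Prop where
  compact_U : IsCompact U
  compact_V : IsCompact V
  whitney : WhitneyProperty U
  continuous : ∀ i, ContinuousOn
    (fun p : EuclideanSpace ℝ (Fin n) × EuclideanSpace ℝ (Fin m) × EuclideanSpace ℝ (Fin l) =>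
      g i p.1 p.2.1 p.2.2) (univ ×ˢ U ×ˢ V)
  /-- `(x, u) ↦ g i x u v` is locally Lipschitz on `ℝⁿ × U`, uniformly in `v ∈ V`. -/
  locallyLipschitz : ∀ i, ∀ x : EuclideanSpace ℝ (Fin n), ∀ u ∈ U,
    ∃ L : ℝ≥0, ∃ W ∈ 𝓝[univ ×ˢ U] (x, u), ∀ v ∈ V,
      LipschitzOnWith L
        (fun p : EuclideanSpace ℝ (Fin n) × EuclideanSpace ℝ (Fin m) => g i p.1 p.2 v) W
  growth : ∃ M : ℝ, 0 < M ∧ ∀ i, ∀ x, ∀ u ∈ U, ∀ v ∈ V, ‖g i x u v‖ ≤ M * (1 + ‖(x, u)‖)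

/-- `v` represents an element of `L¹(I, V)`. -/
def MemL1Into {l : ℕ} (v : ℝ → EuclideanSpace ℝ (Fin l)) (I : Set ℝ)
    (V : Set (EuclideanSpace ℝ (Fin l))) : Prop :=
  IntegrableOn v I ∧ ∀ᵐ t ∂(volume.restrict I), v t ∈ V

/-- `x` is a Carathéodory solution on `[0, T]` of
`ẋ = g₀(x, u, v₁) + ∑ gᵢ(x, u, v₂) u̇ᵢ`, `x(0) = x₀`, for an absolutely continuous `u`. -/
structure IsCaratheodorySolution {n m l : ℕ}
    (g : Fin (m + 1) → EuclideanSpace ℝ (Fin n) → EuclideanSpace ℝ (Fin m) →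
      EuclideanSpace ℝ (Fin l) → EuclideanSpace ℝ (Fin n))
    (T : ℝ) (x₀ : EuclideanSpace ℝ (Fin n)) (u : ℝ → EuclideanSpace ℝ (Fin m))
    (v₁ v₂ : ℝ → EuclideanSpace ℝ (Fin l)) (x : ℝ → EuclideanSpace ℝ (Fin n)) : Prop where
  absolutelyContinuous : AbsolutelyContinuousOnInterval x 0 T
  initial : x 0 = x₀
  ode : ∀ᵐ t ∂(volume.restrict (Icc 0 T)),
    HasDerivAt x (g 0 (x t) (u t) (v₁ t) +
      ∑ i : Fin m, (deriv u t) i • g i.succ (x t) (u t) (v₂ t)) t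

/-- The arc-length change of time `σ(t) = t + Var_{[0,t]}(u)`. -/
noncomputable def arcLength {m : ℕ} (u : ℝ → EuclideanSpace ℝ (Fin m)) (t : ℝ) : ℝ :=
  t + (eVariationOn u (Icc 0 t)).toReal

/-- The inverse of `arcLength u : [0, T] → [0, T + Var_{[0,T]}(u)]`. -/
noncomputable def arcLengthInv {m : ℕ} (u : ℝ → EuclideanSpace ℝ (Fin m)) (T : ℝ) : ℝ → ℝ :=
  Function.invFunOn (arcLength u) (Icc 0 T)

/-- `x` is an extended BV simple limit solution corresponding to `(u, v₁, v₂)`. -/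
def IsEBVSLimitSolution {n m l : ℕ} (U : Set (EuclideanSpace ℝ (Fin m)))
    (V : Set (EuclideanSpace ℝ (Fin l)))
    (g : Fin (m + 1) → EuclideanSpace ℝ (Fin n) → EuclideanSpace ℝ (Fin m) →
      EuclideanSpace ℝ (Fin l) → EuclideanSpace ℝ (Fin n))
    (T : ℝ) (x₀ : EuclideanSpace ℝ (Fin n)) (u₀ : EuclideanSpace ℝ (Fin m))
    (u : ℝ → EuclideanSpace ℝ (Fin m)) (v₁ v₂ : ℝ → EuclideanSpace ℝ (Fin l))
    (x : ℝ → EuclideanSpace ℝ (Fin n)) : Prop :=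
  IntegrableOn x (Icc 0 T) ∧
  ∃ (uk : ℕ → ℝ → EuclideanSpace ℝ (Fin m)) (v₁k v₂k : ℕ → ℝ → EuclideanSpace ℝ (Fin l))
    (xk : ℕ → ℝ → EuclideanSpace ℝ (Fin n)),
    -- the approximating controls are regular, with equibounded variation
    (∀ k, AbsolutelyContinuousOnInterval (uk k) 0 T ∧ MapsTo (uk k) (Icc 0 T) U ∧
      uk k 0 = u₀ ∧ MemL1Into (v₁k k) (Icc 0 T) V ∧ MemL1Into (v₂k k) (Icc 0 T) V) ∧
    (∃ K : ℝ≥0, ∀ k, eVariationOn (uk k) (Icc 0 T) ≤ K) ∧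
    (∀ k, IsCaratheodorySolution g T x₀ (uk k) (v₁k k) (v₂k k) (xk k)) ∧
    -- pointwise convergence of `(x_k, u_k)` and `L¹` convergence of `(x_k, u_k, v_k)`
    (∀ τ ∈ Icc 0 T, Tendsto (fun k => xk k τ) atTop (𝓝 (x τ)) ∧
      Tendsto (fun k => uk k τ) atTop (𝓝 (u τ))) ∧
    Tendsto (fun k => eLpNorm (xk k - x) 1 (volume.restrict (Icc 0 T))) atTop (𝓝 0) ∧
    Tendsto (fun k => eLpNorm (uk k - u) 1 (volume.restrict (Icc 0 T))) atTop (𝓝 0) ∧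
    Tendsto (fun k => eLpNorm (v₁k k - v₁) 1 (volume.restrict (Icc 0 T))) atTop (𝓝 0) ∧
    Tendsto (fun k => eLpNorm (v₂k k - v₂) 1 (volume.restrict (Icc 0 T))) atTop (𝓝 0) ∧
    -- `L¹` convergence of `v_{2,k}` in the arc-length variable; only local integrability of `ψ₂`
    -- is asked, since a `V`-valued map on the half-line need not be integrable
    ∃ ψ₂ : ℝ → EuclideanSpace ℝ (Fin l),
      LocallyIntegrableOn ψ₂ (Ici 0) ∧ (∀ᵐ s ∂(volume.restrict (Ici 0)), ψ₂ s ∈ V) ∧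
      Tendsto (fun k => eLpNorm (fun s => v₂k k (arcLengthInv (uk k) T s) - ψ₂ s) 1
        (volume.restrict (Icc 0 (T + (eVariationOn (uk k) (Icc 0 T)).toReal)))) atTop (𝓝 0)

/-- `(φ₀, φ, ψ₁, ψ₂, S)` is a feasible space-time control starting at `(0, u₀)` and ending at
time `T`. -/
structure IsFeasibleSpaceTimeControl {m l : ℕ} (U : Set (EuclideanSpace ℝ (Fin m)))
    (V : Set (EuclideanSpace ℝ (Fin l))) (T : ℝ) (u₀ : EuclideanSpace ℝ (Fin m))
    (φ₀ : ℝ → ℝ) (φ : ℝ → EuclideanSpace ℝ (Fin m)) (ψ₁ ψ₂ : ℝ → EuclideanSpace ℝ (Fin l))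
    (S : ℝ) : Prop where
  pos : 0 < S
  lipschitz : ∃ L : ℝ≥0, LipschitzOnWith L (fun s => (φ₀ s, φ s)) (Icc 0 S)
  nonneg : ∀ s ∈ Icc 0 S, 0 ≤ φ₀ s
  mapsTo : MapsTo φ (Icc 0 S) U
  time_zero : φ₀ 0 = 0
  control_zero : φ 0 = u₀
  time_end : φ₀ S = T
  deriv_nonneg : ∀ᵐ s ∂(volume.restrict (Icc 0 S)), 0 ≤ deriv φ₀ s
  arc_length : ∀ᵐ s ∂(volume.restrict (Icc 0 S)), deriv φ₀ s + ‖deriv φ s‖ = 1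
  memL1_fst : MemL1Into ψ₁ (Icc 0 S) V
  memL1_snd : MemL1Into ψ₂ (Icc 0 S) V

/-- The space-time control `(φ₀, φ, ψ₁, ψ₂, S)` is a graph completion of `(u, v₁, v₂)`. The maps
`v₁, v₂, ψ₁, ψ₂` are classes modulo null sets, so they are matched for almost every `t`. -/
structure IsGraphCompletion {m l : ℕ} (U : Set (EuclideanSpace ℝ (Fin m)))
    (V : Set (EuclideanSpace ℝ (Fin l))) (T : ℝ) (u₀ : EuclideanSpace ℝ (Fin m))
    (u : ℝ → EuclideanSpace ℝ (Fin m)) (v₁ v₂ : ℝ → EuclideanSpace ℝ (Fin l))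
    (φ₀ : ℝ → ℝ) (φ : ℝ → EuclideanSpace ℝ (Fin m)) (ψ₁ ψ₂ : ℝ → EuclideanSpace ℝ (Fin l))
    (S : ℝ) : Prop where
  feasible : IsFeasibleSpaceTimeControl U V T u₀ φ₀ φ ψ₁ ψ₂ S
  graph : ∀ t ∈ Icc 0 T, ∃ s ∈ Icc 0 S, φ₀ s = t ∧ φ s = u t
  graph_ae : ∀ᵐ t ∂(volume.restrict (Icc 0 T)), ∃ s ∈ Icc 0 S,
    φ₀ s = t ∧ φ s = u t ∧ ψ₁ s = v₁ t ∧ ψ₂ s = v₂ t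

/-- A clock: a strictly increasing `σ : [0, T] → [0, S]`, with `σ(0) = 0` and `σ(T) = S`, along
which the completed graph passes through `(t, u(t))`. -/
structure IsClock {m : ℕ} (T : ℝ) (u : ℝ → EuclideanSpace ℝ (Fin m)) (φ₀ : ℝ → ℝ)
    (φ : ℝ → EuclideanSpace ℝ (Fin m)) (S : ℝ) (σ : ℝ → ℝ) : Prop where
  strictMono : StrictMonoOn σ (Icc 0 T)
  zero : σ 0 = 0
  final : σ T = S
  graph : ∀ t ∈ Icc 0 T, φ₀ (σ t) = t ∧ φ (σ t) = u t

/-- `ξ` solves the space-time control system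
`ξ' = g₀(ξ, φ, ψ₁) φ₀' + ∑ gᵢ(ξ, φ, ψ₂) φᵢ'` a.e. on `[0, S]`, `ξ(0) = x₀`. -/
structure IsSpaceTimeSolution {n m l : ℕ}
    (g : Fin (m + 1) → EuclideanSpace ℝ (Fin n) → EuclideanSpace ℝ (Fin m) →
      EuclideanSpace ℝ (Fin l) → EuclideanSpace ℝ (Fin n))
    (x₀ : EuclideanSpace ℝ (Fin n)) (φ₀ : ℝ → ℝ) (φ : ℝ → EuclideanSpace ℝ (Fin m))
    (ψ₁ ψ₂ : ℝ → EuclideanSpace ℝ (Fin l)) (S : ℝ) (ξ : ℝ → EuclideanSpace ℝ (Fin n)) :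
    Prop where
  absolutelyContinuous : AbsolutelyContinuousOnInterval ξ 0 S
  initial : ξ 0 = x₀
  ode : ∀ᵐ s ∂(volume.restrict (Icc 0 S)),
    HasDerivAt ξ (deriv φ₀ s • g 0 (ξ s) (φ s) (ψ₁ s) +
      ∑ i : Fin m, (deriv φ s) i • g i.succ (ξ s) (φ s) (ψ₂ s)) s

/-- `x` is a graph completion solution associated to `(u, v₁, v₂)`: `x = ξ ∘ σ` on `[0, T]`. -/
def IsGraphCompletionSolution {n m l : ℕ} (U : Set (EuclideanSpace ℝ (Fin m)))
    (V : Set (EuclideanSpace ℝ (Fin l)))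
    (g : Fin (m + 1) → EuclideanSpace ℝ (Fin n) → EuclideanSpace ℝ (Fin m) →
      EuclideanSpace ℝ (Fin l) → EuclideanSpace ℝ (Fin n))
    (T : ℝ) (x₀ : EuclideanSpace ℝ (Fin n)) (u₀ : EuclideanSpace ℝ (Fin m))
    (u : ℝ → EuclideanSpace ℝ (Fin m)) (v₁ v₂ : ℝ → EuclideanSpace ℝ (Fin l))
    (x : ℝ → EuclideanSpace ℝ (Fin n)) : Prop :=
  ∃ (S : ℝ) (φ₀ : ℝ → ℝ) (φ : ℝ → EuclideanSpace ℝ (Fin m))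
    (ψ₁ ψ₂ : ℝ → EuclideanSpace ℝ (Fin l)) (σ : ℝ → ℝ) (ξ : ℝ → EuclideanSpace ℝ (Fin n)),
    IsGraphCompletion U V T u₀ u v₁ v₂ φ₀ φ ψ₁ ψ₂ S ∧
    IsClock T u φ₀ φ S σ ∧
    IsSpaceTimeSolution g x₀ φ₀ φ ψ₁ ψ₂ S ξ ∧
    ∀ t ∈ Icc 0 T, x t = ξ (σ t)

/-! An absolutely continuous control, traversed by the arc length `s = t + Var_{[0,t]}(u)`, turns
into a Lipschitz curve `s ↦ (t, u)`, and its state into a Lipschitz curve solving the space-time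
system. Bounded variation means bounded length, so Arzelà–Ascoli applies in `s` even when the limit
control jumps in `t`. Curves are described by their densities (`HasDensityOn`), so that only
integral identities have to pass to the limit.

The core is closure of the system under these limits,
`StandingAssumptions.isSpaceTimeTrajectory_of_tendsto`. The two parts of the equation are treated in
different variables. In the control part the derivatives `φ_k'` converge only weakly, but they
multiply fields that converge strongly, because condition (ii) provides convergence of `v_{2,k}` in
`s`. The drift is integrated in `t`, where `v_{1,k}` converges and where the arc lengths `σ_k(t)`
converge for almost every `t`; a change of variables carries it back to `s`. The limit curve can
move at speed less than one, even rest, so it is reparametrized by its own arc length in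
`IsSpaceTimeTrajectory.isGraphCompletionSolution`; time, control and state are all constant where it
rests.

For the clock, pointwise convergence of `(x_k, u_k)` forces every cluster point `s` of `σ_k(t)` to
satisfy `φ₀ s = t`, `φ s = u t` and `ξ s = x t`. An ultrafilter selects one cluster point for all
`t` at once. For almost every `t` the equation `φ₀ s = t` has a single solution, so there the
selection is an honest limit.

Conversely, a clock `σ` is monotone, hence a pointwise limit of monotone Lipschitz `σ_k` with the
same endpoints (`MonotoneOn.exists_lipschitzWith_tendsto`). The controls `u_k = φ ∘ σ_k` stay in
`U`, their arc length is `t + σ_k(t) - φ₀(σ_k(t)) → σ(t)`, and their total arc length is exactly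
`S`. Choosing `v_{2,k}` as `ψ₂` evaluated at the arc length makes the distance in (ii) zero.
Compactness, closure and uniqueness for the space-time system then identify the limit of the states
with `ξ ∘ σ`. -/

/-! ### Primitives of integrable functions -/

/-- `f` is a primitive on `[0, S]` of the integrable function `p`. -/
def HasDensityOn {E : Type*} [NormedAddCommGroup E] [NormedSpace ℝ E] (f p : ℝ → E) (S : ℝ) :
    Prop :=
  IntegrableOn p (Icc 0 S) ∧ ∀ s ∈ Icc 0 S, f s = f 0 + ∫ τ in (0 : ℝ)..s, p τ

theorem AbsolutelyContinuousOnInterval.of_dist_le {X Y : Type*} [PseudoMetricSpace X]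
    [PseudoMetricSpace Y] {f : ℝ → X} {g : ℝ → Y} {a b : ℝ}
    (hf : AbsolutelyContinuousOnInterval f a b)
    (h : ∀ x ∈ uIcc a b, ∀ y ∈ uIcc a b, dist (g x) (g y) ≤ dist (f x) (f y)) :
    AbsolutelyContinuousOnInterval g a b := by
  rw [absolutelyContinuousOnInterval_iff] at hf ⊢
  intro ε hε
  obtain ⟨δ, hδ, H⟩ := hf ε hε
  refine ⟨δ, hδ, fun I hI hd => lt_of_le_of_lt ?_ (H I hI hd)⟩
  exact Finset.sum_le_sum fun i hi => h _ (hI.1 i hi).1 _ (hI.1 i hi).2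

section HasDensityOn

variable {E : Type*} [NormedAddCommGroup E] [NormedSpace ℝ E] {f p : ℝ → E} {S : ℝ}

theorem HasDensityOn.integrableOn_Icc (h : HasDensityOn f p S) {s t : ℝ} (hs : 0 ≤ s)
    (ht : t ≤ S) : IntegrableOn p (Icc s t) :=
  h.1.mono_set (Icc_subset_Icc hs ht)

theorem HasDensityOn.intervalIntegrable (h : HasDensityOn f p S) {s t : ℝ} (hs : s ∈ Icc 0 S)
    (ht : t ∈ Icc 0 S) : IntervalIntegrable p volume s t := by
  rw [intervalIntegrable_iff]
  exact h.1.mono_set (uIoc_subset_uIcc.trans (uIcc_subset_Icc hs ht))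

theorem HasDensityOn.sub_eq (h : HasDensityOn f p S) {s t : ℝ} (hs : s ∈ Icc 0 S)
    (ht : t ∈ Icc 0 S) : f t - f s = ∫ τ in s..t, p τ := by
  have h0 : (0 : ℝ) ∈ Icc 0 S := ⟨le_rfl, hs.1.trans hs.2⟩
  rw [h.2 t ht, h.2 s hs, add_sub_add_left_eq_sub,
    intervalIntegral.integral_interval_sub_left (h.intervalIntegrable h0 ht)
      (h.intervalIntegrable h0 hs)]

theorem HasDensityOn.mono (h : HasDensityOn f p S) {R : ℝ} (hR : R ≤ S) : HasDensityOn f p R :=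
  ⟨h.integrableOn_Icc le_rfl hR, fun s hs => h.2 s ⟨hs.1, hs.2.trans hR⟩⟩

theorem HasDensityOn.norm_sub_le (h : HasDensityOn f p S) {s t : ℝ} (hs : s ∈ Icc 0 S)
    (ht : t ∈ Icc 0 S) (hst : s ≤ t) : ‖f t - f s‖ ≤ ∫ τ in s..t, ‖p τ‖ := by
  rw [h.sub_eq hs ht]
  exact intervalIntegral.norm_integral_le_integral_norm hst

theorem HasDensityOn.congr (h : HasDensityOn f p S) {g q : ℝ → E} (hfg : EqOn f g (Icc 0 S))
    (hpq : p =ᵐ[volume.restrict (Icc 0 S)] q) : HasDensityOn g q S := by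
  refine ⟨h.1.congr hpq, fun s hs => ?_⟩
  rw [← hfg hs, ← hfg ⟨le_rfl, hs.1.trans hs.2⟩, h.2 s hs]
  congr 1
  rw [intervalIntegral.integral_of_le hs.1, intervalIntegral.integral_of_le hs.1]
  exact integral_congr_ae (ae_restrict_of_ae_restrict_of_subset
    (Ioc_subset_Icc_self.trans (Icc_subset_Icc le_rfl hs.2)) hpq)

theorem HasDensityOn.norm (h : HasDensityOn f p S) :
    HasDensityOn (fun s => ∫ τ in (0 : ℝ)..s, ‖p τ‖) (fun s => ‖p s‖) S :=
  ⟨h.1.norm, fun s _ => by simp⟩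

/-- Increments of `f` are dominated by those of the real primitive of `‖p‖`. -/
theorem HasDensityOn.absolutelyContinuousOnInterval (hS : 0 ≤ S) (h : HasDensityOn f p S) :
    AbsolutelyContinuousOnInterval f 0 S := by
  have hI : IntervalIntegrable (fun s => ‖p s‖) volume 0 S :=
    h.norm.intervalIntegrable ⟨le_rfl, hS⟩ ⟨hS, le_rfl⟩
  refine (hI.absolutelyContinuousOnInterval_intervalIntegral (c := 0) left_mem_uIcc).of_dist_le ?_
  rw [uIcc_of_le hS]
  have key : ∀ x ∈ Icc 0 S, ∀ y ∈ Icc 0 S, x ≤ y → dist (f x) (f y) ≤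
      dist (∫ τ in (0 : ℝ)..x, ‖p τ‖) (∫ τ in (0 : ℝ)..y, ‖p τ‖) := by
    intro x hx y hy hxy
    rw [dist_comm, dist_eq_norm, dist_comm, dist_eq_norm]
    have := h.norm.sub_eq hx hy
    rw [this, Real.norm_eq_abs]
    exact (h.norm_sub_le hx hy hxy).trans (le_abs_self _)
  intro x hx y hy
  rcases le_total x y with hxy | hxy
  · exact key x hx y hy hxy
  · rw [dist_comm, dist_comm (∫ τ in (0 : ℝ)..x, ‖p τ‖)]
    exact key y hy x hx hxy

theorem HasDensityOn.continuousOn (h : HasDensityOn f p S) : ContinuousOn f (Icc 0 S) := by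
  rcases lt_or_ge S 0 with hS | hS
  · simp [Icc_eq_empty_of_lt hS]
  · simpa [uIcc_of_le hS] using (h.absolutelyContinuousOnInterval hS).continuousOn

theorem HasDensityOn.ae_hasDerivAt [CompleteSpace E] (h : HasDensityOn f p S) :
    ∀ᵐ s ∂(volume.restrict (Icc 0 S)), HasDerivAt f (p s) s := by
  rcases lt_or_ge S 0 with hS | hS
  · simp [Icc_eq_empty_of_lt hS]
  have h0 : (0 : ℝ) ∈ Icc 0 S := ⟨le_rfl, hS⟩
  have hI := (h.intervalIntegrable h0 ⟨hS, le_rfl⟩).ae_hasDerivAt_integral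
  have h₁ : ∀ᵐ x : ℝ, x ≠ 0 := by simp [ae_iff, measure_singleton]
  have h₂ : ∀ᵐ x : ℝ, x ≠ S := by simp [ae_iff, measure_singleton]
  rw [ae_restrict_iff' measurableSet_Icc]
  filter_upwards [hI, h₁, h₂] with s hs hs0 hsS hmem
  rw [uIcc_of_le hS] at hs
  refine ((hs hmem 0 h0).const_add (f 0)).congr_of_eventuallyEq ?_
  filter_upwards [Icc_mem_nhds (lt_of_le_of_ne hmem.1 hs0.symm) (lt_of_le_of_ne hmem.2 hsS)]
    with y hy
  exact h.2 y hy

theorem HasDensityOn.lipschitzOnWith (h : HasDensityOn f p S) {C : ℝ≥0}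
    (hC : ∀ᵐ s ∂(volume.restrict (Icc 0 S)), ‖p s‖ ≤ C) : LipschitzOnWith C f (Icc 0 S) := by
  have key : ∀ x ∈ Icc 0 S, ∀ y ∈ Icc 0 S, x ≤ y → dist (f x) (f y) ≤ C * dist x y := by
    intro x hx y hy hxy
    rw [dist_comm, dist_eq_norm, h.sub_eq hx hy, dist_comm, Real.dist_eq]
    refine intervalIntegral.norm_integral_le_of_norm_le_const_ae ?_
    rw [ae_restrict_iff' measurableSet_Icc] at hC
    filter_upwards [hC] with s hs hmem
    rw [uIoc_of_le hxy] at hmem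
    exact hs ⟨hx.1.trans hmem.1.le, hmem.2.trans hy.2⟩
  refine LipschitzOnWith.of_dist_le_mul fun x hx y hy => ?_
  rcases le_total x y with hxy | hxy
  · exact key x hx y hy hxy
  · rw [dist_comm, dist_comm x]
    exact key y hy x hx hxy

theorem HasDensityOn.clm_comp {F : Type*} [NormedAddCommGroup F] [NormedSpace ℝ F]
    [CompleteSpace E] [CompleteSpace F]
    (h : HasDensityOn f p S) (A : E →L[ℝ] F) :
    HasDensityOn (fun s => A (f s)) (fun s => A (p s)) S := by
  refine ⟨A.integrable_comp h.1, fun s hs => ?_⟩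
  beta_reduce
  rw [h.2 s hs, map_add, A.intervalIntegral_comp_comm
    (h.intervalIntegrable ⟨le_rfl, hs.1.trans hs.2⟩ hs)]

end HasDensityOn

theorem HasDensityOn.monotoneOn {a α : ℝ → ℝ} {S : ℝ} (h : HasDensityOn a α S)
    (h0 : ∀ᵐ s ∂(volume.restrict (Icc 0 S)), 0 ≤ α s) : MonotoneOn a (Icc 0 S) := by
  intro x hx y hy hxy
  rw [← sub_nonneg, h.sub_eq hx hy]
  refine intervalIntegral.integral_nonneg_of_ae_restrict hxy ?_
  exact ae_restrict_of_ae_restrict_of_subset (Icc_subset_Icc hx.1 hy.2) h0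

/-- The real fundamental theorem of calculus is applied to each coordinate; finite dimension turns
integrability of the coordinates into integrability of the derivative. -/
theorem AbsolutelyContinuousOnInterval.hasDensityOn {n : ℕ} {f : ℝ → EuclideanSpace ℝ (Fin n)}
    {S : ℝ} (hS : 0 ≤ S) (hf : AbsolutelyContinuousOnInterval f 0 S) :
    HasDensityOn f (deriv f) S := by
  have hd : ∀ᵐ x ∂(volume.restrict (Icc 0 S)), DifferentiableAt ℝ f x := by
    rw [ae_restrict_iff' measurableSet_Icc, ← uIcc_of_le hS]
    exact hf.boundedVariationOn.ae_differentiableAt_of_mem_uIcc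
  have hcoord : ∀ i, AbsolutelyContinuousOnInterval (fun t => f t i) 0 S := fun i =>
    hf.of_dist_le fun x _ y _ => by
      simpa [dist_eq_norm] using PiLp.norm_apply_le (f x - f y) i
  have hder : ∀ i, (fun t => deriv f t i) =ᵐ[volume.restrict (Icc 0 S)]
      deriv (fun t => f t i) := by
    intro i
    filter_upwards [hd] with x hx
    have := ((EuclideanSpace.proj i : EuclideanSpace ℝ (Fin n) →L[ℝ] ℝ).hasFDerivAt
      (x := f x)).comp_hasDerivAt x hx.hasDerivAt
    exact this.deriv.symm
  have hInt : ∀ i, IntegrableOn (fun t => deriv f t i) (Icc 0 S) := by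
    intro i
    have h1 := (hcoord i).intervalIntegrable_deriv
    rw [intervalIntegrable_iff_integrableOn_Icc_of_le hS] at h1
    exact h1.congr (hder i).symm
  have hI : IntegrableOn (deriv f) (Icc 0 S) := by
    unfold IntegrableOn
    have hm := measurable_deriv f
    refine ((integrable_finsetSum (s := Finset.univ) (f := fun i t => ‖deriv f t i‖)
      fun i _ => (hInt i).norm)).mono' hm.aestronglyMeasurable ?_
    filter_upwards with t
    have : deriv f t = ∑ i, EuclideanSpace.single i (deriv f t i) := by
      ext j; simp [Finset.sum_apply, Pi.single_apply]
    conv_lhs => rw [this]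
    refine (norm_sum_le _ _).trans (by simp)
  refine ⟨hI, fun s hs => ?_⟩
  have hsub : uIcc 0 s ⊆ uIcc 0 S := by
    rw [uIcc_of_le hS, uIcc_of_le hs.1]; exact Icc_subset_Icc le_rfl hs.2
  ext i
  have h1 := ((hcoord i).mono hsub).integral_deriv_eq_sub
  have h2 : (∫ τ in (0 : ℝ)..s, deriv f τ) i = ∫ τ in (0 : ℝ)..s, deriv f τ i := by
    have := (EuclideanSpace.proj i : EuclideanSpace ℝ (Fin n) →L[ℝ] ℝ).intervalIntegral_comp_comm
      (μ := volume) (a := 0) (b := s) (f := deriv f) (by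
        rw [intervalIntegrable_iff_integrableOn_Icc_of_le hs.1]
        exact hI.mono_set (Icc_subset_Icc le_rfl hs.2))
    exact this.symm
  rw [PiLp.add_apply, h2]
  have h3 : ∫ τ in (0 : ℝ)..s, deriv f τ i = ∫ τ in (0 : ℝ)..s, deriv (fun t => f t i) τ := by
    rw [intervalIntegral.integral_of_le hs.1, intervalIntegral.integral_of_le hs.1]
    exact integral_congr_ae (ae_restrict_of_ae_restrict_of_subset
      (Ioc_subset_Icc_self.trans (Icc_subset_Icc le_rfl hs.2)) (hder i))
  rw [h3, h1]; ring

theorem AbsolutelyContinuousOnInterval.hasDensityOn_real {f : ℝ → ℝ}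
    {S : ℝ} (hS : 0 ≤ S) (hf : AbsolutelyContinuousOnInterval f 0 S) :
    HasDensityOn f (deriv f) S := by
  have h1 := hf.intervalIntegrable_deriv
  rw [intervalIntegrable_iff_integrableOn_Icc_of_le hS] at h1
  refine ⟨h1, fun s hs => ?_⟩
  have hsub : uIcc 0 s ⊆ uIcc 0 S := by
    rw [uIcc_of_le hS, uIcc_of_le hs.1]; exact Icc_subset_Icc le_rfl hs.2
  rw [(hf.mono hsub).integral_deriv_eq_sub]; ring

/-! ### Variation and arc length -/

theorem eVariationOn_le_of_edist_le {X Y : Type*} [PseudoEMetricSpace X] [PseudoEMetricSpace Y]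
    {f : ℝ → X} {g : ℝ → Y} {s : Set ℝ}
    (h : ∀ x ∈ s, ∀ y ∈ s, edist (f x) (f y) ≤ edist (g x) (g y)) :
    eVariationOn f s ≤ eVariationOn g s := by
  unfold eVariationOn
  exact iSup_mono fun p => Finset.sum_le_sum fun i _ => h _ (p.2.2.2 _) _ (p.2.2.2 _)

/-- Comparison of difference quotients at a common point of differentiability. -/
theorem norm_deriv_le_of_norm_sub_le {E F : Type*} [NormedAddCommGroup E] [NormedSpace ℝ E]
    [NormedAddCommGroup F] [NormedSpace ℝ F] {f : ℝ → E} {g : ℝ → F} {f' : E} {g' : F} {x : ℝ}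
    (hf : HasDerivAt f f' x) (hg : HasDerivAt g g' x)
    (h : ∀ᶠ y in 𝓝 x, ‖f y - f x‖ ≤ ‖g y - g x‖) : ‖f'‖ ≤ ‖g'‖ := by
  have h1 := (hasDerivAt_iff_tendsto_slope.1 hf).norm
  have h2 := (hasDerivAt_iff_tendsto_slope.1 hg).norm
  refine le_of_tendsto_of_tendsto h1 h2 ?_
  filter_upwards [h.filter_mono nhdsWithin_le_nhds] with y hy
  simp only [slope, vsub_eq_sub, norm_smul]
  gcongr

/-- The increments of `f` are dominated by those of the monotone function `∫ ‖p‖`, whose variation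
is its total increment. -/
theorem HasDensityOn.eVariationOn_Icc_le {E : Type*} [NormedAddCommGroup E] [NormedSpace ℝ E]
    {f p : ℝ → E} {S : ℝ} (h : HasDensityOn f p S) {s t : ℝ} (hs : 0 ≤ s) (hst : s ≤ t)
    (ht : t ≤ S) : eVariationOn f (Icc s t) ≤ ENNReal.ofReal (∫ τ in s..t, ‖p τ‖) := by
  have hs' : s ∈ Icc 0 S := ⟨hs, hst.trans ht⟩
  have ht' : t ∈ Icc 0 S := ⟨hs.trans hst, ht⟩
  set N : ℝ → ℝ := fun s => ∫ τ in (0 : ℝ)..s, ‖p τ‖ with hN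
  have hmono : MonotoneOn N (Icc 0 S) := h.norm.monotoneOn (by simp)
  rw [← h.norm.sub_eq hs' ht']
  have h1 : eVariationOn f (Icc s t) ≤ eVariationOn N (Icc s t) := by
    refine eVariationOn_le_of_edist_le ?_
    have key : ∀ x ∈ Icc s t, ∀ y ∈ Icc s t, x ≤ y → edist (f x) (f y) ≤ edist (N x) (N y) := by
      intro x hx y hy hxy
      have hx' : x ∈ Icc 0 S := ⟨hs.trans hx.1, hx.2.trans ht⟩
      have hy' : y ∈ Icc 0 S := ⟨hs.trans hy.1, hy.2.trans ht⟩
      rw [edist_comm, edist_dist, edist_comm, edist_dist]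
      refine ENNReal.ofReal_le_ofReal ?_
      rw [dist_eq_norm, Real.dist_eq]
      refine le_trans ?_ (le_abs_self _)
      exact (h.norm_sub_le hx' hy' hxy).trans_eq (h.norm.sub_eq hx' hy').symm
    intro x hx y hy
    rcases le_total x y with hxy | hxy
    · exact key x hx y hy hxy
    · rw [edist_comm, edist_comm (N x)]
      exact key y hy x hx hxy
  refine h1.trans ?_
  have := (hmono.mono (Icc_subset_Icc hs ht)).eVariationOn_eq
    (left_mem_Icc.2 hst) (right_mem_Icc.2 hst)
  rw [inter_self] at this
  exact this.le

/-- The variation of an absolutely continuous curve is the integral of its speed. -/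
theorem HasDensityOn.eVariationOn_Icc {E : Type*} [NormedAddCommGroup E] [NormedSpace ℝ E]
    [CompleteSpace E] {f p : ℝ → E} {S : ℝ} (h : HasDensityOn f p S) {t : ℝ} (ht : t ∈ Icc 0 S) :
    eVariationOn f (Icc 0 t) = ENNReal.ofReal (∫ τ in (0 : ℝ)..t, ‖p τ‖) := by
  have hS : 0 ≤ S := ht.1.trans ht.2
  refine le_antisymm (h.eVariationOn_Icc_le le_rfl ht.1 ht.2) ?_
  -- For the lower bound, the increments of the variation function `W` are at most those of `∫ ‖p‖`,
  -- so `W` is absolutely continuous; they are at least those of `f`, so `‖p‖ ≤ W'` almost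
  -- everywhere. Integration concludes.
  set W : ℝ → ℝ := fun t => (eVariationOn f (Icc 0 t)).toReal with hW
  have hfin : ∀ {x y}, 0 ≤ x → x ≤ y → y ≤ S → eVariationOn f (Icc x y) ≠ ⊤ := fun h0 hxy hy =>
    ((h.eVariationOn_Icc_le h0 hxy hy).trans_lt ENNReal.ofReal_lt_top).ne
  have hadd : ∀ x ∈ Icc 0 S, ∀ y ∈ Icc 0 S, x ≤ y →
      W y - W x = (eVariationOn f (Icc x y)).toReal := by
    intro x hx y hy hxy
    have := eVariationOn.Icc_add_Icc f (s := univ) hx.1 hxy (mem_univ x)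
    simp only [univ_inter] at this
    simp only [hW]
    rw [← this, ENNReal.toReal_add (hfin le_rfl hx.1 hx.2) (hfin hx.1 hxy hy.2)]
    ring
  have hle : ∀ x ∈ Icc 0 S, ∀ y ∈ Icc 0 S, x ≤ y → ‖f y - f x‖ ≤ W y - W x := by
    intro x hx y hy hxy
    rw [hadd x hx y hy hxy, ← ENNReal.ofReal_le_iff_le_toReal (hfin hx.1 hxy hy.2),
      ← dist_eq_norm, ← edist_dist]
    exact eVariationOn.edist_le f (right_mem_Icc.2 hxy) (left_mem_Icc.2 hxy)
  have hle' : ∀ x ∈ Icc 0 S, ∀ y ∈ Icc 0 S, x ≤ y → W y - W x ≤ ∫ τ in x..y, ‖p τ‖ := by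
    intro x hx y hy hxy
    rw [hadd x hx y hy hxy]
    exact ENNReal.toReal_le_of_le_ofReal
      (intervalIntegral.integral_nonneg hxy fun _ _ => norm_nonneg _)
      (h.eVariationOn_Icc_le hx.1 hxy hy.2)
  have hmonoW : MonotoneOn W (Icc 0 S) := fun x hx y hy hxy => by
    have := (norm_nonneg _).trans (hle x hx y hy hxy); linarith
  have hWac : AbsolutelyContinuousOnInterval W 0 S := by
    refine (h.norm.absolutelyContinuousOnInterval hS).of_dist_le ?_
    rw [uIcc_of_le hS]
    have key : ∀ x ∈ Icc 0 S, ∀ y ∈ Icc 0 S, x ≤ y → dist (W x) (W y) ≤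
        dist (∫ τ in (0 : ℝ)..x, ‖p τ‖) (∫ τ in (0 : ℝ)..y, ‖p τ‖) := by
      intro x hx y hy hxy
      rw [dist_comm, Real.dist_eq, dist_comm, Real.dist_eq, h.norm.sub_eq hx hy,
        abs_of_nonneg (sub_nonneg.2 (hmonoW hx hy hxy))]
      exact (hle' x hx y hy hxy).trans (le_abs_self _)
    intro x hx y hy
    rcases le_total x y with hxy | hxy
    · exact key x hx y hy hxy
    · rw [dist_comm, dist_comm (∫ τ in (0 : ℝ)..x, ‖p τ‖)]
      exact key y hy x hx hxy
  have hWd := hWac.hasDensityOn_real hS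
  have hae : ∀ᵐ s ∂(volume.restrict (Icc 0 S)), ‖p s‖ ≤ deriv W s := by
    have h₁ : ∀ᵐ x : ℝ, x ≠ 0 := by simp [ae_iff, measure_singleton]
    have h₂ : ∀ᵐ x : ℝ, x ≠ S := by simp [ae_iff, measure_singleton]
    filter_upwards [hWd.ae_hasDerivAt, h.ae_hasDerivAt, ae_restrict_mem measurableSet_Icc,
      ae_restrict_of_ae h₁, ae_restrict_of_ae h₂] with s hs1 hs2 hs hs0 hsS
    have hnhds : Icc 0 S ∈ 𝓝 s :=
      Icc_mem_nhds (lt_of_le_of_ne hs.1 hs0.symm) (lt_of_le_of_ne hs.2 hsS)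
    have h3 : ‖p s‖ ≤ ‖deriv W s‖ := by
      refine norm_deriv_le_of_norm_sub_le hs2 hs1 ?_
      filter_upwards [hnhds] with y hy
      rcases le_total s y with hsy | hsy
      · exact (hle s hs y hy hsy).trans (le_abs_self _)
      · rw [norm_sub_rev, norm_sub_rev (W y)]
        exact (hle y hy s hs hsy).trans (le_abs_self _)
    have h4 : 0 ≤ deriv W s := by
      refine ge_of_tendsto (hasDerivAt_iff_tendsto_slope.1 hs1) ?_
      filter_upwards [nhdsWithin_le_nhds hnhds] with y hy
      exact hmonoW.slope_nonneg hs hy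
    rwa [Real.norm_of_nonneg h4] at h3
  have hW0 : W 0 = 0 := by simp [hW, eVariationOn.subsingleton]
  rw [ENNReal.ofReal_le_iff_le_toReal (hfin le_rfl ht.1 ht.2)]
  have h5 := hWd.2 t ht
  rw [hW0, zero_add] at h5
  change _ ≤ W t
  rw [h5]
  have h00 : (0 : ℝ) ∈ Icc 0 S := ⟨le_rfl, hS⟩
  refine intervalIntegral.integral_mono_ae_restrict ht.1 (h.norm.intervalIntegrable h00 ht)
    (hWd.intervalIntegrable h00 ht) ?_
  exact ae_restrict_of_ae_restrict_of_subset (Icc_subset_Icc le_rfl ht.2) hae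

theorem HasDensityOn.arcLength {m : ℕ} {u p : ℝ → EuclideanSpace ℝ (Fin m)} {S : ℝ}
    (h : HasDensityOn u p S) : HasDensityOn (arcLength u) (fun t => 1 + ‖p t‖) S := by
  refine ⟨(integrable_const _).add h.1.norm, fun s hs => ?_⟩
  have h00 : (0 : ℝ) ∈ Icc 0 S := ⟨le_rfl, hs.1.trans hs.2⟩
  rw [intervalIntegral.integral_add (by simp) (h.norm.intervalIntegrable h00 hs)]
  unfold _root_.arcLength
  rw [h.eVariationOn_Icc hs, h.eVariationOn_Icc h00, ENNReal.toReal_ofReal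
    (intervalIntegral.integral_nonneg hs.1 fun _ _ => norm_nonneg _)]
  simp

/-! ### Monotone changes of variable and their right inverses -/

/-- Preimages exist by the intermediate value theorem, and any choice of them is monotone because
`a` is. Clamping the argument makes the choice monotone on the whole line, hence Borel. -/
theorem exists_monotone_rightInverse {a : ℝ → ℝ} {S : ℝ} (hS : 0 ≤ S)
    (hc : ContinuousOn a (Icc 0 S)) (hm : MonotoneOn a (Icc 0 S)) (h0 : a 0 = 0) :
    ∃ b : ℝ → ℝ, Monotone b ∧ (∀ y, b y ∈ Icc 0 S) ∧ ∀ y ∈ Icc 0 (a S), a (b y) = y := by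
  have h00 : (0 : ℝ) ∈ Icc 0 S := ⟨le_rfl, hS⟩
  have hSS : S ∈ Icc 0 S := ⟨hS, le_rfl⟩
  have haS : 0 ≤ a S := h0 ▸ hm h00 hSS hS
  have hsurj : ∀ y ∈ Icc 0 (a S), ∃ x ∈ Icc 0 S, a x = y := by
    intro y hy
    have := intermediate_value_Icc hS hc
    rw [h0] at this
    exact this hy
  choose! c hcm hca using hsurj
  have hclamp : ∀ y, max 0 (min y (a S)) ∈ Icc 0 (a S) := fun y =>
    ⟨le_max_left _ _, max_le haS (min_le_right _ _)⟩
  refine ⟨fun y => c (max 0 (min y (a S))), ?_, fun y => hcm _ (hclamp y), ?_⟩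
  · intro y z hyz
    have h1 : max 0 (min y (a S)) ≤ max 0 (min z (a S)) := by gcongr
    rcases h1.eq_or_lt with h2 | h2
    · simp [h2]
    · by_contra! hlt
      have := hm (hcm _ (hclamp z)) (hcm _ (hclamp y)) hlt.le
      rw [hca _ (hclamp z), hca _ (hclamp y)] at this
      exact absurd this (not_le.2 h2)
  · intro y hy
    beta_reduce
    rw [min_eq_left hy.2, max_eq_right hy.1, hca y hy]

section ChangeOfVariables

variable {a α : ℝ → ℝ} {S : ℝ}

theorem HasDensityOn.aemeasurable_withDensity (h : HasDensityOn a α S) (f : ℝ → ℝ≥0∞) :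
    AEMeasurable a ((volume.restrict (Icc 0 S)).withDensity f) :=
  (h.continuousOn.aemeasurable measurableSet_Icc).mono_ac (withDensity_absolutelyContinuous _ _)

theorem HasDensityOn.lintegral_Icc (h : HasDensityOn a α S)
    (h0 : ∀ᵐ s ∂(volume.restrict (Icc 0 S)), 0 ≤ α s) (ha0 : a 0 = 0) {s : ℝ} (hs : s ∈ Icc 0 S) :
    ∫⁻ τ in Icc 0 s, ENNReal.ofReal (α τ) = ENNReal.ofReal (a s) := by
  have hsub : Icc 0 s ⊆ Icc 0 S := Icc_subset_Icc le_rfl hs.2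
  rw [← ofReal_integral_eq_lintegral_ofReal (h.1.mono_set hsub)
    (ae_restrict_of_ae_restrict_of_subset hsub h0), h.2 s hs, ha0, zero_add,
    integral_Icc_eq_integral_Ioc, intervalIntegral.integral_of_le hs.1]

/-- Change of variables: a nondecreasing primitive of `α` pushes the measure with density `α`
forward to the Lebesgue measure. -/
theorem HasDensityOn.map_withDensity (hS : 0 ≤ S) (h : HasDensityOn a α S)
    (h0 : ∀ᵐ s ∂(volume.restrict (Icc 0 S)), 0 ≤ α s) (ha0 : a 0 = 0) :
    Measure.map a ((volume.restrict (Icc 0 S)).withDensity fun s => ENNReal.ofReal (α s)) =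
      volume.restrict (Icc 0 (a S)) := by
  have h00 : (0 : ℝ) ∈ Icc 0 S := ⟨le_rfl, hS⟩
  have hSS : S ∈ Icc 0 S := ⟨hS, le_rfl⟩
  have hm := h.monotoneOn h0
  have hc := h.continuousOn
  have hproj : ∀ τ, max 0 (min τ S) ∈ Icc 0 S := fun τ =>
    ⟨le_max_left _ _, max_le hS (min_le_right _ _)⟩
  -- Clamping makes `a` continuous and monotone on the whole line without changing it on `[0, S]`.
  set a' : ℝ → ℝ := fun τ => a (max 0 (min τ S)) with ha'
  have haa' : ∀ τ ∈ Icc 0 S, a' τ = a τ := fun τ hτ => by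
    simp [ha', min_eq_left hτ.2, max_eq_right hτ.1]
  have hc' : Continuous a' := hc.comp_continuous (by fun_prop) hproj
  have hm' : Monotone a' := fun x y hxy => hm (hproj x) (hproj y) (by gcongr)
  have hcongr : a =ᵐ[(volume.restrict (Icc 0 S)).withDensity fun s => ENNReal.ofReal (α s)] a' := by
    refine (withDensity_absolutelyContinuous _ _).ae_le ?_
    filter_upwards [ae_restrict_mem measurableSet_Icc] with τ hτ using (haa' τ hτ).symm
  rw [Measure.map_congr hcongr]
  have hfin : IsFiniteMeasure
      ((volume.restrict (Icc 0 S)).withDensity fun s => ENNReal.ofReal (α s)) := by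
    refine isFiniteMeasure_withDensity ?_
    rw [h.lintegral_Icc h0 ha0 hSS]
    exact ENNReal.ofReal_ne_top
  -- A nonempty sublevel set `{a ≤ c}` is an interval `[0, s]`, of mass `a s`; the intermediate
  -- value theorem gives `a s = min c (a S)`.
  refine Measure.ext_of_Iic _ _ fun c => ?_
  rw [Measure.map_apply hc'.measurable measurableSet_Iic,
    withDensity_apply _ (hc'.measurable measurableSet_Iic),
    Measure.restrict_restrict (hc'.measurable measurableSet_Iic),
    Measure.restrict_apply measurableSet_Iic]
  rcases lt_or_ge c 0 with hc0 | hc0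
  · have h1 : a' ⁻¹' Iic c ∩ Icc 0 S = ∅ := by
      refine eq_empty_of_forall_notMem fun τ hτ => ?_
      have h2 : a' τ ≤ c := hτ.1
      rw [haa' τ hτ.2] at h2
      have := hm h00 hτ.2 hτ.2.1
      rw [ha0] at this
      linarith
    have h2 : Iic c ∩ Icc 0 (a S) = ∅ :=
      eq_empty_of_forall_notMem fun τ hτ => by
        have h3 : τ ≤ c := hτ.1
        linarith [hτ.2.1]
    simp [h1, h2]
  · have hcomp : IsCompact (a' ⁻¹' Iic c ∩ Icc 0 S) :=
      isCompact_Icc.inter_left (isClosed_Iic.preimage hc')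
    obtain ⟨s, hs, hsmax⟩ := hcomp.exists_isGreatest
      ⟨0, by simp only [mem_preimage, mem_Iic]; rw [haa' 0 h00, ha0]; exact hc0, h00⟩
    have hset : a' ⁻¹' Iic c ∩ Icc 0 S = Icc 0 s := by
      ext τ
      refine ⟨fun hτ => ⟨hτ.2.1, hsmax hτ⟩, fun hτ => ⟨?_, hτ.1, hτ.2.trans hs.2.2⟩⟩
      exact (hm' hτ.2).trans hs.1
    have has : a s = min c (a S) := by
      have h1 : a s ≤ c := haa' s hs.2 ▸ hs.1
      refine le_antisymm (le_min h1 (hm hs.2 hSS hs.2.2)) ?_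
      have h2 : min c (a S) ∈ Icc (a 0) (a S) :=
        ⟨le_min (ha0.trans_le hc0) (hm h00 hSS hS), min_le_right _ _⟩
      obtain ⟨r, hr, hra⟩ := intermediate_value_Icc hS hc h2
      rw [← hra]
      refine hm hr hs.2 (hsmax ⟨?_, hr⟩)
      simp only [mem_preimage, mem_Iic]
      rw [haa' r hr, hra]
      exact min_le_left _ _
    have hset2 : Iic c ∩ Icc 0 (a S) = Icc 0 (min c (a S)) := by
      ext τ; simp only [mem_inter_iff, mem_Iic, mem_Icc, le_min_iff]; tauto
    rw [hset, hset2, h.lintegral_Icc h0 ha0 hs.2, has]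
    simp

/-- A nondecreasing primitive of `α` is one-to-one almost everywhere on `{α ≠ 0}`. -/
theorem HasDensityOn.ae_eq_of_apply_eq (h : HasDensityOn a α S)
    (h0 : ∀ᵐ s ∂(volume.restrict (Icc 0 S)), 0 ≤ α s) :
    ∀ᵐ s ∂(volume.restrict (Icc 0 S)), α s ≠ 0 → ∀ x ∈ Icc 0 S, a x = a s → x = s := by
  have hm := h.monotoneOn h0
  filter_upwards [h.ae_hasDerivAt, ae_restrict_mem measurableSet_Icc] with s hs hmem hα x hx hax
  by_contra hne
  apply hα
  -- By monotonicity `a` is constant between `s` and `x`, so its derivative at `s` within that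
  -- interval, which is `α s`, is zero.
  have hsub : uIcc s x ⊆ Icc 0 S := uIcc_subset_Icc hmem hx
  have hconst : ∀ y ∈ uIcc s x, a y = a s := by
    intro y hy
    rcases le_total s x with hsx | hsx
    · rw [uIcc_of_le hsx] at hy hsub
      exact le_antisymm (hax ▸ hm (hsub hy) hx hy.2) (hm hmem (hsub hy) hy.1)
    · rw [uIcc_of_ge hsx] at hy hsub
      exact le_antisymm (hm (hsub hy) hmem hy.2) (hax ▸ hm hx (hsub hy) hy.1)
  have hud : UniqueDiffWithinAt ℝ (uIcc s x) s :=
    uniqueDiffOn_Icc (by simpa using hne) s left_mem_uIcc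
  have h1 : HasDerivWithinAt a (α s) (uIcc s x) s := hs.hasDerivWithinAt
  have h2 : HasDerivWithinAt a 0 (uIcc s x) s :=
    (hasDerivWithinAt_const s (uIcc s x) (a s)).congr hconst rfl
  exact hud.eq_deriv _ h1 h2

/-- A right inverse of a nondecreasing primitive of `α` is a left inverse almost everywhere on
`{α ≠ 0}`. -/
theorem HasDensityOn.ae_rightInverse_comp (h : HasDensityOn a α S)
    (h0 : ∀ᵐ s ∂(volume.restrict (Icc 0 S)), 0 ≤ α s) {b : ℝ → ℝ}
    (hb : ∀ s ∈ Icc 0 S, b (a s) ∈ Icc 0 S ∧ a (b (a s)) = a s) :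
    ∀ᵐ s ∂(volume.restrict (Icc 0 S)), α s ≠ 0 → b (a s) = s := by
  filter_upwards [h.ae_eq_of_apply_eq h0, ae_restrict_mem measurableSet_Icc] with s hs hmem hα
  exact hs hα _ (hb s hmem).1 (hb s hmem).2

/-- Lebesgue measure is the image under `a` of the measure with density `α`, so its image under `b`
is the image of that measure under `b ∘ a`, which is the identity almost everywhere for it. -/
theorem HasDensityOn.map_rightInverse (hS : 0 ≤ S) (h : HasDensityOn a α S)
    (h0 : ∀ᵐ s ∂(volume.restrict (Icc 0 S)), 0 ≤ α s) (ha0 : a 0 = 0) {b : ℝ → ℝ}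
    (hb : Monotone b) (hbm : ∀ y ∈ Icc 0 (a S), b y ∈ Icc 0 S ∧ a (b y) = y) :
    Measure.map b (volume.restrict (Icc 0 (a S))) =
      (volume.restrict (Icc 0 S)).withDensity fun s => ENNReal.ofReal (α s) := by
  have hm := h.monotoneOn h0
  rw [← h.map_withDensity hS h0 ha0, AEMeasurable.map_map_of_aemeasurable
    hb.measurable.aemeasurable (h.aemeasurable_withDensity _)]
  conv_rhs => rw [← Measure.map_id (μ := (volume.restrict (Icc 0 S)).withDensity _)]
  refine Measure.map_congr ?_
  have hmem : ∀ s ∈ Icc 0 S, a s ∈ Icc 0 (a S) := fun s hs =>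
    ⟨ha0 ▸ hm ⟨le_rfl, hS⟩ hs hs.1, hm hs ⟨hS, le_rfl⟩ hs.2⟩
  have h1 := h.ae_rightInverse_comp h0 (b := b) fun s hs => hbm _ (hmem s hs)
  have hαm : AEMeasurable (fun s => ENNReal.ofReal (α s)) (volume.restrict (Icc 0 S)) :=
    h.1.aemeasurable.ennreal_ofReal
  rw [EventuallyEq, ae_withDensity_iff' hαm]
  filter_upwards [h1] with s hs hα
  refine hs fun h2 => hα (by simp [h2])

theorem HasDensityOn.quasiMeasurePreserving_rightInverse (hS : 0 ≤ S) (h : HasDensityOn a α S)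
    (h0 : ∀ᵐ s ∂(volume.restrict (Icc 0 S)), 0 ≤ α s) (ha0 : a 0 = 0) {b : ℝ → ℝ}
    (hb : Monotone b) (hbm : ∀ y ∈ Icc 0 (a S), b y ∈ Icc 0 S ∧ a (b y) = y) :
    Measure.QuasiMeasurePreserving b (volume.restrict (Icc 0 (a S)))
      (volume.restrict (Icc 0 S)) :=
  ⟨hb.measurable, by
    rw [h.map_rightInverse hS h0 ha0 hb hbm]; exact withDensity_absolutelyContinuous _ _⟩

/-- The image of Lebesgue measure under `b` has density `α`, so it does not charge `{α = 0}`. -/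
theorem HasDensityOn.ae_density_ne_zero (hS : 0 ≤ S) (h : HasDensityOn a α S)
    (h0 : ∀ᵐ s ∂(volume.restrict (Icc 0 S)), 0 ≤ α s) (ha0 : a 0 = 0) {b : ℝ → ℝ}
    (hb : Monotone b) (hbm : ∀ y ∈ Icc 0 (a S), b y ∈ Icc 0 S ∧ a (b y) = y) :
    ∀ᵐ y ∂(volume.restrict (Icc 0 (a S))), α (b y) ≠ 0 := by
  have hαm : AEMeasurable (fun s => ENNReal.ofReal (α s)) (volume.restrict (Icc 0 S)) :=
    h.1.aemeasurable.ennreal_ofReal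
  refine ae_of_ae_map (p := fun s => α s ≠ 0) hb.measurable.aemeasurable ?_
  rw [h.map_rightInverse hS h0 ha0 hb hbm, ae_withDensity_iff' hαm]
  filter_upwards with s hs h2
  exact hs (by simp [h2])

/-- Reparametrization of a primitive by a right inverse of a nondecreasing primitive. -/
theorem HasDensityOn.comp_rightInverse {E : Type*} [NormedAddCommGroup E] [NormedSpace ℝ E]
    {f p : ℝ → E} (hf : HasDensityOn f p S) (hS : 0 ≤ S) (h : HasDensityOn a α S)
    (h0 : ∀ᵐ s ∂(volume.restrict (Icc 0 S)), 0 ≤ α s) (ha0 : a 0 = 0) {b : ℝ → ℝ}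
    (hb : Monotone b) (hbm : ∀ y ∈ Icc 0 (a S), b y ∈ Icc 0 S ∧ a (b y) = y)
    (hp : ∀ᵐ s ∂(volume.restrict (Icc 0 S)), α s = 0 → p s = 0) :
    HasDensityOn (fun y => f (b y)) (fun y => (α (b y))⁻¹ • p (b y)) (a S) := by
  have hm := h.monotoneOn h0
  have haS : 0 ≤ a S := ha0 ▸ hm ⟨le_rfl, hS⟩ ⟨hS, le_rfl⟩ hS
  set G : ℝ → E := fun s => (α s)⁻¹ • p s with hG
  have hGm : AEStronglyMeasurable G (volume.restrict (Icc 0 S)) :=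
    (h.1.aemeasurable.inv.aestronglyMeasurable).smul hf.1.aestronglyMeasurable
  have hαm : AEMeasurable (fun s => ENNReal.ofReal (α s)) (volume.restrict (Icc 0 S)) :=
    h.1.aemeasurable.ennreal_ofReal
  -- Where `α` vanishes, `hp` makes `p` vanish as well, so division by zero does no harm.
  have hsmul : ∀ᵐ s ∂(volume.restrict (Icc 0 S)),
      (ENNReal.ofReal (α s)).toReal • G s = p s := by
    filter_upwards [h0, hp] with s hs hps
    rw [ENNReal.toReal_ofReal hs]
    by_cases hz : α s = 0
    · simp [hz, hps hz]
    · simp [hG, smul_smul, mul_inv_cancel₀ hz]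
  -- integrability and value of the integral on each `[0, r]`
  have key : ∀ r ∈ Icc 0 S, b (a r) = r →
      IntegrableOn (fun y => G (b y)) (Icc 0 (a r)) ∧
      ∫ y in Icc 0 (a r), G (b y) = ∫ s in Icc 0 r, p s := by
    intro r hr hbr
    have hsub : Icc 0 r ⊆ Icc 0 S := Icc_subset_Icc le_rfl hr.2
    have hbm' : ∀ y ∈ Icc 0 (a r), b y ∈ Icc 0 r ∧ a (b y) = y := fun y hy => by
      have h1 := hbm y ⟨hy.1, hy.2.trans (hm hr ⟨hS, le_rfl⟩ hr.2)⟩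
      exact ⟨⟨h1.1.1, (hb hy.2).trans_eq hbr⟩, h1.2⟩
    have h0' := ae_restrict_of_ae_restrict_of_subset hsub h0
    have hmap := (h.mono hr.2).map_rightInverse hr.1 h0' ha0 hb hbm'
    have hαm' := hαm.mono_measure (Measure.restrict_mono hsub le_rfl)
    have hGm' : AEStronglyMeasurable G
        (Measure.map b (volume.restrict (Icc 0 (a r)))) := by
      rw [hmap]
      exact (hGm.mono_measure (Measure.restrict_mono hsub le_rfl)).mono_ac
        (withDensity_absolutelyContinuous _ _)
    have hlt : ∀ᵐ s ∂(volume.restrict (Icc 0 r)), ENNReal.ofReal (α s) < ⊤ := by simp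
    have hsmul' := ae_restrict_of_ae_restrict_of_subset hsub hsmul
    constructor
    · have h2 : Integrable G (Measure.map b (volume.restrict (Icc 0 (a r)))) := by
        rw [hmap, integrable_withDensity_iff_integrable_smul₀' hαm' hlt]
        exact (hf.1.mono_set hsub).congr (hsmul'.mono fun s hs => hs.symm)
      exact (integrable_map_measure hGm' hb.measurable.aemeasurable).1 h2
    · rw [← integral_map hb.measurable.aemeasurable hGm', hmap,
        integral_withDensity_eq_integral_toReal_smul₀ hαm' hlt]
      exact integral_congr_ae hsmul'
  -- The condition `b (a r) = r` in `key` is what makes `b` map `[0, a r]` into `[0, r]`; it holds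
  -- for every `r = b y`.
  have hval : ∀ y ∈ Icc 0 (a S), IntegrableOn (fun y => G (b y)) (Icc 0 y) ∧
      ∫ z in Icc 0 y, G (b z) = ∫ s in Icc 0 (b y), p s := fun y hy => by
    have := key (b y) (hbm y hy).1 (by rw [(hbm y hy).2])
    rwa [(hbm y hy).2] at this
  have hfb : ∀ y ∈ Icc 0 (a S), f (b y) = f 0 + ∫ z in Icc 0 y, G (b z) := fun y hy => by
    rw [(hval y hy).2, hf.2 _ (hbm y hy).1, intervalIntegral.integral_of_le (hbm y hy).1.1,
      integral_Icc_eq_integral_Ioc]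
  refine ⟨(hval (a S) ⟨haS, le_rfl⟩).1, fun y hy => ?_⟩
  -- If `a` is flat near the origin then `b 0` may differ from `0`; still `f (b 0) = f 0`, the
  -- integral over `[0, 0]` being zero.
  have hb0 := hfb 0 ⟨le_rfl, haS⟩
  simp only [Icc_self, Measure.restrict_singleton, Real.volume_singleton, zero_smul,
    integral_zero_measure, add_zero] at hb0
  beta_reduce
  rw [hb0, hfb y hy, intervalIntegral.integral_of_le hy.1, integral_Icc_eq_integral_Ioc]

end ChangeOfVariables

/-! ### Weak convergence of bounded densities -/

section WeakConvergence

variable {E : Type*} [NormedAddCommGroup E] [NormedSpace ℝ E]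
  {μ : Measure ℝ} [IsFiniteMeasure μ] {wk : ℕ → ℝ → ℝ} {w : ℝ → ℝ} {C : ℝ}

/-- A π-λ argument starting from half-lines. For disjoint unions the series passes to the limit by
domination by `C * μ (f i)`, which is summable since `μ` is finite. -/
theorem tendsto_setIntegral_of_tendsto_Iic
    (hwk : ∀ k, AEStronglyMeasurable (wk k) μ) (hw : AEStronglyMeasurable w μ)
    (hCk : ∀ k, ∀ᵐ s ∂μ, ‖wk k s‖ ≤ C) (hC : ∀ᵐ s ∂μ, ‖w s‖ ≤ C)
    (htot : Tendsto (fun k => ∫ s, wk k s ∂μ) atTop (𝓝 (∫ s, w s ∂μ)))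
    (hIic : ∀ r, Tendsto (fun k => ∫ s in Iic r, wk k s ∂μ) atTop (𝓝 (∫ s in Iic r, w s ∂μ)))
    {A : Set ℝ} (hA : MeasurableSet A) :
    Tendsto (fun k => ∫ s in A, wk k s ∂μ) atTop (𝓝 (∫ s in A, w s ∂μ)) := by
  have hik : ∀ k, Integrable (wk k) μ := fun k => Integrable.of_bound (hwk k) C (hCk k)
  have hi : Integrable w μ := Integrable.of_bound hw C hC
  refine MeasurableSpace.induction_on_inter
    (C := fun A _ => Tendsto (fun k => ∫ s in A, wk k s ∂μ) atTop (𝓝 (∫ s in A, w s ∂μ)))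
    ((BorelSpace.measurable_eq (α := ℝ)).trans (borel_eq_generateFrom_Iic ℝ)) isPiSystem_Iic
    ?_ ?_ ?_ ?_ A hA
  · simp
  · rintro _ ⟨r, rfl⟩
    exact hIic r
  · intro t ht h
    rw [setIntegral_compl ht hi]
    simp_rw [setIntegral_compl ht (hik _)]
    exact htot.sub h
  · intro f hd hm h
    rw [integral_iUnion hm hd hi.integrableOn]
    simp_rw [integral_iUnion hm hd (hik _).integrableOn]
    refine tendsto_tsum_of_dominated_convergence (bound := fun i => C * μ.real (f i))
      ((summable_measure_toReal hm hd).mul_left C) h (Eventually.of_forall fun k i => ?_)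
    exact norm_setIntegral_le_of_norm_le_const_ae (measure_lt_top _ _)
      (ae_restrict_of_ae (hCk k))

/-- Bounded densities whose primitives converge do so weakly against integrable functions. -/
theorem tendsto_integral_smul_of_tendsto_Iic [CompleteSpace E]
    (hwk : ∀ k, AEStronglyMeasurable (wk k) μ) (hw : AEStronglyMeasurable w μ)
    (hCk : ∀ k, ∀ᵐ s ∂μ, ‖wk k s‖ ≤ C) (hC : ∀ᵐ s ∂μ, ‖w s‖ ≤ C)
    (htot : Tendsto (fun k => ∫ s, wk k s ∂μ) atTop (𝓝 (∫ s, w s ∂μ)))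
    (hIic : ∀ r, Tendsto (fun k => ∫ s in Iic r, wk k s ∂μ) atTop (𝓝 (∫ s in Iic r, w s ∂μ)))
    {h : ℝ → E} (hh : Integrable h μ) :
    Tendsto (fun k => ∫ s, wk k s • h s ∂μ) atTop (𝓝 (∫ s, w s • h s ∂μ)) := by
  have hInt : ∀ {v : ℝ → ℝ} {f : ℝ → E}, AEStronglyMeasurable v μ → (∀ᵐ s ∂μ, ‖v s‖ ≤ C) →
      Integrable f μ → Integrable (fun s => v s • f s) μ := fun hv hvC hf =>
    hf.bdd_smul C hv hvC
  have hC0 : ∀ {v : ℝ → ℝ} {f g : ℝ → E}, AEStronglyMeasurable v μ → (∀ᵐ s ∂μ, ‖v s‖ ≤ C) →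
      Integrable f μ → Integrable g μ →
      ‖∫ s, v s • f s ∂μ - ∫ s, v s • g s ∂μ‖ ≤ |C| * ∫ s, ‖f s - g s‖ ∂μ := by
    intro v f g hv hvC hf hg
    rw [← integral_sub (hInt hv hvC hf) (hInt hv hvC hg), ← integral_const_mul]
    refine norm_integral_le_of_norm_le ((hf.sub hg).norm.const_mul _) ?_
    filter_upwards [hvC] with s hs
    rw [← smul_sub, norm_smul]
    gcongr
    exact hs.trans (le_abs_self C)
  refine Integrable.induction (μ := μ) (fun h : ℝ → E =>
    Tendsto (fun k => ∫ s, wk k s • h s ∂μ) atTop (𝓝 (∫ s, w s • h s ∂μ))) ?_ ?_ ?_ ?_ hh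
  · intro c A hA _
    have : ∀ v : ℝ → ℝ, ∫ s, v s • A.indicator (fun _ => c) s ∂μ = (∫ s in A, v s ∂μ) • c := by
      intro v
      rw [← integral_smul_const, ← integral_indicator hA]
      congr 1
      ext s
      by_cases hs : s ∈ A <;> simp [hs]
    simp_rw [this]
    exact (tendsto_setIntegral_of_tendsto_Iic hwk hw hCk hC htot hIic hA).smul_const c
  · intro f g _ hf hg h1 h2
    have h3 := h1.add h2
    rw [← integral_add (hInt hw hC hf) (hInt hw hC hg)] at h3
    simp_rw [← integral_add (hInt (hwk _) (hCk _) hf) (hInt (hwk _) (hCk _) hg), ← smul_add] at h3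
    exact h3
  -- By `hC0` the pairings are Lipschitz in the `L¹` norm with a constant independent of `k`, so the
  -- admissible integrands form a closed set.
  · refine isClosed_of_closure_subset fun f hf => ?_
    rw [mem_ofPred_eq, Metric.tendsto_nhds]
    intro ε hε
    obtain ⟨g, hg, hfg⟩ := Metric.mem_closure_iff.1 hf (ε / (3 * (|C| + 1))) (by positivity)
    have hfg' : |C| * ∫ s, ‖f s - g s‖ ∂μ < ε / 3 := by
      rw [dist_eq_norm, L1.norm_eq_integral_norm] at hfg
      have h1 : ∫ a, ‖(f - g : Lp E 1 μ) a‖ ∂μ = ∫ s, ‖f s - g s‖ ∂μ := by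
        refine integral_congr_ae ?_
        filter_upwards [Lp.coeFn_sub f g] with s hs
        rw [hs]; rfl
      rw [h1] at hfg
      have h0 : 0 ≤ ∫ s, ‖f s - g s‖ ∂μ := integral_nonneg fun _ => norm_nonneg _
      calc |C| * ∫ s, ‖f s - g s‖ ∂μ ≤ (|C| + 1) * ∫ s, ‖f s - g s‖ ∂μ := by gcongr; linarith
        _ < (|C| + 1) * (ε / (3 * (|C| + 1))) := by gcongr
        _ = ε / 3 := by field_simp
    have hg' := Metric.tendsto_nhds.1 (show Tendsto _ _ _ from hg) (ε / 3) (by positivity)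
    filter_upwards [hg'] with k hk
    have h1 := hC0 (hwk k) (hCk k) (L1.integrable_coeFn f) (L1.integrable_coeFn g)
    have h2 := hC0 hw hC (L1.integrable_coeFn f) (L1.integrable_coeFn g)
    rw [dist_eq_norm] at hk ⊢
    calc _ = ‖(∫ s, wk k s • f s ∂μ - ∫ s, wk k s • g s ∂μ)
          + (∫ s, wk k s • g s ∂μ - ∫ s, w s • g s ∂μ)
          - (∫ s, w s • f s ∂μ - ∫ s, w s • g s ∂μ)‖ := by congr 1; abel
      _ ≤ _ := (norm_sub_le _ _).trans (add_le_add (norm_add_le _ _) le_rfl)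
      _ < ε := by linarith
  · intro f g hfg _ h1
    have : ∀ v : ℝ → ℝ, ∫ s, v s • f s ∂μ = ∫ s, v s • g s ∂μ := fun v =>
      integral_congr_ae (by filter_upwards [hfg] with s hs; rw [hs])
    simpa only [this] using h1

/-- Weakly convergent bounded densities against boundedly convergent integrands. -/
theorem tendsto_integral_smul_of_tendsto_Iic_of_ae [CompleteSpace E]
    (hwk : ∀ k, AEStronglyMeasurable (wk k) μ) (hw : AEStronglyMeasurable w μ)
    (hCk : ∀ k, ∀ᵐ s ∂μ, ‖wk k s‖ ≤ C) (hC : ∀ᵐ s ∂μ, ‖w s‖ ≤ C)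
    (htot : Tendsto (fun k => ∫ s, wk k s ∂μ) atTop (𝓝 (∫ s, w s ∂μ)))
    (hIic : ∀ r, Tendsto (fun k => ∫ s in Iic r, wk k s ∂μ) atTop (𝓝 (∫ s in Iic r, w s ∂μ)))
    {hk : ℕ → ℝ → E} {h : ℝ → E} {D : ℝ} (hkm : ∀ k, AEStronglyMeasurable (hk k) μ)
    (hm : AEStronglyMeasurable h μ) (hDk : ∀ k, ∀ᵐ s ∂μ, ‖hk k s‖ ≤ D)
    (hD : ∀ᵐ s ∂μ, ‖h s‖ ≤ D)
    (hlim : ∀ᵐ s ∂μ, Tendsto (fun k => hk k s) atTop (𝓝 (h s))) :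
    Tendsto (fun k => ∫ s, wk k s • hk k s ∂μ) atTop (𝓝 (∫ s, w s • h s ∂μ)) := by
  have hi : Integrable h μ := Integrable.of_bound hm D hD
  have h1 := tendsto_integral_smul_of_tendsto_Iic hwk hw hCk hC htot hIic hi
  -- Weak times strong: in `w_k h_k = w_k h + w_k (h_k - h)` the last term disappears by dominated
  -- convergence.
  have h2 : Tendsto (fun k => ∫ s, wk k s • (hk k s - h s) ∂μ) atTop (𝓝 (∫ _, (0 : E) ∂μ)) := by
    refine tendsto_integral_of_dominated_convergence (fun _ => |C| * (D + D))
      (fun k => (hwk k).smul ((hkm k).sub hm)) (integrable_const _) (fun k => ?_) ?_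
    · filter_upwards [hCk k, hDk k, hD] with s h3 h4 h5
      rw [norm_smul]
      have := norm_sub_le (hk k s) (h s)
      gcongr
      · exact h3.trans (le_abs_self C)
      · linarith
    · filter_upwards [hlim, ae_all_iff.2 hCk] with s h3 h4
      refine squeeze_zero_norm (a := fun k => |C| * ‖hk k s - h s‖) (fun k => ?_) ?_
      · rw [norm_smul]
        gcongr
        exact (h4 k).trans (le_abs_self C)
      · have := (tendsto_iff_norm_sub_tendsto_zero.1 h3).const_mul |C|
        simpa using this
  have h3 := h1.add h2
  simp only [integral_zero, add_zero] at h3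
  refine h3.congr fun k => ?_
  have hik : Integrable (hk k) μ := Integrable.of_bound (hkm k) D (hDk k)
  have h4 : Integrable (fun s => wk k s • h s) μ := hi.bdd_smul C (hwk k) (hCk k)
  have h5 : Integrable (fun s => wk k s • (hk k s - h s)) μ :=
    (hik.sub hi).bdd_smul C (hwk k) (hCk k)
  rw [← integral_add h4 h5]
  congr 1
  ext s
  rw [← smul_add]
  simp

end WeakConvergence

/-! ### Compactness, Grönwall estimates and composition in `L¹` -/

/-- Arzelà–Ascoli on the line for bounded equi-Lipschitz sequences. -/
theorem exists_subseq_tendsto_of_lipschitzWith {E : Type*} [NormedAddCommGroup E] [ProperSpace E]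
    {f : ℕ → ℝ → E} {K : ℝ≥0} {C : ℝ} (hK : ∀ k, LipschitzWith K (f k))
    (hC : ∀ k s, ‖f k s‖ ≤ C) :
    ∃ θ : ℕ → ℕ, StrictMono θ ∧ ∃ g : ℝ → E, LipschitzWith K g ∧
      ∀ s, Tendsto (fun k => f (θ k) s) atTop (𝓝 (g s)) := by
  -- Compactness of a countable product yields one subsequence converging at all rationals; the
  -- common Lipschitz constant extends the convergence to every point.
  have hcomp : IsCompact (Set.pi univ fun _ : ℚ => Metric.closedBall (0 : E) C) :=
    isCompact_univ_pi fun _ => isCompact_closedBall _ _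
  obtain ⟨a, -, θ, hθ, hlim⟩ := hcomp.tendsto_subseq (x := fun k (r : ℚ) => f k r)
    (fun k r _ => by simpa using hC k r)
  rw [tendsto_pi_nhds] at hlim
  have hcauchy : ∀ s, CauchySeq fun k => f (θ k) s := by
    intro s
    rw [Metric.cauchySeq_iff]
    intro ε hε
    obtain ⟨r, hr1, hr2⟩ := exists_rat_btwn (show s < s + ε / (4 * (K + 1)) by
      have : 0 < ε / (4 * ((K : ℝ) + 1)) := by positivity
      linarith)
    have hrs : ∀ k, dist (f k s) (f k r) ≤ ε / 4 := fun k => by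
      refine ((hK k).dist_le_mul s r).trans ?_
      rw [dist_comm, Real.dist_eq, abs_of_pos (sub_pos.2 hr1)]
      calc (K : ℝ) * (r - s) ≤ (K + 1) * (ε / (4 * (K + 1))) := by
            gcongr
            · linarith
            · linarith
        _ = ε / 4 := by field_simp
    obtain ⟨N, hN⟩ := Metric.cauchySeq_iff.1 (hlim r).cauchySeq (ε / 4) (by positivity)
    refine ⟨N, fun i hi j hj => ?_⟩
    have h1 := hN i hi j hj
    simp only [Function.comp_apply] at h1
    have h2 := hrs (θ i)
    have h3 := hrs (θ j)
    rw [dist_comm] at h3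
    have := dist_triangle4 (f (θ i) s) (f (θ i) r) (f (θ j) r) (f (θ j) s)
    linarith
  choose g hg using fun s => cauchySeq_tendsto_of_complete (hcauchy s)
  refine ⟨θ, hθ, g, LipschitzWith.of_dist_le_mul fun x y => ?_, hg⟩
  exact le_of_tendsto ((hg x).dist (hg y)) (Eventually.of_forall fun k => (hK _).dist_le_mul x y)

/-- Grönwall's inequality in integral form. -/
theorem le_mul_exp_of_le_add_integral {y : ℝ → ℝ} {S A B : ℝ} (hS : 0 ≤ S)
    (hy : ContinuousOn y (Icc 0 S)) (hy0 : ∀ s ∈ Icc 0 S, 0 ≤ y s) (hB : 0 ≤ B)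
    (h : ∀ s ∈ Icc 0 S, y s ≤ A + B * ∫ τ in (0 : ℝ)..s, y τ) {s : ℝ} (hs : s ∈ Icc 0 S) :
    y s ≤ A * Real.exp (B * s) := by
  have hproj : ∀ τ, max 0 (min τ S) ∈ Icc 0 S := fun τ =>
    ⟨le_max_left _ _, max_le hS (min_le_right _ _)⟩
  -- Extending `y` by clamping makes its primitive `Z` differentiable everywhere, and `Z' ≤ A + B Z`
  -- on `[0, S]` is the differential form of the inequality.
  set z : ℝ → ℝ := fun τ => y (max 0 (min τ S)) with hz
  have hzy : ∀ τ ∈ Icc 0 S, z τ = y τ := fun τ hτ => by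
    simp [hz, min_eq_left hτ.2, max_eq_right hτ.1]
  have hzc : Continuous z := hy.comp_continuous (by fun_prop) hproj
  have hzi : ∀ s ∈ Icc 0 S, ∫ τ in (0 : ℝ)..s, y τ = ∫ τ in (0 : ℝ)..s, z τ := fun s hs =>
    intervalIntegral.integral_congr fun τ hτ => by
      rw [uIcc_of_le hs.1] at hτ
      exact (hzy τ ⟨hτ.1, hτ.2.trans hs.2⟩).symm
  set Z : ℝ → ℝ := fun s => ∫ τ in (0 : ℝ)..s, z τ with hZ
  have hZd : ∀ s, HasDerivAt Z (z s) s := fun s =>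
    intervalIntegral.integral_hasDerivAt_right (hzc.intervalIntegrable _ _)
      (hzc.stronglyMeasurableAtFilter _ _) hzc.continuousAt
  have hZ0 : ∀ s ∈ Icc 0 S, 0 ≤ Z s := fun s hs =>
    intervalIntegral.integral_nonneg hs.1 fun τ hτ => hy0 _ (hproj τ)
  have hle : ∀ s ∈ Icc 0 S, z s ≤ A + B * Z s := fun s hs => by
    rw [hzy s hs]
    simpa only [hZ, hzi s hs] using h s hs
  have hmain : Z s ≤ gronwallBound 0 B A s := by
    have := norm_le_gronwallBound_of_norm_deriv_right_le (f := Z) (f' := z) (δ := 0) (K := B)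
      (ε := A) (a := 0) (b := S) (fun x _ => (hZd x).continuousAt.continuousWithinAt)
      (fun x _ => (hZd x).hasDerivWithinAt) (by simp [hZ])
      (fun x hx => by
        have hx' : x ∈ Icc 0 S := ⟨hx.1, hx.2.le⟩
        rw [Real.norm_of_nonneg (hy0 _ (hproj x)), Real.norm_of_nonneg (hZ0 x hx')]
        linarith [hle x hx']) s hs
    rw [Real.norm_of_nonneg (hZ0 s hs), sub_zero] at this
    exact this
  rw [← hzy s hs]
  refine (hle s hs).trans ?_
  rcases eq_or_ne B 0 with rfl | hB0
  · simp
  · rw [gronwallBound_of_K_ne_0 hB0] at hmain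
    have : B * Z s ≤ B * (0 * Real.exp (B * s) + A / B * (Real.exp (B * s) - 1)) := by gcongr
    have h2 : B * (0 * Real.exp (B * s) + A / B * (Real.exp (B * s) - 1))
        = A * (Real.exp (B * s) - 1) := by field_simp; ring
    linarith

/-- An expanding map of an interval pushes the Lebesgue measure to a smaller measure. -/
theorem map_restrict_le_of_expanding {a : ℝ → ℝ} {T S : ℝ}
    (hmaps : MapsTo a (Icc 0 T) (Icc 0 S))
    (hexp : ∀ s ∈ Icc 0 T, ∀ t ∈ Icc 0 T, s ≤ t → t - s ≤ a t - a s) :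
    Measure.map a (volume.restrict (Icc 0 T)) ≤ volume.restrict (Icc 0 S) := by
  have hmono : MonotoneOn a (Icc 0 T) := fun s hs t ht hst => by
    have := hexp s hs t ht hst; linarith
  have hae := aemeasurable_restrict_of_monotoneOn (μ := volume) measurableSet_Icc hmono
  have hdist : ∀ s ∈ Icc 0 T, ∀ t ∈ Icc 0 T, dist s t ≤ dist (a s) (a t) := by
    intro s hs t ht
    rcases le_total s t with hst | hst
    · rw [dist_comm, dist_comm (a s), Real.dist_eq, Real.dist_eq, abs_of_nonneg (sub_nonneg.2 hst)]
      exact (hexp s hs t ht hst).trans (le_abs_self _)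
    · rw [Real.dist_eq, Real.dist_eq, abs_of_nonneg (sub_nonneg.2 hst)]
      exact (hexp t ht s hs hst).trans (le_abs_self _)
  have hinj : InjOn a (Icc 0 T) := fun s hs t ht hst => by
    have := hdist s hs t ht
    rw [hst, dist_self] at this
    exact dist_le_zero.1 this
  refine Measure.le_iff.2 fun A hA => ?_
  rw [Measure.map_apply_of_aemeasurable hae hA, Measure.restrict_apply₀' (by simp),
    Measure.restrict_apply hA]
  set B := a ⁻¹' A ∩ Icc 0 T with hB
  have hsub : a '' B ⊆ A ∩ Icc 0 S := by
    rintro _ ⟨t, ht, rfl⟩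
    exact ⟨ht.1, hmaps ht.2⟩
  -- The inverse is 1-Lipschitz on the image, so it does not increase the one-dimensional Hausdorff
  -- measure, which is Lebesgue measure; the image need not be measurable.
  set c := Function.invFunOn a (Icc 0 T) with hc
  have hca : ∀ t ∈ Icc 0 T, c (a t) = t := fun t ht => hinj.leftInvOn_invFunOn ht
  have hlip : LipschitzOnWith 1 c (a '' B) := by
    refine LipschitzOnWith.of_dist_le_mul ?_
    rintro _ ⟨s, hs, rfl⟩ _ ⟨t, ht, rfl⟩
    rw [hca s hs.2, hca t ht.2]
    simpa using hdist s hs.2 t ht.2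
  have himg : c '' (a '' B) = B := by
    rw [image_image]
    exact (image_congr fun t ht => hca t ht.2).trans (image_id _)
  have h1 := hlip.hausdorffMeasure_image_le (d := 1) zero_le_one
  rw [himg, hausdorffMeasure_real] at h1
  simp only [ENNReal.coe_one, ENNReal.one_rpow, one_mul] at h1
  exact h1.trans (measure_mono hsub)

/-- Composition with pointwise convergent changes of variables is continuous in `L¹`. -/
theorem tendsto_lintegral_comp_sub {E : Type*} [NormedAddCommGroup E] [NormedSpace ℝ E]
    {μ ν : Measure ℝ} [IsFiniteMeasure μ] [ν.Regular] {f : ℝ → E} (hf : Integrable f ν)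
    {ak : ℕ → ℝ → ℝ} {a : ℝ → ℝ} (hak : ∀ k, AEMeasurable (ak k) μ) (ha : AEMeasurable a μ)
    (hmk : ∀ k, Measure.map (ak k) μ ≤ ν) (hm : Measure.map a μ ≤ ν)
    (hlim : ∀ᵐ t ∂μ, Tendsto (fun k => ak k t) atTop (𝓝 (a t))) :
    Tendsto (fun k => ∫⁻ t, ‖f (ak k t) - f (a t)‖ₑ ∂μ) atTop (𝓝 0) := by
  rw [ENNReal.tendsto_nhds_zero]
  intro ε hε
  have hε3 : ε / 3 ≠ 0 := by simpa using hε.ne'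
  -- For a continuous compactly supported `c` close to `f`, dominated convergence applies. The
  -- images of `μ` lie below `ν`, so replacing `f` by `c` costs at most `ε / 3` after each
  -- composition, uniformly in `k`.
  obtain ⟨c, hcs, hfc, hcc, -⟩ := hf.exists_hasCompactSupport_lintegral_sub_le hε3
  obtain ⟨D, hD⟩ := hcs.exists_bound_of_continuous hcc
  have hfcm : AEMeasurable (fun s => ‖f s - c s‖ₑ) ν :=
    (hf.aestronglyMeasurable.sub hcc.aestronglyMeasurable).enorm
  have hpush : ∀ {b : ℝ → ℝ}, AEMeasurable b μ → Measure.map b μ ≤ ν →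
      ∫⁻ t, ‖f (b t) - c (b t)‖ₑ ∂μ ≤ ε / 3 := fun {b} hb hbm => by
    rw [← lintegral_map' (f := fun s => ‖f s - c s‖ₑ) (hfcm.mono_measure hbm) hb]
    exact (lintegral_mono' hbm le_rfl).trans hfc
  have hmeas : ∀ {b : ℝ → ℝ}, AEMeasurable b μ → Measure.map b μ ≤ ν →
      AEMeasurable (fun t => ‖f (b t) - c (b t)‖ₑ) μ := fun {b} hb hbm =>
    (hfcm.mono_measure hbm).comp_aemeasurable hb
  have hmeas2 : ∀ {b : ℝ → ℝ}, AEMeasurable b μ →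
      AEStronglyMeasurable (fun t => c (b t)) μ := fun {b} hb =>
    hcc.comp_aestronglyMeasurable hb.aestronglyMeasurable
  have hmid : Tendsto (fun k => ∫⁻ t, ‖c (ak k t) - c (a t)‖ₑ ∂μ) atTop (𝓝 0) := by
    have := tendsto_lintegral_of_dominated_convergence' (μ := μ)
      (F := fun k t => ‖c (ak k t) - c (a t)‖ₑ) (f := fun _ => 0)
      (fun _ => ENNReal.ofReal (D + D)) (fun k => ((hmeas2 (hak k)).sub (hmeas2 ha)).enorm)
      (fun k => Eventually.of_forall fun t => by
        beta_reduce
        rw [← ofReal_norm]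
        exact ENNReal.ofReal_le_ofReal ((norm_sub_le _ _).trans (add_le_add (hD _) (hD _))))
      (by simp [ENNReal.mul_eq_top]) (by
        filter_upwards [hlim] with t ht
        have h1 : Tendsto (fun k => c (ak k t) - c (a t)) atTop (𝓝 0) := by
          simpa using (((hcc.tendsto _).comp ht).sub_const (c (a t)))
        simpa using h1.enorm)
    simpa using this
  filter_upwards [(ENNReal.tendsto_nhds_zero.1 hmid) (ε / 3) (pos_iff_ne_zero.2 hε3)] with k hk
  calc ∫⁻ t, ‖f (ak k t) - f (a t)‖ₑ ∂μ
      ≤ ∫⁻ t, (‖f (ak k t) - c (ak k t)‖ₑ + ‖c (ak k t) - c (a t)‖ₑ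
          + ‖f (a t) - c (a t)‖ₑ) ∂μ := by
        refine lintegral_mono fun t => ?_
        have : f (ak k t) - f (a t) = (f (ak k t) - c (ak k t)) + (c (ak k t) - c (a t))
          - (f (a t) - c (a t)) := by abel
        rw [this]
        exact enorm_sub_le.trans (add_le_add (enorm_add_le _ _) le_rfl)
    _ = ∫⁻ t, ‖f (ak k t) - c (ak k t)‖ₑ ∂μ + ∫⁻ t, ‖c (ak k t) - c (a t)‖ₑ ∂μ
          + ∫⁻ t, ‖f (a t) - c (a t)‖ₑ ∂μ := by
        have h1 : AEMeasurable (fun t => ‖c (ak k t) - c (a t)‖ₑ) μ :=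
          ((hmeas2 (hak k)).sub (hmeas2 ha)).enorm
        have h2 : AEMeasurable (fun t => ‖f (ak k t) - c (ak k t)‖ₑ + ‖c (ak k t) - c (a t)‖ₑ) μ :=
          (hmeas (hak k) (hmk k)).add h1
        rw [lintegral_add_left' h2, lintegral_add_left' (hmeas (hak k) (hmk k))]
    _ ≤ ε / 3 + ε / 3 + ε / 3 := by
        gcongr
        · exact hpush (hak k) (hmk k)
        · exact hpush ha hm
    _ = ε := ENNReal.add_thirds ε

section GeneralDensities

variable {E : Type*} [NormedAddCommGroup E] [NormedSpace ℝ E] {f p g q : ℝ → E} {S : ℝ}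

theorem HasDensityOn.norm_le_of_linear_growth (h : HasDensityOn f p S) {c : ℝ} (hc : 0 ≤ c)
    (hp : ∀ᵐ s ∂(volume.restrict (Icc 0 S)), ‖p s‖ ≤ c * (1 + ‖f s‖)) {s : ℝ}
    (hs : s ∈ Icc 0 S) : ‖f s‖ ≤ (‖f 0‖ + c * S) * Real.exp (c * S) := by
  have hS : 0 ≤ S := hs.1.trans hs.2
  have h00 : (0 : ℝ) ∈ Icc 0 S := ⟨le_rfl, hS⟩
  have hcont : ContinuousOn (fun s => ‖f s‖) (Icc 0 S) := h.continuousOn.norm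
  have hii : ∀ s ∈ Icc 0 S, IntervalIntegrable (fun s => ‖f s‖) volume 0 s := fun s hs =>
    (hcont.mono (by rw [uIcc_of_le hs.1]; exact Icc_subset_Icc le_rfl hs.2)).intervalIntegrable
  have key := le_mul_exp_of_le_add_integral (y := fun s => ‖f s‖) (A := ‖f 0‖ + c * S) (B := c) hS
    hcont (fun _ _ => norm_nonneg _) hc (fun s hs => ?_) hs
  · refine key.trans ?_
    gcongr
    exact hs.2
  · have h1 : ‖f s‖ ≤ ‖f 0‖ + ‖f s - f 0‖ := by
      have := norm_add_le (f 0) (f s - f 0); simpa using this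
    have h2 := h.norm_sub_le h00 hs hs.1
    have h3 : ∫ τ in (0 : ℝ)..s, ‖p τ‖ ≤ ∫ τ in (0 : ℝ)..s, (c * 1 + c * ‖f τ‖) := by
      refine intervalIntegral.integral_mono_ae_restrict hs.1 (h.norm.intervalIntegrable h00 hs)
        (intervalIntegrable_const.add ((hii s hs).const_mul c)) ?_
      filter_upwards [ae_restrict_of_ae_restrict_of_subset (Icc_subset_Icc le_rfl hs.2) hp]
        with τ hτ
      rw [← mul_add]; exact hτ
    rw [intervalIntegral.integral_add intervalIntegrable_const ((hii s hs).const_mul c),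
      intervalIntegral.integral_const_mul c (fun τ => ‖f τ‖)] at h3
    simp only [mul_one, intervalIntegral.integral_const, sub_zero, smul_eq_mul] at h3
    have h4 : s * c ≤ c * S := by rw [mul_comm]; gcongr; exact hs.2
    linarith

theorem HasDensityOn.eqOn_of_norm_sub_le (hf : HasDensityOn f p S) (hg : HasDensityOn g q S)
    (h0 : f 0 = g 0) {c : ℝ} (hc : 0 ≤ c)
    (hp : ∀ᵐ s ∂(volume.restrict (Icc 0 S)), ‖p s - q s‖ ≤ c * ‖f s - g s‖) :
    EqOn f g (Icc 0 S) := by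
  intro s hs
  have hS : 0 ≤ S := hs.1.trans hs.2
  have h00 : (0 : ℝ) ∈ Icc 0 S := ⟨le_rfl, hS⟩
  have hcont : ContinuousOn (fun s => ‖f s - g s‖) (Icc 0 S) :=
    (hf.continuousOn.sub hg.continuousOn).norm
  have hii : ∀ s ∈ Icc 0 S, IntervalIntegrable (fun s => ‖f s - g s‖) volume 0 s := fun s hs =>
    (hcont.mono (by rw [uIcc_of_le hs.1]; exact Icc_subset_Icc le_rfl hs.2)).intervalIntegrable
  have key := le_mul_exp_of_le_add_integral (y := fun s => ‖f s - g s‖) (A := 0) (B := c) hS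
    hcont (fun _ _ => norm_nonneg _) hc (fun s hs => ?_) hs
  · rw [zero_mul] at key
    exact sub_eq_zero.1 (norm_le_zero_iff.1 key)
  · rw [hf.2 s hs, hg.2 s hs, h0, add_sub_add_left_eq_sub, zero_add,
      ← intervalIntegral.integral_sub (hf.intervalIntegrable h00 hs)
        (hg.intervalIntegrable h00 hs), ← intervalIntegral.integral_const_mul]
    refine (intervalIntegral.norm_integral_le_integral_norm hs.1).trans ?_
    refine intervalIntegral.integral_mono_ae_restrict hs.1
      ((hf.intervalIntegrable h00 hs).sub (hg.intervalIntegrable h00 hs)).norm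
      ((hii s hs).const_mul c) ?_
    exact ae_restrict_of_ae_restrict_of_subset (Icc_subset_Icc le_rfl hs.2) hp

end GeneralDensities

/-! ### Growth, measurability and Lipschitz bounds for the vector fields -/

section Fields

variable {n m l : ℕ} {U : Set (EuclideanSpace ℝ (Fin m))} {V : Set (EuclideanSpace ℝ (Fin l))}
  {g : Fin (m + 1) → EuclideanSpace ℝ (Fin n) → EuclideanSpace ℝ (Fin m) →
    EuclideanSpace ℝ (Fin l) → EuclideanSpace ℝ (Fin n)}

theorem StandingAssumptions.exists_linear_growth (hyp : StandingAssumptions U V g) :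
    ∃ M : ℝ, 0 ≤ M ∧ ∀ i x, ∀ u ∈ U, ∀ v ∈ V, ‖g i x u v‖ ≤ M * (1 + ‖x‖) := by
  obtain ⟨M, hM, hg⟩ := hyp.growth
  obtain ⟨B, hB⟩ := hyp.compact_U.isBounded.exists_norm_le
  refine ⟨M * (1 + |B|), by positivity, fun i x u hu v hv => (hg i x u hu v hv).trans ?_⟩
  rw [mul_assoc]
  gcongr
  have h1 : ‖(x, u)‖ ≤ ‖x‖ + |B| := by
    rw [Prod.norm_def]
    refine max_le (by linarith [abs_nonneg B]) ?_
    exact ((hB u hu).trans (le_abs_self B)).trans (by linarith [norm_nonneg x])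
  nlinarith [norm_nonneg x, abs_nonneg B]

/-- Continuity is known only on the closed set `ℝⁿ × U × V`; the extension by zero is Borel and
agrees with the field almost everywhere along the given maps. -/
theorem StandingAssumptions.aestronglyMeasurable (hyp : StandingAssumptions U V g)
    (i : Fin (m + 1)) {μ : Measure ℝ} {x : ℝ → EuclideanSpace ℝ (Fin n)}
    {u : ℝ → EuclideanSpace ℝ (Fin m)} {v : ℝ → EuclideanSpace ℝ (Fin l)}
    (hx : AEMeasurable x μ) (hu : AEMeasurable u μ) (huU : ∀ᵐ s ∂μ, u s ∈ U)
    (hv : AEMeasurable v μ) (hvV : ∀ᵐ s ∂μ, v s ∈ V) :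
    AEStronglyMeasurable (fun s => g i (x s) (u s) (v s)) μ := by
  have hK : MeasurableSet ((univ : Set (EuclideanSpace ℝ (Fin n))) ×ˢ U ×ˢ V) :=
    MeasurableSet.univ.prod
      (hyp.compact_U.isClosed.measurableSet.prod hyp.compact_V.isClosed.measurableSet)
  classical
  have hG := (hyp.continuous i).measurable_piecewise (g := fun _ => 0) continuousOn_const hK
  have h1 := hG.comp_aemeasurable (hx.prodMk (hu.prodMk hv))
  refine (h1.congr ?_).aestronglyMeasurable
  filter_upwards [huU, hvV] with s hs1 hs2
  simp [piecewise, hs1, hs2]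

theorem StandingAssumptions.tendsto (hyp : StandingAssumptions U V g) (i : Fin (m + 1))
    {ι : Type*} {L : Filter ι} {xk : ι → EuclideanSpace ℝ (Fin n)}
    {uk : ι → EuclideanSpace ℝ (Fin m)} {vk : ι → EuclideanSpace ℝ (Fin l)}
    {x : EuclideanSpace ℝ (Fin n)} {u : EuclideanSpace ℝ (Fin m)} {v : EuclideanSpace ℝ (Fin l)}
    (hx : Tendsto xk L (𝓝 x)) (hu : Tendsto uk L (𝓝 u)) (hv : Tendsto vk L (𝓝 v))
    (hukU : ∀ᶠ k in L, uk k ∈ U) (hvkV : ∀ᶠ k in L, vk k ∈ V) (huU : u ∈ U) (hvV : v ∈ V) :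
    Tendsto (fun k => g i (xk k) (uk k) (vk k)) L (𝓝 (g i x u v)) := by
  have h1 := (hyp.continuous i (x, u, v) ⟨mem_univ _, huU, hvV⟩).tendsto
  refine h1.comp (f := fun k => (xk k, uk k, vk k)) (tendsto_nhdsWithin_iff.2 ⟨?_, ?_⟩)
  · exact hx.prodMk_nhds (hu.prodMk_nhds hv)
  · filter_upwards [hukU, hvkV] with k h2 h3 using ⟨mem_univ _, h2, h3⟩

/-- The fields are Lipschitz in the state on bounded sets, uniformly in the controls. -/
theorem StandingAssumptions.exists_lipschitz (hyp : StandingAssumptions U V g) (R : ℝ) :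
    ∃ L : ℝ, 0 ≤ L ∧ ∀ i x y, ‖x‖ ≤ R → ‖y‖ ≤ R → ∀ u ∈ U, ∀ v ∈ V,
      ‖g i x u v - g i y u v‖ ≤ L * ‖x - y‖ := by
  obtain ⟨M, hM, hg⟩ := hyp.exists_linear_growth
  have hi : ∀ i, ∃ L : ℝ, 0 ≤ L ∧ ∀ x y, ‖x‖ ≤ R → ‖y‖ ≤ R → ∀ u ∈ U, ∀ v ∈ V,
      ‖g i x u v - g i y u v‖ ≤ L * ‖x - y‖ := by
    intro i
    set K : Set (EuclideanSpace ℝ (Fin n) × EuclideanSpace ℝ (Fin m)) :=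
      Metric.closedBall 0 R ×ˢ U with hKdef
    have hK : IsCompact K := (isCompact_closedBall _ _).prod hyp.compact_U
    -- Compactness turns the local constants into one radius and one constant. Here `y` is any point
    -- near `p.1`, possibly outside the ball.
    have hloc : ∃ δ > 0, ∃ L : ℝ, ∀ p ∈ K, ∀ y, dist p (y, p.2) < δ → ∀ v ∈ V,
        ‖g i p.1 p.2 v - g i y p.2 v‖ ≤ L * ‖p.1 - y‖ := by
      refine hK.induction_on (p := fun s => ∃ δ > 0, ∃ L : ℝ, ∀ p ∈ s, ∀ y,
        dist p (y, p.2) < δ → ∀ v ∈ V, ‖g i p.1 p.2 v - g i y p.2 v‖ ≤ L * ‖p.1 - y‖) ?_ ?_ ?_ ?_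
      · exact ⟨1, one_pos, 0, by simp⟩
      · rintro s t hst ⟨δ, hδ, L, h⟩
        exact ⟨δ, hδ, L, fun p hp => h p (hst hp)⟩
      · rintro s t ⟨δ, hδ, L, h⟩ ⟨δ', hδ', L', h'⟩
        refine ⟨min δ δ', lt_min hδ hδ', max L L', fun p hp y hy v hv => ?_⟩
        rcases hp with hp | hp
        · exact (h p hp y (hy.trans_le (min_le_left _ _)) v hv).trans (by gcongr; exact le_max_left _ _)
        · exact (h' p hp y (hy.trans_le (min_le_right _ _)) v hv).trans
            (by gcongr; exact le_max_right _ _)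
      · rintro ⟨x, u⟩ hxu
        obtain ⟨L, W, hW, hL⟩ := hyp.locallyLipschitz i x u hxu.2
        obtain ⟨ε, hε, hεW⟩ := Metric.mem_nhdsWithin_iff.1 hW
        refine ⟨Metric.ball (x, u) (ε / 2) ∩ K, inter_comm K _ ▸ inter_mem_nhdsWithin K
          (Metric.ball_mem_nhds _ (half_pos hε)), ε / 2, half_pos hε, L, fun p hp y hy v hv => ?_⟩
        have hpU : p.2 ∈ U := hp.2.2
        have h1 : p ∈ W := hεW ⟨Metric.ball_subset_ball (by linarith) hp.1, mem_univ _, hpU⟩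
        have h2 : (y, p.2) ∈ W := by
          refine hεW ⟨?_, mem_univ _, hpU⟩
          have h3 : dist p (x, u) < ε / 2 := hp.1
          rw [Metric.mem_ball]
          have := dist_triangle (y, p.2) p (x, u)
          rw [dist_comm (y, p.2) p] at this
          linarith
        have h4 := (hL v hv).dist_le_mul p h1 (y, p.2) h2
        have h5 : dist p (y, p.2) = ‖p.1 - y‖ := by
          rw [Prod.dist_eq]; simp [dist_eq_norm]
        rw [h5, dist_eq_norm] at h4
        exact h4
    obtain ⟨δ, hδ, L, hL⟩ := hloc
    have hB : 0 ≤ M * (1 + |R|) := by positivity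
    refine ⟨max |L| (2 * (M * (1 + |R|)) / δ), by positivity, fun x y hx hy u hu v hv => ?_⟩
    by_cases hxy : ‖x - y‖ < δ
    · refine (hL (x, u) ⟨by simpa using hx, hu⟩ y ?_ v hv).trans ?_
      · rw [Prod.dist_eq]; simpa [dist_eq_norm, hδ] using hxy
      · gcongr
        exact (le_abs_self L).trans (le_max_left _ _)
    -- Distant pairs need only the bound on the fields, since `‖x - y‖ ≥ δ`.
    · push Not at hxy
      have hb : ∀ z, ‖z‖ ≤ R → ‖g i z u v‖ ≤ M * (1 + |R|) := fun z hz =>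
        (hg i z u hu v hv).trans (by gcongr; exact hz.trans (le_abs_self R))
      calc ‖g i x u v - g i y u v‖ ≤ 2 * (M * (1 + |R|)) := by
            have := norm_sub_le (g i x u v) (g i y u v)
            linarith [hb x hx, hb y hy]
        _ = 2 * (M * (1 + |R|)) / δ * δ := by field_simp
        _ ≤ max |L| (2 * (M * (1 + |R|)) / δ) * ‖x - y‖ := by
            gcongr
            exact le_max_right _ _
  choose L hL0 hL using hi
  refine ⟨∑ i, L i, Finset.sum_nonneg fun i _ => hL0 i, fun i x y hx hy u hu v hv =>
    (hL i x y hx hy u hu v hv).trans ?_⟩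
  gcongr
  exact Finset.single_le_sum (fun j _ => hL0 j) (Finset.mem_univ i)

/-- The right-hand side of the space-time system. -/
noncomputable def spaceTimeField
    (g : Fin (m + 1) → EuclideanSpace ℝ (Fin n) → EuclideanSpace ℝ (Fin m) →
      EuclideanSpace ℝ (Fin l) → EuclideanSpace ℝ (Fin n)) (q : ℝ)
    (w : EuclideanSpace ℝ (Fin m)) (x : EuclideanSpace ℝ (Fin n)) (u : EuclideanSpace ℝ (Fin m))
    (v₁ v₂ : EuclideanSpace ℝ (Fin l)) : EuclideanSpace ℝ (Fin n) :=
  q • g 0 x u v₁ + ∑ i : Fin m, w i • g i.succ x u v₂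

/-- This serves twice: applied to the fields it bounds their growth, applied to their increments
through `spaceTimeField_sub` it gives the Lipschitz estimate in the state. -/
theorem norm_smul_add_sum_smul_le {F : Type*} [NormedAddCommGroup F] [NormedSpace ℝ F]
    {q D Q : ℝ} {w : EuclideanSpace ℝ (Fin m)} {a : F} {b : Fin m → F}
    (hq : |q| ≤ Q) (hw : ‖w‖ ≤ Q)
    (ha : ‖a‖ ≤ D) (hb : ∀ i, ‖b i‖ ≤ D) : ‖q • a + ∑ i, w i • b i‖ ≤ (m + 1) * Q * D := by
  have hQ : 0 ≤ Q := (abs_nonneg q).trans hq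
  have h1 : ‖q • a‖ ≤ Q * D := by rw [norm_smul]; exact mul_le_mul hq ha (norm_nonneg _) hQ
  have h2 : ‖∑ i, w i • b i‖ ≤ ∑ _i : Fin m, Q * D := by
    refine (norm_sum_le _ _).trans (Finset.sum_le_sum fun i _ => ?_)
    rw [norm_smul]
    exact mul_le_mul ((PiLp.norm_apply_le w i).trans hw) (hb i) (norm_nonneg _) hQ
  rw [Finset.sum_const, Finset.card_univ, Fintype.card_fin, nsmul_eq_mul] at h2
  have := norm_add_le (q • a) (∑ i, w i • b i)
  linarith

theorem spaceTimeField_sub (q : ℝ) (w : EuclideanSpace ℝ (Fin m))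
    (x y : EuclideanSpace ℝ (Fin n)) (u : EuclideanSpace ℝ (Fin m))
    (v₁ v₂ : EuclideanSpace ℝ (Fin l)) :
    spaceTimeField g q w x u v₁ v₂ - spaceTimeField g q w y u v₁ v₂ =
      q • (g 0 x u v₁ - g 0 y u v₁) + ∑ i, w i • (g i.succ x u v₂ - g i.succ y u v₂) := by
  simp only [spaceTimeField, smul_sub, Finset.sum_sub_distrib]
  abel

theorem StandingAssumptions.aestronglyMeasurable_spaceTimeField (hyp : StandingAssumptions U V g)
    {μ : Measure ℝ} {q : ℝ → ℝ} {x : ℝ → EuclideanSpace ℝ (Fin n)}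
    {w u : ℝ → EuclideanSpace ℝ (Fin m)} {v₁ v₂ : ℝ → EuclideanSpace ℝ (Fin l)}
    (hq : AEMeasurable q μ) (hw : AEMeasurable w μ)
    (hx : AEMeasurable x μ) (hu : AEMeasurable u μ) (huU : ∀ᵐ s ∂μ, u s ∈ U)
    (hv₁ : AEMeasurable v₁ μ) (hv₁V : ∀ᵐ s ∂μ, v₁ s ∈ V)
    (hv₂ : AEMeasurable v₂ μ) (hv₂V : ∀ᵐ s ∂μ, v₂ s ∈ V) :
    AEStronglyMeasurable
      (fun s => spaceTimeField g (q s) (w s) (x s) (u s) (v₁ s) (v₂ s)) μ := by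
  unfold spaceTimeField
  refine (hq.aestronglyMeasurable.smul (hyp.aestronglyMeasurable 0 hx hu huU hv₁ hv₁V)).add ?_
  refine Finset.aestronglyMeasurable_fun_sum _ fun i _ => ?_
  have hwi : AEMeasurable (fun s => w s i) μ :=
    (EuclideanSpace.proj (𝕜 := ℝ) i).continuous.measurable.comp_aemeasurable hw
  exact hwi.aestronglyMeasurable.smul (hyp.aestronglyMeasurable i.succ hx hu huU hv₂ hv₂V)

theorem MemL1Into.mono {v : ℝ → EuclideanSpace ℝ (Fin l)} {I J : Set ℝ} (h : MemL1Into v I V)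
    (hJ : J ⊆ I) : MemL1Into v J V :=
  ⟨h.1.mono_set hJ, ae_restrict_of_ae_restrict_of_subset hJ h.2⟩

theorem MemL1Into.congr {v v' : ℝ → EuclideanSpace ℝ (Fin l)} {I : Set ℝ} (h : MemL1Into v I V)
    (hv : v =ᵐ[volume.restrict I] v') : MemL1Into v' I V :=
  ⟨h.1.congr hv, by filter_upwards [h.2, hv] with t h1 h2; rwa [← h2]⟩

theorem MemL1Into.of_measurable {v : ℝ → EuclideanSpace ℝ (Fin l)} (hV : IsCompact V)
    (hv : Measurable v) (hvV : ∀ t, v t ∈ V) (a b : ℝ) : MemL1Into v (Icc a b) V := by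
  obtain ⟨B, hB⟩ := hV.isBounded.exists_norm_le
  exact ⟨Integrable.of_bound hv.aestronglyMeasurable B (by simp [hB _ (hvV _)]),
    by simp [hvV]⟩

/-- A Borel representative all of whose values lie in `V`. -/
theorem MemL1Into.exists_measurable {v : ℝ → EuclideanSpace ℝ (Fin l)} {I : Set ℝ}
    (h : MemL1Into v I V) (hV : IsCompact V) (hne : V.Nonempty) :
    ∃ v' : ℝ → EuclideanSpace ℝ (Fin l), Measurable v' ∧ (∀ t, v' t ∈ V) ∧
      v =ᵐ[volume.restrict I] v' := by
  classical
  obtain ⟨v₀, hv₀⟩ := hne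
  have hm := h.1.aemeasurable
  have hms : MeasurableSet (hm.mk v ⁻¹' V) := hm.measurable_mk hV.isClosed.measurableSet
  refine ⟨fun t => if t ∈ hm.mk v ⁻¹' V then hm.mk v t else v₀,
    Measurable.ite hms hm.measurable_mk measurable_const, fun t => ?_, ?_⟩
  · by_cases ht : t ∈ hm.mk v ⁻¹' V
    · simp only [ht, if_true]; exact ht
    · simp only [ht, if_false]; exact hv₀
  · filter_upwards [h.2, hm.ae_eq_mk] with t h1 h2
    have : hm.mk v t ∈ V := h2 ▸ h1
    simp only [mem_preimage, this, if_true, h2]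

end Fields

/-! ### Space-time trajectories: bounds, uniqueness and the limit of the control part -/

section Trajectories

variable {n m l : ℕ} {U : Set (EuclideanSpace ℝ (Fin m))} {V : Set (EuclideanSpace ℝ (Fin l))}
  {g : Fin (m + 1) → EuclideanSpace ℝ (Fin n) → EuclideanSpace ℝ (Fin m) →
    EuclideanSpace ℝ (Fin l) → EuclideanSpace ℝ (Fin n)}

/-- Trajectories of the space-time system in integral form. The parametrization `(φ₀, φ)` has
density `(q, w)` and speed bounded, coordinatewise, by one; the case of arc length is not asked. -/
structure IsSpaceTimeTrajectory (U : Set (EuclideanSpace ℝ (Fin m)))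
    (V : Set (EuclideanSpace ℝ (Fin l)))
    (g : Fin (m + 1) → EuclideanSpace ℝ (Fin n) → EuclideanSpace ℝ (Fin m) →
      EuclideanSpace ℝ (Fin l) → EuclideanSpace ℝ (Fin n))
    (x₀ : EuclideanSpace ℝ (Fin n)) (S : ℝ) (φ₀ q : ℝ → ℝ) (φ w : ℝ → EuclideanSpace ℝ (Fin m))
    (ψ₁ ψ₂ : ℝ → EuclideanSpace ℝ (Fin l)) (ξ : ℝ → EuclideanSpace ℝ (Fin n)) : Prop where
  nonneg : 0 ≤ S
  time : HasDensityOn φ₀ q S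
  time_zero : φ₀ 0 = 0
  control : HasDensityOn φ w S
  mapsTo : MapsTo φ (Icc 0 S) U
  q_nonneg : ∀ᵐ s ∂(volume.restrict (Icc 0 S)), 0 ≤ q s
  q_le : ∀ᵐ s ∂(volume.restrict (Icc 0 S)), q s ≤ 1
  w_le : ∀ᵐ s ∂(volume.restrict (Icc 0 S)), ‖w s‖ ≤ 1
  memL1_fst : MemL1Into ψ₁ (Icc 0 S) V
  memL1_snd : MemL1Into ψ₂ (Icc 0 S) V
  state : HasDensityOn ξ
    (fun s => spaceTimeField g (q s) (w s) (ξ s) (φ s) (ψ₁ s) (ψ₂ s)) S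
  initial : ξ 0 = x₀

variable {x₀ : EuclideanSpace ℝ (Fin n)} {S : ℝ} {φ₀ q : ℝ → ℝ}
  {φ w : ℝ → EuclideanSpace ℝ (Fin m)} {ψ₁ ψ₂ : ℝ → EuclideanSpace ℝ (Fin l)}
  {ξ : ℝ → EuclideanSpace ℝ (Fin n)}

theorem IsSpaceTimeTrajectory.monotoneOn_time
    (h : IsSpaceTimeTrajectory U V g x₀ S φ₀ q φ w ψ₁ ψ₂ ξ) : MonotoneOn φ₀ (Icc 0 S) :=
  h.time.monotoneOn h.q_nonneg

theorem IsSpaceTimeTrajectory.lipschitzOnWith_time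
    (h : IsSpaceTimeTrajectory U V g x₀ S φ₀ q φ w ψ₁ ψ₂ ξ) : LipschitzOnWith 1 φ₀ (Icc 0 S) :=
  h.time.lipschitzOnWith (by
    filter_upwards [h.q_nonneg, h.q_le] with s h1 h2
    rwa [Real.norm_of_nonneg h1])

theorem IsSpaceTimeTrajectory.lipschitzOnWith_control
    (h : IsSpaceTimeTrajectory U V g x₀ S φ₀ q φ w ψ₁ ψ₂ ξ) : LipschitzOnWith 1 φ (Icc 0 S) :=
  h.control.lipschitzOnWith h.w_le

/-- A priori bounds on trajectories of bounded length. -/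
theorem StandingAssumptions.exists_trajectory_bound (hyp : StandingAssumptions U V g)
    (x₀ : EuclideanSpace ℝ (Fin n)) (R : ℝ) :
    ∃ C : ℝ≥0, ∀ {S : ℝ} {φ₀ q : ℝ → ℝ} {φ w : ℝ → EuclideanSpace ℝ (Fin m)}
      {ψ₁ ψ₂ : ℝ → EuclideanSpace ℝ (Fin l)} {ξ : ℝ → EuclideanSpace ℝ (Fin n)},
      IsSpaceTimeTrajectory U V g x₀ S φ₀ q φ w ψ₁ ψ₂ ξ → S ≤ R →
      (∀ s ∈ Icc 0 S, ‖ξ s‖ ≤ C) ∧ LipschitzOnWith C ξ (Icc 0 S) := by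
  obtain ⟨M, hM, hg⟩ := hyp.exists_linear_growth
  -- The growth rate counts `m + 1` fields, each with weight at most one; `B` is the resulting
  -- Grönwall bound, with `|R|` in place of the length.
  set c : ℝ := (m + 1) * M with hc
  have hc0 : 0 ≤ c := by positivity
  set B : ℝ := (‖x₀‖ + c * |R|) * Real.exp (c * |R|) with hB
  have hB0 : 0 ≤ B := by positivity
  refine ⟨⟨max B (c * (1 + B)), le_max_of_le_left hB0⟩, fun {S φ₀ q φ w ψ₁ ψ₂ ξ} h hSR => ?_⟩
  have hgrow : ∀ᵐ s ∂(volume.restrict (Icc 0 S)),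
      ‖spaceTimeField g (q s) (w s) (ξ s) (φ s) (ψ₁ s) (ψ₂ s)‖ ≤ c * (1 + ‖ξ s‖) := by
    filter_upwards [h.q_nonneg, h.q_le, h.w_le, h.memL1_fst.2, h.memL1_snd.2,
      ae_restrict_mem measurableSet_Icc] with s h1 h2 h3 h4 h5 h6
    have := norm_smul_add_sum_smul_le (D := M * (1 + ‖ξ s‖)) (Q := 1)
      (by rwa [abs_of_nonneg h1]) h3 (hg 0 (ξ s) (φ s) (h.mapsTo h6) _ h4)
      (fun i => hg i.succ (ξ s) (φ s) (h.mapsTo h6) _ h5)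
    refine this.trans_eq ?_
    rw [hc]; ring
  have hb : ∀ s ∈ Icc 0 S, ‖ξ s‖ ≤ B := fun s hs => by
    have := h.state.norm_le_of_linear_growth hc0 hgrow hs
    rw [h.initial] at this
    refine this.trans ?_
    have hS : S ≤ |R| := hSR.trans (le_abs_self R)
    have hS0 := h.nonneg
    rw [hB]
    gcongr
  refine ⟨fun s hs => (hb s hs).trans (le_max_left _ _), ?_⟩
  refine h.state.lipschitzOnWith ?_
  filter_upwards [hgrow, ae_restrict_mem measurableSet_Icc] with s h1 h2
  refine h1.trans (le_trans ?_ (le_max_right _ _))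
  gcongr
  exact hb s h2

/-- Both solutions stay in one ball, where the fields are Lipschitz in the state, and Grönwall's
inequality applies to their difference. -/
theorem IsSpaceTimeTrajectory.eqOn (hyp : StandingAssumptions U V g)
    (h : IsSpaceTimeTrajectory U V g x₀ S φ₀ q φ w ψ₁ ψ₂ ξ) {η : ℝ → EuclideanSpace ℝ (Fin n)}
    (h' : IsSpaceTimeTrajectory U V g x₀ S φ₀ q φ w ψ₁ ψ₂ η) : EqOn ξ η (Icc 0 S) := by
  obtain ⟨C, hC⟩ := hyp.exists_trajectory_bound x₀ S
  obtain ⟨L, hL0, hL⟩ := hyp.exists_lipschitz C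
  have hξ := (hC h le_rfl).1
  have hη := (hC h' le_rfl).1
  refine h.state.eqOn_of_norm_sub_le h'.state (h.initial.trans h'.initial.symm)
    (c := (m + 1) * L) (by positivity) ?_
  filter_upwards [h.q_nonneg, h.q_le, h.w_le, h.memL1_fst.2, h.memL1_snd.2,
    ae_restrict_mem measurableSet_Icc] with s h1 h2 h3 h4 h5 h6
  rw [spaceTimeField_sub]
  have := norm_smul_add_sum_smul_le (D := L * ‖ξ s - η s‖) (Q := 1)
    (by rwa [abs_of_nonneg h1]) h3
    (hL 0 (ξ s) (η s) (hξ s h6) (hη s h6) (φ s) (h.mapsTo h6) _ h4)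
    (fun i => hL i.succ (ξ s) (η s) (hξ s h6) (hη s h6) (φ s) (h.mapsTo h6) _ h5)
  refine this.trans_eq ?_
  ring

/-- Seen on the fixed interval `[0, T]`, the integrands cut off at `tk` converge almost everywhere,
the only additional exceptional point being `t`. -/
theorem tendsto_intervalIntegral_of_tendsto {E : Type*} [NormedAddCommGroup E] [NormedSpace ℝ E]
    {T D : ℝ} {hk : ℕ → ℝ → E} {h : ℝ → E}
    (hkm : ∀ k, AEStronglyMeasurable (hk k) (volume.restrict (Icc 0 T)))
    (hDk : ∀ k, ∀ᵐ t ∂(volume.restrict (Icc 0 T)), ‖hk k t‖ ≤ D)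
    (hlim : ∀ᵐ t ∂(volume.restrict (Icc 0 T)), Tendsto (fun k => hk k t) atTop (𝓝 (h t)))
    {tk : ℕ → ℝ} {t : ℝ} (htk : ∀ k, tk k ∈ Icc 0 T) (ht : Tendsto tk atTop (𝓝 t)) :
    Tendsto (fun k => ∫ τ in (0 : ℝ)..tk k, hk k τ) atTop (𝓝 (∫ τ in (0 : ℝ)..t, h τ)) := by
  have htT : t ∈ Icc 0 T := isClosed_Icc.mem_of_tendsto ht (Eventually.of_forall htk)
  have hset : ∀ {r} (_ : r ∈ Icc 0 T) (f : ℝ → E), ∫ τ in (0 : ℝ)..r, f τ =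
      ∫ τ in Icc 0 T, (Iic r).indicator f τ := by
    intro r hr f
    rw [intervalIntegral.integral_of_le hr.1, ← integral_Icc_eq_integral_Ioc,
      setIntegral_indicator measurableSet_Iic]
    congr 2
    ext τ
    simp only [mem_Icc, mem_inter_iff, mem_Iic]
    exact ⟨fun h => ⟨⟨h.1, h.2.trans hr.2⟩, h.2⟩, fun h => ⟨h.1.1, h.2⟩⟩
  rw [hset htT]
  simp_rw [hset (htk _)]
  have hne : ∀ᵐ τ : ℝ, τ ≠ t := by simp [ae_iff, measure_singleton]
  refine tendsto_integral_of_dominated_convergence (fun _ => D)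
    (fun k => (hkm k).indicator measurableSet_Iic) (integrable_const _) (fun k => ?_) ?_
  · filter_upwards [hDk k] with τ hτ
    exact (norm_indicator_le_norm_self _ _).trans hτ
  · filter_upwards [hlim, ae_restrict_of_ae hne] with τ h1 h2
    rcases lt_or_gt_of_ne h2 with h3 | h3
    · have : ∀ᶠ k in atTop, τ < tk k := ht.eventually (lt_mem_nhds h3)
      rw [indicator_of_mem (show τ ∈ Iic t from h3.le)]
      refine h1.congr' ?_
      filter_upwards [this] with k hk
      rw [indicator_of_mem (show τ ∈ Iic (tk k) from hk.le)]
    · have : ∀ᶠ k in atTop, tk k < τ := ht.eventually (gt_mem_nhds h3)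
      rw [indicator_of_notMem (show τ ∉ Iic t from not_le.2 h3)]
      refine tendsto_const_nhds.congr' ?_
      filter_upwards [this] with k hk
      rw [indicator_of_notMem (show τ ∉ Iic (tk k) from not_le.2 hk)]

/-- Passage to the limit in the control part of the space-time system. -/
theorem StandingAssumptions.tendsto_integral_control (hyp : StandingAssumptions U V g) {r B : ℝ}
    {φk wk : ℕ → ℝ → EuclideanSpace ℝ (Fin m)} {ψk : ℕ → ℝ → EuclideanSpace ℝ (Fin l)}
    {ξk : ℕ → ℝ → EuclideanSpace ℝ (Fin n)} (hr : 0 ≤ r)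
    (hφk : ∀ k, HasDensityOn (φk k) (wk k) r) (hφ : HasDensityOn φ w r)
    (hwk : ∀ k, ∀ᵐ s ∂(volume.restrict (Icc 0 r)), ‖wk k s‖ ≤ 1)
    (hw : ∀ᵐ s ∂(volume.restrict (Icc 0 r)), ‖w s‖ ≤ 1)
    (hφkU : ∀ k, MapsTo (φk k) (Icc 0 r) U) (hφU : MapsTo φ (Icc 0 r) U)
    (hψk : ∀ k, MemL1Into (ψk k) (Icc 0 r) V) (hψ : MemL1Into ψ₂ (Icc 0 r) V)
    (hξk : ∀ k, ContinuousOn (ξk k) (Icc 0 r)) (hξ : ContinuousOn ξ (Icc 0 r))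
    (hξkB : ∀ k, ∀ s ∈ Icc 0 r, ‖ξk k s‖ ≤ B)
    (hφlim : ∀ s ∈ Icc 0 r, Tendsto (fun k => φk k s) atTop (𝓝 (φ s)))
    (hξlim : ∀ s ∈ Icc 0 r, Tendsto (fun k => ξk k s) atTop (𝓝 (ξ s)))
    (hψlim : ∀ᵐ s ∂(volume.restrict (Icc 0 r)), Tendsto (fun k => ψk k s) atTop (𝓝 (ψ₂ s))) :
    Tendsto (fun k => ∫ s in (0 : ℝ)..r, ∑ i, wk k s i • g i.succ (ξk k s) (φk k s) (ψk k s))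
      atTop (𝓝 (∫ s in (0 : ℝ)..r, ∑ i, w s i • g i.succ (ξ s) (φ s) (ψ₂ s))) := by
  obtain ⟨M, hM, hg⟩ := hyp.exists_linear_growth
  set μ := volume.restrict (Icc 0 r) with hμ
  have hξB : ∀ s ∈ Icc 0 r, ‖ξ s‖ ≤ B := fun s hs =>
    le_of_tendsto (hξlim s hs).norm (Eventually.of_forall fun k => hξkB k s hs)
  have hmem : ∀ᵐ s ∂μ, s ∈ Icc 0 r := ae_restrict_mem measurableSet_Icc
  have hmeas : ∀ (i : Fin m) {x : ℝ → EuclideanSpace ℝ (Fin n)}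
      {u p : ℝ → EuclideanSpace ℝ (Fin m)} {v : ℝ → EuclideanSpace ℝ (Fin l)},
      ContinuousOn x (Icc 0 r) → HasDensityOn u p r → MapsTo u (Icc 0 r) U →
      MemL1Into v (Icc 0 r) V → AEStronglyMeasurable (fun s => g i.succ (x s) (u s) (v s)) μ :=
    fun i _ _ _ _ hx hu huU hv => hyp.aestronglyMeasurable i.succ
      (hx.aemeasurable measurableSet_Icc) (hu.continuousOn.aemeasurable measurableSet_Icc)
      (hmem.mono fun s hs => huU hs) hv.1.aemeasurable hv.2
  have hbd : ∀ (i : Fin m) {x : ℝ → EuclideanSpace ℝ (Fin n)}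
      {u : ℝ → EuclideanSpace ℝ (Fin m)} {v : ℝ → EuclideanSpace ℝ (Fin l)},
      (∀ s ∈ Icc 0 r, ‖x s‖ ≤ B) → MapsTo u (Icc 0 r) U →
      MemL1Into v (Icc 0 r) V → ∀ᵐ s ∂μ, ‖g i.succ (x s) (u s) (v s)‖ ≤ M * (1 + B) :=
    fun i x u v hx hu hv => by
      filter_upwards [hmem, hv.2] with s h1 h2
      refine (hg i.succ (x s) (u s) (hu h1) (v s) h2).trans ?_
      gcongr
      exact hx s h1
  have hwi : ∀ (i : Fin m) {p : ℝ → EuclideanSpace ℝ (Fin m)}, IntegrableOn p (Icc 0 r) →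
      Integrable (fun s => p s i) μ := fun i _ hp =>
    (EuclideanSpace.proj (𝕜 := ℝ) i).integrable_comp hp
  have hwle : ∀ (i : Fin m) {p : ℝ → EuclideanSpace ℝ (Fin m)},
      (∀ᵐ s ∂μ, ‖p s‖ ≤ 1) → ∀ᵐ s ∂μ, ‖p s i‖ ≤ 1 := fun i _ hp =>
    hp.mono fun s hs => (PiLp.norm_apply_le _ i).trans hs
  have hInt : ∀ (i : Fin m) {p : ℝ → EuclideanSpace ℝ (Fin m)} {f : ℝ → EuclideanSpace ℝ (Fin n)},
      IntegrableOn p (Icc 0 r) → (∀ᵐ s ∂μ, ‖p s‖ ≤ 1) → AEStronglyMeasurable f μ →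
      (∀ᵐ s ∂μ, ‖f s‖ ≤ M * (1 + B)) → Integrable (fun s => p s i • f s) μ :=
    fun i p f hp hp1 hf hfB => (Integrable.of_bound hf _ hfB).bdd_smul 1
      (hwi i hp).aestronglyMeasurable (hwle i hp1)
  have hval : ∀ {x : ℝ → EuclideanSpace ℝ (Fin n)}
      {u p : ℝ → EuclideanSpace ℝ (Fin m)} {v : ℝ → EuclideanSpace ℝ (Fin l)},
      ContinuousOn x (Icc 0 r) → (∀ s ∈ Icc 0 r, ‖x s‖ ≤ B) → HasDensityOn u p r →
      (∀ᵐ s ∂μ, ‖p s‖ ≤ 1) → MapsTo u (Icc 0 r) U → MemL1Into v (Icc 0 r) V →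
      ∫ s in (0 : ℝ)..r, ∑ i, p s i • g i.succ (x s) (u s) (v s) =
        ∑ i, ∫ s, p s i • g i.succ (x s) (u s) (v s) ∂μ :=
    fun hx hxB hu hp huU hv => by
      rw [intervalIntegral.integral_of_le hr, ← integral_Icc_eq_integral_Ioc,
        integral_finsetSum _ fun i _ => hInt i hu.1 hp (hmeas i hx hu huU hv) (hbd i hxB huU hv)]
  rw [hval hξ hξB hφ hw hφU hψ]
  simp_rw [hval (hξk _) (hξkB _) (hφk _) (hwk _) (hφkU _) (hψk _)]
  refine tendsto_finsetSum _ fun i _ => ?_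
  -- The primitives of the coordinates of `wk` are increments of `φk`, which converge pointwise.
  -- This is the weak convergence of the densities; the fields converge boundedly almost everywhere.
  have hprim : ∀ {u p : ℝ → EuclideanSpace ℝ (Fin m)}, HasDensityOn u p r →
      ∀ s ∈ Icc 0 r, ∫ τ in Icc 0 s, p τ i = u s i - u 0 i := fun {u p} hu s hs => by
    have h1 := (hu.clm_comp (EuclideanSpace.proj (𝕜 := ℝ) i)).2 s hs
    simp only [PiLp.proj_apply] at h1
    rw [integral_Icc_eq_integral_Ioc, ← intervalIntegral.integral_of_le hs.1, h1]
    ring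
  have h00 : (0 : ℝ) ∈ Icc 0 r := ⟨le_rfl, hr⟩
  have hcoord : ∀ s ∈ Icc 0 r, Tendsto (fun k => φk k s i - φk k 0 i) atTop
      (𝓝 (φ s i - φ 0 i)) := fun s hs =>
    ((((EuclideanSpace.proj (𝕜 := ℝ) i).continuous.tendsto _).comp (hφlim s hs)).sub
      (((EuclideanSpace.proj (𝕜 := ℝ) i).continuous.tendsto _).comp (hφlim 0 h00)))
  refine tendsto_integral_smul_of_tendsto_Iic_of_ae (C := 1) (D := M * (1 + B))
    (fun k => (hwi i (hφk k).1).aestronglyMeasurable) (hwi i hφ.1).aestronglyMeasurable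
    (fun k => hwle i (hwk k)) (hwle i hw) ?_ ?_
    (fun k => hmeas i (hξk k) (hφk k) (hφkU k) (hψk k)) (hmeas i hξ hφ hφU hψ)
    (fun k => hbd i (hξkB k) (hφkU k) (hψk k)) (hbd i hξB hφU hψ) ?_
  · simp only [hμ]
    rw [hprim hφ r ⟨hr, le_rfl⟩]
    simp_rw [hprim (hφk _) r ⟨hr, le_rfl⟩]
    exact hcoord r ⟨hr, le_rfl⟩
  · intro s
    rw [hμ, Measure.restrict_restrict measurableSet_Iic]
    rcases lt_or_ge s 0 with hs | hs
    · have : Iic s ∩ Icc 0 r = ∅ := eq_empty_of_forall_notMem fun τ hτ => by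
        have h3 : τ ≤ s := hτ.1
        linarith [hτ.2.1]
      simp [this]
    · have : Iic s ∩ Icc 0 r = Icc 0 (min s r) := by
        ext τ; simp only [mem_inter_iff, mem_Iic, mem_Icc, le_min_iff]; tauto
      have hsr : min s r ∈ Icc 0 r := ⟨le_min hs hr, min_le_right _ _⟩
      rw [this, hprim hφ _ hsr]
      simp_rw [hprim (hφk _) _ hsr]
      exact hcoord _ hsr
  · filter_upwards [hmem, hψlim, ae_all_iff.2 fun k => (hψk k).2, hψ.2] with s h1 h2 h3 h4
    exact hyp.tendsto i.succ (hξlim s h1) (hφlim s h1) h2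
      (Eventually.of_forall fun k => hφkU k h1) (Eventually.of_forall h3) (hφU h1) h4

end Trajectories

/-! ### Closure of the space-time system under limits -/

theorem ae_restrict_Icc_mem_nhds (a b : ℝ) :
    ∀ᵐ s ∂(volume.restrict (Icc a b)), Icc a b ∈ 𝓝 s := by
  have h₁ : ∀ᵐ x : ℝ, x ≠ a := by simp [ae_iff, measure_singleton]
  have h₂ : ∀ᵐ x : ℝ, x ≠ b := by simp [ae_iff, measure_singleton]
  filter_upwards [ae_restrict_mem measurableSet_Icc, ae_restrict_of_ae h₁, ae_restrict_of_ae h₂]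
    with s hs hs0 hsS
  exact Icc_mem_nhds (lt_of_le_of_ne hs.1 hs0.symm) (lt_of_le_of_ne hs.2 hsS)

theorem LipschitzOnWith.ae_norm_deriv_le {E : Type*} [NormedAddCommGroup E] [NormedSpace ℝ E]
    {f : ℝ → E} {K : ℝ≥0} {a b : ℝ} (h : LipschitzOnWith K f (Icc a b)) :
    ∀ᵐ s ∂(volume.restrict (Icc a b)), ‖deriv f s‖ ≤ K := by
  filter_upwards [ae_restrict_Icc_mem_nhds a b] with s hs
  exact norm_deriv_le_of_lipschitzOn hs h

theorem MonotoneOn.ae_deriv_nonneg {f : ℝ → ℝ} {a b : ℝ} (h : MonotoneOn f (Icc a b)) :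
    ∀ᵐ s ∂(volume.restrict (Icc a b)), 0 ≤ deriv f s := by
  filter_upwards [ae_restrict_Icc_mem_nhds a b] with s hs
  by_cases hd : DifferentiableAt ℝ f s
  · refine ge_of_tendsto (hasDerivAt_iff_tendsto_slope.1 hd.hasDerivAt) ?_
    filter_upwards [nhdsWithin_le_nhds hs] with y hy
    exact h.slope_nonneg (mem_of_mem_nhds hs) hy
  · rw [deriv_zero_of_not_differentiableAt hd]

/-- This allows the integral equation of a limit to be checked only for `r < S`, where `[0, r]`
eventually lies in the approximating intervals; continuity supplies the endpoint. -/
theorem HasDensityOn.of_forall_lt {E : Type*} [NormedAddCommGroup E] [NormedSpace ℝ E]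
    {f p : ℝ → E} {S : ℝ} (hp : IntegrableOn p (Icc 0 S)) (hf : ContinuousOn f (Icc 0 S))
    (h : ∀ s ∈ Ico 0 S, f s = f 0 + ∫ τ in (0 : ℝ)..s, p τ) : HasDensityOn f p S := by
  refine ⟨hp, fun s hs => ?_⟩
  rcases hs.2.lt_or_eq with hlt | rfl
  · exact h s ⟨hs.1, hlt⟩
  rcases hs.1.eq_or_lt with h0 | h0
  · rw [← h0]; simp
  have hP : HasDensityOn (fun s => ∫ τ in (0 : ℝ)..s, p τ) p s := ⟨hp, fun r _ => by simp⟩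
  have hcl : s ∈ closure (Ico 0 s) := by rw [closure_Ico h0.ne]; exact hs
  have h1 : ContinuousWithinAt f (Ico 0 s) s := (hf s hs).mono Ico_subset_Icc_self
  have h2 : ContinuousWithinAt (fun s => f 0 + ∫ τ in (0 : ℝ)..s, p τ) (Ico 0 s) s :=
    ((continuousOn_const.add hP.continuousOn) s hs).mono Ico_subset_Icc_self
  have hne : (𝓝[Ico 0 s] s).NeBot := mem_closure_iff_nhdsWithin_neBot.1 hcl
  refine tendsto_nhds_unique h1 (h2.tendsto.congr' ?_)
  filter_upwards [self_mem_nhdsWithin] with r hr using (h r hr).symm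

theorem HasDensityOn.integral_comp_eq {E : Type*} [NormedAddCommGroup E] [NormedSpace ℝ E]
    {a α : ℝ → ℝ} {r : ℝ} (hr : 0 ≤ r) (h : HasDensityOn a α r)
    (h0 : ∀ᵐ s ∂(volume.restrict (Icc 0 r)), 0 ≤ α s) (ha0 : a 0 = 0) {H : ℝ → E}
    (hH : AEStronglyMeasurable H (volume.restrict (Icc 0 (a r)))) :
    ∫ t in (0 : ℝ)..a r, H t = ∫ s in (0 : ℝ)..r, α s • H (a s) := by
  have har : 0 ≤ a r := ha0 ▸ h.monotoneOn h0 ⟨le_rfl, hr⟩ ⟨hr, le_rfl⟩ hr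
  rw [intervalIntegral.integral_of_le hr, intervalIntegral.integral_of_le har,
    ← integral_Icc_eq_integral_Ioc, ← integral_Icc_eq_integral_Ioc,
    ← h.map_withDensity hr h0 ha0, integral_map (h.aemeasurable_withDensity _)
    (by rwa [h.map_withDensity hr h0 ha0]),
    integral_withDensity_eq_integral_toReal_smul₀ h.1.aemeasurable.ennreal_ofReal (by simp)]
  refine integral_congr_ae ?_
  filter_upwards [h0] with s hs
  rw [ENNReal.toReal_ofReal hs]

section

variable {n m l : ℕ} {U : Set (EuclideanSpace ℝ (Fin m))} {V : Set (EuclideanSpace ℝ (Fin l))}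
  {g : Fin (m + 1) → EuclideanSpace ℝ (Fin n) → EuclideanSpace ℝ (Fin m) →
    EuclideanSpace ℝ (Fin l) → EuclideanSpace ℝ (Fin n)}
  {x₀ : EuclideanSpace ℝ (Fin n)} {S : ℝ} {φ₀ q : ℝ → ℝ}
  {φ w : ℝ → EuclideanSpace ℝ (Fin m)} {ψ₁ ψ₂ : ℝ → EuclideanSpace ℝ (Fin l)}
  {ξ : ℝ → EuclideanSpace ℝ (Fin n)}

theorem strictMonoOn_of_rightInverse {a σ : ℝ → ℝ} {T S : ℝ} (ha : MonotoneOn a (Icc 0 S))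
    (hσ : ∀ t ∈ Icc 0 T, σ t ∈ Icc 0 S ∧ a (σ t) = t) : StrictMonoOn σ (Icc 0 T) := by
  intro s hs t ht hst
  by_contra! hlt
  have := ha (hσ t ht).1 (hσ s hs).1 hlt
  rw [(hσ t ht).2, (hσ s hs).2] at this
  linarith

theorem ContinuousOn.aemeasurable_comp_monotoneOn {E : Type*} [TopologicalSpace E]
    [MeasurableSpace E] [BorelSpace E] {f : ℝ → E} {σ : ℝ → ℝ} {T S : ℝ}
    (hf : ContinuousOn f (Icc 0 S)) (hσ : MonotoneOn σ (Icc 0 T))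
    (hmaps : MapsTo σ (Icc 0 T) (Icc 0 S)) :
    AEMeasurable (fun t => f (σ t)) (volume.restrict (Icc 0 T)) := by
  rcases lt_or_ge S 0 with hS | hS
  · have : Icc 0 T = ∅ := eq_empty_of_forall_notMem fun t ht => by
      have := hmaps ht; linarith [this.1, this.2]
    simp [this]
  have hproj : ∀ τ, max 0 (min τ S) ∈ Icc 0 S := fun τ =>
    ⟨le_max_left _ _, max_le hS (min_le_right _ _)⟩
  have hc : Continuous fun s => f (max 0 (min s S)) := hf.comp_continuous (by fun_prop) hproj
  have h1 := hc.measurable.comp_aemeasurable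
    (aemeasurable_restrict_of_monotoneOn (μ := volume) measurableSet_Icc hσ)
  refine h1.congr ?_
  filter_upwards [ae_restrict_mem measurableSet_Icc] with t ht
  simp [min_eq_left (hmaps ht).2, max_eq_right (hmaps ht).1]

theorem StandingAssumptions.aestronglyMeasurable_drift (hyp : StandingAssumptions U V g)
    {σ : ℝ → ℝ} {v : ℝ → EuclideanSpace ℝ (Fin l)} {T : ℝ}
    (hφ : ContinuousOn φ (Icc 0 S)) (hφU : MapsTo φ (Icc 0 S) U) (hξ : ContinuousOn ξ (Icc 0 S))
    (hv : Measurable v) (hvV : ∀ t, v t ∈ V) (hσ : MonotoneOn σ (Icc 0 T))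
    (hσS : MapsTo σ (Icc 0 T) (Icc 0 S)) :
    AEStronglyMeasurable (fun t => g 0 (ξ (σ t)) (φ (σ t)) (v t)) (volume.restrict (Icc 0 T)) := by
  refine hyp.aestronglyMeasurable 0 (hξ.aemeasurable_comp_monotoneOn hσ hσS)
    (hφ.aemeasurable_comp_monotoneOn hσ hσS) ?_ hv.aemeasurable (by simp [hvV])
  filter_upwards [ae_restrict_mem measurableSet_Icc] with t ht using hφU (hσS ht)

/-- The drift term in the original time and in the space-time parameter. -/
theorem StandingAssumptions.integral_drift (hyp : StandingAssumptions U V g)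
    (hS : 0 ≤ S) (ht : HasDensityOn φ₀ q S) (ht0 : φ₀ 0 = 0)
    (hq : ∀ᵐ s ∂(volume.restrict (Icc 0 S)), 0 ≤ q s) (hφ : ContinuousOn φ (Icc 0 S))
    (hφU : MapsTo φ (Icc 0 S) U) (hξ : ContinuousOn ξ (Icc 0 S))
    {v : ℝ → EuclideanSpace ℝ (Fin l)} (hv : Measurable v) (hvV : ∀ t, v t ∈ V) {σ : ℝ → ℝ}
    (hσ : ∀ t ∈ Icc 0 (φ₀ S), σ t ∈ Icc 0 S ∧ φ₀ (σ t) = t) {r : ℝ} (hr : r ∈ Icc 0 S) :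
    ∫ t in (0 : ℝ)..φ₀ r, g 0 (ξ (σ t)) (φ (σ t)) (v t) =
      ∫ s in (0 : ℝ)..r, q s • g 0 (ξ s) (φ s) (v (φ₀ s)) := by
  have hm := ht.monotoneOn hq
  have hsub : Icc 0 r ⊆ Icc 0 S := Icc_subset_Icc le_rfl hr.2
  have hmaps : ∀ s ∈ Icc 0 S, φ₀ s ∈ Icc 0 (φ₀ S) := fun s hs =>
    ⟨ht0 ▸ hm ⟨le_rfl, hS⟩ hs hs.1, hm hs ⟨hS, le_rfl⟩ hs.2⟩
  rw [(ht.mono hr.2).integral_comp_eq hr.1 (ae_restrict_of_ae_restrict_of_subset hsub hq) ht0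
    ((hyp.aestronglyMeasurable_drift hφ hφU hξ hv hvV
      (strictMonoOn_of_rightInverse hm hσ).monotoneOn fun t ht => (hσ t ht).1).mono_measure
      (Measure.restrict_mono (Icc_subset_Icc le_rfl (hmaps r hr).2) le_rfl)),
    intervalIntegral.integral_of_le hr.1, intervalIntegral.integral_of_le hr.1]
  refine integral_congr_ae (ae_restrict_of_ae_restrict_of_subset
    (Ioc_subset_Icc_self.trans hsub) ?_)
  -- For almost every `s` with `q s ≠ 0` one has `σ (φ₀ s) = s`; where `q s = 0` both integrands
  -- vanish, whatever `σ (φ₀ s)` is.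
  filter_upwards [ht.ae_rightInverse_comp hq fun s hs => hσ _ (hmaps s hs)] with s hs
  by_cases hz : q s = 0
  · simp [hz]
  · rw [hs hz]

theorem StandingAssumptions.integrableOn_spaceTimeField (hyp : StandingAssumptions U V g) {B : ℝ}
    (hq : IntegrableOn q (Icc 0 S)) (hw : IntegrableOn w (Icc 0 S))
    (hq1 : ∀ᵐ s ∂(volume.restrict (Icc 0 S)), |q s| ≤ 1)
    (hw1 : ∀ᵐ s ∂(volume.restrict (Icc 0 S)), ‖w s‖ ≤ 1) (hφ : ContinuousOn φ (Icc 0 S))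
    (hφU : MapsTo φ (Icc 0 S) U) (hξ : ContinuousOn ξ (Icc 0 S))
    (hξB : ∀ s ∈ Icc 0 S, ‖ξ s‖ ≤ B) (hψ₁ : MemL1Into ψ₁ (Icc 0 S) V)
    (hψ₂ : MemL1Into ψ₂ (Icc 0 S) V) :
    IntegrableOn (fun s => q s • g 0 (ξ s) (φ s) (ψ₁ s)) (Icc 0 S) ∧
    IntegrableOn (fun s => ∑ i : Fin m, w s i • g i.succ (ξ s) (φ s) (ψ₂ s)) (Icc 0 S) := by
  obtain ⟨M, hM, hg⟩ := hyp.exists_linear_growth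
  have hmem : ∀ᵐ s ∂(volume.restrict (Icc 0 S)), s ∈ Icc 0 S := ae_restrict_mem measurableSet_Icc
  have hInt : ∀ i {v : ℝ → EuclideanSpace ℝ (Fin l)}, MemL1Into v (Icc 0 S) V →
      Integrable (fun s => g i (ξ s) (φ s) (v s)) (volume.restrict (Icc 0 S)) := fun i v hv =>
    Integrable.of_bound (C := M * (1 + B)) (hyp.aestronglyMeasurable i
      (hξ.aemeasurable measurableSet_Icc)
      (hφ.aemeasurable measurableSet_Icc) (hmem.mono fun s hs => hφU hs) hv.1.aemeasurable hv.2)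
      (by
        filter_upwards [hmem, hv.2] with s h1 h2
        refine (hg i (ξ s) (φ s) (hφU h1) (v s) h2).trans ?_
        gcongr
        exact hξB s h1)
  refine ⟨(hInt 0 hψ₁).bdd_smul 1 hq.aestronglyMeasurable hq1, ?_⟩
  refine integrable_finsetSum _ fun i _ => ?_
  exact (hInt i.succ hψ₂).bdd_smul 1
    ((EuclideanSpace.proj (𝕜 := ℝ) i).integrable_comp hw).aestronglyMeasurable
    (hw1.mono fun s hs => (PiLp.norm_apply_le _ i).trans hs)

/-- The filter is arbitrary because the clock will be obtained along an ultrafilter. -/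
theorem tendsto_apply_of_lipschitzOnWith {E : Type*} [PseudoMetricSpace E] {L : Filter ℕ}
    {f : ℕ → ℝ → E}
    {K : ℝ≥0} {Sk rk sk : ℕ → ℝ} {y : E} (hK : ∀ k, LipschitzOnWith K (f k) (Icc 0 (Sk k)))
    (hrk : ∀ k, rk k ∈ Icc 0 (Sk k)) (hsk : ∀ k, sk k ∈ Icc 0 (Sk k))
    (hy : Tendsto (fun k => f k (rk k)) L (𝓝 y))
    (h : Tendsto (fun k => sk k - rk k) L (𝓝 0)) :
    Tendsto (fun k => f k (sk k)) L (𝓝 y) := by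
  refine tendsto_of_tendsto_of_dist hy (squeeze_zero (fun _ => dist_nonneg)
    (fun k => (hK k).dist_le_mul _ (hrk k) _ (hsk k)) ?_)
  have h1 : Tendsto (fun k => dist (rk k) (sk k)) L (𝓝 0) := by
    simpa [Real.dist_eq, abs_sub_comm] using h.abs
  simpa using h1.const_mul (K : ℝ)

/-- Limits of trajectories of the space-time system are trajectories. -/
theorem StandingAssumptions.isSpaceTimeTrajectory_of_tendsto (hyp : StandingAssumptions U V g)
    {T : ℝ} {Sk : ℕ → ℝ} {φ₀k qk : ℕ → ℝ → ℝ} {φk wk : ℕ → ℝ → EuclideanSpace ℝ (Fin m)}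
    {v₁k ψ₂k : ℕ → ℝ → EuclideanSpace ℝ (Fin l)} {ξk : ℕ → ℝ → EuclideanSpace ℝ (Fin n)}
    {σk : ℕ → ℝ → ℝ} {v₁ : ℝ → EuclideanSpace ℝ (Fin l)} {σ : ℝ → ℝ}
    (hk : ∀ k, IsSpaceTimeTrajectory U V g x₀ (Sk k) (φ₀k k) (qk k) (φk k) (wk k)
      (fun s => v₁k k (φ₀k k s)) (ψ₂k k) (ξk k))
    (hT : 0 ≤ T) (hend : ∀ k, φ₀k k (Sk k) = T)
    (hSk : Tendsto Sk atTop (𝓝 S)) (hσk : ∀ k, ∀ t ∈ Icc 0 T, σk k t ∈ Icc 0 (Sk k) ∧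
      φ₀k k (σk k t) = t)
    (hv₁k : ∀ k, Measurable (v₁k k)) (hv₁kV : ∀ k t, v₁k k t ∈ V)
    (hv₁ : Measurable v₁) (hv₁V : ∀ t, v₁ t ∈ V) (hψ₂ : MemL1Into ψ₂ (Icc 0 S) V)
    (hφ₀lim : ∀ s ∈ Icc 0 S, Tendsto (fun k => φ₀k k (min s (Sk k))) atTop (𝓝 (φ₀ s)))
    (hφlim : ∀ s ∈ Icc 0 S, Tendsto (fun k => φk k (min s (Sk k))) atTop (𝓝 (φ s)))
    (hξlim : ∀ s ∈ Icc 0 S, Tendsto (fun k => ξk k (min s (Sk k))) atTop (𝓝 (ξ s)))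
    (hσ : ∀ t ∈ Icc 0 T, σ t ∈ Icc 0 S ∧ φ₀ (σ t) = t)
    (hσlim : ∀ᵐ t ∂(volume.restrict (Icc 0 T)), Tendsto (fun k => σk k t) atTop (𝓝 (σ t)))
    (hv₁lim : ∀ᵐ t ∂(volume.restrict (Icc 0 T)), Tendsto (fun k => v₁k k t) atTop (𝓝 (v₁ t)))
    (hψ₂lim : ∀ᵐ s ∂(volume.restrict (Icc 0 S)), Tendsto (fun k => ψ₂k k s) atTop (𝓝 (ψ₂ s))) :
    IsSpaceTimeTrajectory U V g x₀ S φ₀ (deriv φ₀) φ (deriv φ) (fun s => v₁ (φ₀ s)) ψ₂ ξ := by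
  have hS : 0 ≤ S := ge_of_tendsto' hSk fun k => (hk k).nonneg
  have h00 : (0 : ℝ) ∈ Icc 0 S := ⟨le_rfl, hS⟩
  have hSS : S ∈ Icc 0 S := ⟨hS, le_rfl⟩
  obtain ⟨R, hR⟩ := hSk.bddAbove_range
  obtain ⟨C, hC⟩ := hyp.exists_trajectory_bound x₀ R
  have hSR : ∀ k, Sk k ≤ R := fun k => hR (mem_range_self k)
  have hmin : ∀ s ∈ Icc 0 S, ∀ k, min s (Sk k) ∈ Icc 0 (Sk k) := fun s hs k =>
    ⟨le_min hs.1 (hk k).nonneg, min_le_right _ _⟩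
  -- regularity of the limits
  have hlip : ∀ {E : Type} [NormedAddCommGroup E] [NormedSpace ℝ E] {fk : ℕ → ℝ → E} {f : ℝ → E}
      {K : ℝ≥0}, (∀ k, LipschitzOnWith K (fk k) (Icc 0 (Sk k))) →
      (∀ s ∈ Icc 0 S, Tendsto (fun k => fk k (min s (Sk k))) atTop (𝓝 (f s))) →
      LipschitzOnWith K f (Icc 0 S) := by
    intro E _ _ fk f K hK hlim
    refine LipschitzOnWith.of_dist_le_mul fun x hx y hy => ?_
    refine le_of_tendsto ((hlim x hx).dist (hlim y hy)) (Eventually.of_forall fun k => ?_)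
    refine ((hK k).dist_le_mul _ (hmin x hx k) _ (hmin y hy k)).trans ?_
    gcongr
    rw [Real.dist_eq, Real.dist_eq]
    exact (abs_min_sub_min_le_max x (Sk k) y (Sk k)).trans (by simp)
  have hφ₀L := hlip (fun k => (hk k).lipschitzOnWith_time) hφ₀lim
  have hφL := hlip (fun k => (hk k).lipschitzOnWith_control) hφlim
  have hξL := hlip (fun k => (hC (hk k) (hSR k)).2) hξlim
  have hξB : ∀ s ∈ Icc 0 S, ‖ξ s‖ ≤ C := fun s hs =>
    le_of_tendsto (hξlim s hs).norm
      (Eventually.of_forall fun k => (hC (hk k) (hSR k)).1 _ (hmin s hs k))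
  have hφ₀m : MonotoneOn φ₀ (Icc 0 S) := fun x hx y hy hxy =>
    le_of_tendsto_of_tendsto' (hφ₀lim x hx) (hφ₀lim y hy) fun k =>
      (hk k).monotoneOn_time (hmin x hx k) (hmin y hy k) (by gcongr)
  have hz : ∀ k, min 0 (Sk k) = 0 := fun k => min_eq_left (hk k).nonneg
  have hφ₀0 : φ₀ 0 = 0 := by
    refine tendsto_nhds_unique (hφ₀lim 0 h00) ?_
    simp_rw [hz, (hk _).time_zero]
    exact tendsto_const_nhds
  have hξ0 : ξ 0 = x₀ := by
    refine tendsto_nhds_unique (hξlim 0 h00) ?_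
    simp_rw [hz, (hk _).initial]
    exact tendsto_const_nhds
  have hφU : MapsTo φ (Icc 0 S) U := fun s hs =>
    hyp.compact_U.isClosed.mem_of_tendsto (hφlim s hs)
      (Eventually.of_forall fun k => (hk k).mapsTo (hmin s hs k))
  have hφ₀d : HasDensityOn φ₀ (deriv φ₀) S :=
    (LipschitzOnWith.absolutelyContinuousOnInterval
      (by rwa [uIcc_of_le hS])).hasDensityOn_real hS
  have hφd : HasDensityOn φ (deriv φ) S :=
    (LipschitzOnWith.absolutelyContinuousOnInterval (by rwa [uIcc_of_le hS])).hasDensityOn hS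
  have hq0 := hφ₀m.ae_deriv_nonneg
  have hq1 : ∀ᵐ s ∂(volume.restrict (Icc 0 S)), |deriv φ₀ s| ≤ 1 := by
    simpa using hφ₀L.ae_norm_deriv_le
  have hw1 : ∀ᵐ s ∂(volume.restrict (Icc 0 S)), ‖deriv φ s‖ ≤ 1 := by
    simpa using hφL.ae_norm_deriv_le
  have hφ₀S : φ₀ S = T := by
    refine le_antisymm ?_ ?_
    · refine le_of_tendsto (hφ₀lim S hSS) (Eventually.of_forall fun k => ?_)
      rw [← hend k]
      exact (hk k).monotoneOn_time (hmin S hSS k) ⟨(hk k).nonneg, le_rfl⟩ (min_le_right _ _)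
    -- The value `T` is already attained at `σ T ≤ S`, and `φ₀` is monotone.
    · have h1 := hσ T ⟨hT, le_rfl⟩
      rw [← h1.2]
      exact hφ₀m h1.1 hSS h1.1.2
  have hψ₁ : MemL1Into (fun s => v₁ (φ₀ s)) (Icc 0 S) V := by
    obtain ⟨B, hB⟩ := hyp.compact_V.isBounded.exists_norm_le
    refine ⟨Integrable.of_bound (C := B) ?_ (by simp [hB _ (hv₁V _)]), by simp [hv₁V]⟩
    exact (hv₁.comp_aemeasurable
      (hφ₀L.continuousOn.aemeasurable measurableSet_Icc)).aestronglyMeasurable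
  obtain ⟨hI₁, hI₂⟩ := hyp.integrableOn_spaceTimeField hφ₀d.1 hφd.1 hq1 hw1 hφL.continuousOn hφU
    hξL.continuousOn hξB hψ₁ hψ₂
  have hσ' : ∀ t ∈ Icc 0 (φ₀ S), σ t ∈ Icc 0 S ∧ φ₀ (σ t) = t := by rwa [hφ₀S]
  refine ⟨hS, hφ₀d, hφ₀0, hφd, hφU, hq0, hq1.mono fun s hs => (le_abs_self _).trans hs, hw1,
    hψ₁, hψ₂, HasDensityOn.of_forall_lt (hI₁.add hI₂) hξL.continuousOn fun r hr => ?_, hξ0⟩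
  have hr' : r ∈ Icc 0 S := ⟨hr.1, hr.2.le⟩
  have hsub : Icc 0 r ⊆ Icc 0 S := Icc_subset_Icc le_rfl hr.2.le
  -- After a shift by `N` all intervals contain `[0, r]`, and the truncations `min s (Sk k)` drop
  -- out.
  obtain ⟨N, hN⟩ := eventually_atTop.1 (hSk.eventually (lt_mem_nhds hr.2))
  have hNk : ∀ k, r ≤ Sk (k + N) := fun k => (hN _ (Nat.le_add_left N k)).le
  have hsubk : ∀ k, Icc 0 r ⊆ Icc 0 (Sk (k + N)) := fun k => Icc_subset_Icc le_rfl (hNk k)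
  have hshift : ∀ {E : Type} [TopologicalSpace E] {fk : ℕ → ℝ → E} {f : ℝ → E},
      (∀ s ∈ Icc 0 S, Tendsto (fun k => fk k (min s (Sk k))) atTop (𝓝 (f s))) →
      ∀ s ∈ Icc 0 r, Tendsto (fun k => fk (k + N) s) atTop (𝓝 (f s)) := by
    intro E _ fk f hlim s hs
    refine ((tendsto_add_atTop_iff_nat N).2 (hlim s (hsub hs))).congr fun k => ?_
    rw [min_eq_left (hs.2.trans (hNk k))]
  -- the control part
  have hcontrol := hyp.tendsto_integral_control (B := C) (ξ := ξ) (ψ₂ := ψ₂)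
    (φk := fun k => φk (k + N)) (wk := fun k => wk (k + N))
    (ψk := fun k => ψ₂k (k + N)) (ξk := fun k => ξk (k + N)) hr.1
    (fun k => (hk _).control.mono (hNk k)) (hφd.mono hr.2.le)
    (fun k => ae_restrict_of_ae_restrict_of_subset (hsubk k) (hk _).w_le)
    (ae_restrict_of_ae_restrict_of_subset hsub hw1) (fun k => (hk _).mapsTo.mono_left (hsubk k))
    (hφU.mono_left hsub) (fun k => (hk _).memL1_snd.mono (hsubk k)) (hψ₂.mono hsub)
    (fun k => (hk _).state.continuousOn.mono (hsubk k)) (hξL.continuousOn.mono hsub)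
    (fun k s hs => (hC (hk _) (hSR _)).1 s (hsubk k hs)) (hshift hφlim) (hshift hξlim)
    (by
      filter_upwards [ae_restrict_of_ae_restrict_of_subset hsub hψ₂lim] with s hs
      exact (tendsto_add_atTop_iff_nat N).2 hs)
  -- the drift, in the original time
  obtain ⟨M, hM, hg⟩ := hyp.exists_linear_growth
  have hmono : ∀ k, MonotoneOn (σk k) (Icc 0 T) := fun k =>
    (strictMonoOn_of_rightInverse (hk k).monotoneOn_time (hσk k)).monotoneOn
  -- No convergence of `v₁k ∘ φ₀k` in the parameter is available. In the time variable the integrand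
  -- converges boundedly almost everywhere, and only the endpoint `φ₀k r` moves.
  have hdrift := tendsto_intervalIntegral_of_tendsto (T := T) (D := M * (1 + C))
    (hk := fun k t => g 0 (ξk k (σk k t)) (φk k (σk k t)) (v₁k k t))
    (h := fun t => g 0 (ξ (σ t)) (φ (σ t)) (v₁ t))
    (fun k => hyp.aestronglyMeasurable_drift (hk k).control.continuousOn (hk k).mapsTo
      (hk k).state.continuousOn (hv₁k k) (hv₁kV k) (hmono k) fun t ht => (hσk k t ht).1)
    (fun k => by
      filter_upwards [ae_restrict_mem measurableSet_Icc] with t ht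
      refine (hg 0 _ _ ((hk k).mapsTo (hσk k t ht).1) _ (hv₁kV k t)).trans ?_
      gcongr
      exact (hC (hk k) (hSR k)).1 _ (hσk k t ht).1)
    (by
      filter_upwards [ae_restrict_mem measurableSet_Icc, hσlim, hv₁lim] with t ht h1 h2
      have hd : Tendsto (fun k => σk k t - min (σ t) (Sk k)) atTop (𝓝 0) := by
        have := h1.sub ((tendsto_const_nhds (x := σ t)).min hSk)
        rwa [min_eq_left (hσ t ht).1.2, sub_self] at this
      refine hyp.tendsto 0 ?_ ?_ h2 (Eventually.of_forall fun k => (hk k).mapsTo (hσk k t ht).1)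
        (Eventually.of_forall fun k => hv₁kV k t) (hφU (hσ t ht).1) (hv₁V t)
      · exact tendsto_apply_of_lipschitzOnWith (fun k => (hC (hk k) (hSR k)).2)
          (hmin _ (hσ t ht).1) (fun k => (hσk k t ht).1) (hξlim _ (hσ t ht).1) hd
      · exact tendsto_apply_of_lipschitzOnWith (fun k => (hk k).lipschitzOnWith_control)
          (hmin _ (hσ t ht).1) (fun k => (hσk k t ht).1) (hφlim _ (hσ t ht).1) hd)
    (tk := fun k => φ₀k k (min r (Sk k))) (t := φ₀ r)
    (fun k => by
      have hm := (hk k).monotoneOn_time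
      refine ⟨?_, ?_⟩
      · rw [← (hk k).time_zero]
        exact hm ⟨le_rfl, (hk k).nonneg⟩ (hmin r hr' k) (hmin r hr' k).1
      · rw [← hend k]
        exact hm (hmin r hr' k) ⟨(hk k).nonneg, le_rfl⟩ (hmin r hr' k).2)
    (hφ₀lim r hr')
  have hdrift' := (tendsto_add_atTop_iff_nat N).2 hdrift
  have hsum := (hdrift'.add hcontrol).const_add x₀
  have hlhs := hshift hξlim r ⟨hr.1, le_rfl⟩
  have heq := tendsto_nhds_unique hlhs (hsum.congr fun k => ?_)
  · rw [heq, hξ0, hyp.integral_drift hS hφ₀d hφ₀0 hq0 hφL.continuousOn hφU hξL.continuousOn hv₁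
      hv₁V hσ' hr']
    congr 1
    rw [← intervalIntegral.integral_add]
    · rfl
    · rw [intervalIntegrable_iff_integrableOn_Icc_of_le hr.1]; exact hI₁.mono_set hsub
    · rw [intervalIntegrable_iff_integrableOn_Icc_of_le hr.1]; exact hI₂.mono_set hsub
  · have hkk := hk (k + N)
    have hrk : r ∈ Icc 0 (Sk (k + N)) := ⟨hr.1, hNk k⟩
    have hqk : ∀ᵐ s ∂(volume.restrict (Icc 0 (Sk (k + N)))), |qk (k + N) s| ≤ 1 := by
      filter_upwards [hkk.q_nonneg, hkk.q_le] with s h1 h2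
      rwa [abs_of_nonneg h1]
    obtain ⟨hJ₁, hJ₂⟩ := hyp.integrableOn_spaceTimeField hkk.time.1 hkk.control.1 hqk hkk.w_le
      hkk.control.continuousOn hkk.mapsTo hkk.state.continuousOn (hC hkk (hSR _)).1
      hkk.memL1_fst hkk.memL1_snd
    rw [min_eq_left (hNk k), hyp.integral_drift hkk.nonneg hkk.time hkk.time_zero hkk.q_nonneg
      hkk.control.continuousOn hkk.mapsTo hkk.state.continuousOn (hv₁k _) (hv₁kV _)
      (by rw [hend]; exact hσk _) hrk, hkk.state.2 r hrk, hkk.initial,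
      ← intervalIntegral.integral_add]
    · rfl
    · rw [intervalIntegrable_iff_integrableOn_Icc_of_le hr.1]; exact hJ₁.mono_set (hsubk k)
    · rw [intervalIntegrable_iff_integrableOn_Icc_of_le hr.1]; exact hJ₂.mono_set (hsubk k)

end

/-! ### Reparametrization by arc length -/

theorem HasDensityOn.id (S : ℝ) : HasDensityOn (fun s : ℝ => s) (fun _ => (1 : ℝ)) S :=
  ⟨integrable_const _, fun s _ => by simp⟩

theorem HasDensityOn.norm_sub_le_mul {E : Type*} [NormedAddCommGroup E] [NormedSpace ℝ E]
    {f p : ℝ → E} {a α : ℝ → ℝ} {S C : ℝ} (hf : HasDensityOn f p S) (ha : HasDensityOn a α S)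
    (h : ∀ᵐ s ∂(volume.restrict (Icc 0 S)), ‖p s‖ ≤ C * α s) {s t : ℝ} (hs : s ∈ Icc 0 S)
    (ht : t ∈ Icc 0 S) (hst : s ≤ t) : ‖f t - f s‖ ≤ C * (a t - a s) := by
  refine (hf.norm_sub_le hs ht hst).trans ?_
  rw [ha.sub_eq hs ht, ← intervalIntegral.integral_const_mul]
  exact intervalIntegral.integral_mono_ae_restrict hst (hf.norm.intervalIntegrable hs ht)
    ((ha.intervalIntegrable hs ht).const_mul C)
    (ae_restrict_of_ae_restrict_of_subset (Icc_subset_Icc hs.1 ht.2) h)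

/-- A curve whose speed is dominated by `α` is constant wherever `a` is, so it factors through `a`;
this makes the choice of a right inverse of `a` immaterial. -/
theorem HasDensityOn.eq_of_eq {E : Type*} [NormedAddCommGroup E] [NormedSpace ℝ E]
    {f p : ℝ → E} {a α : ℝ → ℝ} {S C : ℝ} (hf : HasDensityOn f p S) (ha : HasDensityOn a α S)
    (h : ∀ᵐ s ∂(volume.restrict (Icc 0 S)), ‖p s‖ ≤ C * α s) {s t : ℝ} (hs : s ∈ Icc 0 S)
    (ht : t ∈ Icc 0 S) (hst : a s = a t) : f s = f t := by
  rcases le_total s t with h1 | h1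
  · have := hf.norm_sub_le_mul ha h hs ht h1
    rw [hst, sub_self, mul_zero] at this
    exact (sub_eq_zero.1 (norm_le_zero_iff.1 this)).symm
  · have := hf.norm_sub_le_mul ha h ht hs h1
    rw [hst, sub_self, mul_zero] at this
    exact sub_eq_zero.1 (norm_le_zero_iff.1 this)

/-- Almost everywhere statements pull back along a right inverse of a primitive. -/
theorem HasDensityOn.ae_comp_rightInverse {a α σ : ℝ → ℝ} {S : ℝ} (hS : 0 ≤ S)
    (h : HasDensityOn a α S) (h0 : ∀ᵐ s ∂(volume.restrict (Icc 0 S)), 0 ≤ α s) (ha0 : a 0 = 0)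
    (hσ : ∀ t ∈ Icc 0 (a S), σ t ∈ Icc 0 S ∧ a (σ t) = t) {P : ℝ → Prop}
    (hP : ∀ᵐ s ∂(volume.restrict (Icc 0 S)), α s ≠ 0 → P s) :
    ∀ᵐ t ∂(volume.restrict (Icc 0 (a S))), P (σ t) := by
  have hm := h.monotoneOn h0
  have haS : 0 ≤ a S := ha0 ▸ hm ⟨le_rfl, hS⟩ ⟨hS, le_rfl⟩ hS
  have hσm := (strictMonoOn_of_rightInverse hm hσ).monotoneOn
  have hproj : ∀ τ, max 0 (min τ (a S)) ∈ Icc 0 (a S) := fun τ =>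
    ⟨le_max_left _ _, max_le haS (min_le_right _ _)⟩
  set σ' : ℝ → ℝ := fun t => σ (max 0 (min t (a S))) with hσ'
  have hσσ' : ∀ t ∈ Icc 0 (a S), σ' t = σ t := fun t ht => by
    simp [hσ', min_eq_left ht.2, max_eq_right ht.1]
  have hmono : Monotone σ' := fun x y hxy => hσm (hproj x) (hproj y) (by gcongr)
  have hmap := h.map_rightInverse hS h0 ha0 hmono fun t ht => by rw [hσσ' t ht]; exact hσ t ht
  have h1 : ∀ᵐ s ∂(Measure.map σ' (volume.restrict (Icc 0 (a S)))), P s := by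
    rw [hmap, ae_withDensity_iff' h.1.aemeasurable.ennreal_ofReal]
    filter_upwards [hP] with s hs h2
    exact hs fun h3 => h2 (by simp [h3])
  filter_upwards [ae_of_ae_map hmono.measurable.aemeasurable h1,
    ae_restrict_mem measurableSet_Icc] with t ht htm
  rwa [hσσ' t htm] at ht

theorem arcLength_zero {m : ℕ} (u : ℝ → EuclideanSpace ℝ (Fin m)) : arcLength u 0 = 0 := by
  simp [arcLength, eVariationOn.subsingleton]

theorem HasDensityOn.sub_le_arcLength_sub {m : ℕ} {u p : ℝ → EuclideanSpace ℝ (Fin m)} {S : ℝ}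
    (h : HasDensityOn u p S) {s t : ℝ} (hs : s ∈ Icc 0 S) (ht : t ∈ Icc 0 S) (hst : s ≤ t) :
    t - s ≤ _root_.arcLength u t - _root_.arcLength u s := by
  have := (HasDensityOn.id S).norm_sub_le_mul h.arcLength (C := 1)
    (by simp) hs ht hst
  rw [one_mul, Real.norm_of_nonneg (sub_nonneg.2 hst)] at this
  exact this

theorem eqOn_arcLengthInv {m : ℕ} {u p : ℝ → EuclideanSpace ℝ (Fin m)} {T : ℝ}
    (h : HasDensityOn u p T) {t : ℝ} (ht : t ∈ Icc 0 T) :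
    arcLengthInv u T (arcLength u t) = t := by
  have hinj : InjOn (arcLength u) (Icc 0 T) := by
    intro x hx y hy hxy
    rcases le_total x y with h1 | h1
    · have := h.sub_le_arcLength_sub hx hy h1; linarith
    · have := h.sub_le_arcLength_sub hy hx h1; linarith
  exact hinj.leftInvOn_invFunOn ht

section

variable {n m l : ℕ} {U : Set (EuclideanSpace ℝ (Fin m))} {V : Set (EuclideanSpace ℝ (Fin l))}
  {g : Fin (m + 1) → EuclideanSpace ℝ (Fin n) → EuclideanSpace ℝ (Fin m) →
    EuclideanSpace ℝ (Fin l) → EuclideanSpace ℝ (Fin n)}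
  {x₀ : EuclideanSpace ℝ (Fin n)}

theorem IsCaratheodorySolution.congr_ae {T : ℝ} {u : ℝ → EuclideanSpace ℝ (Fin m)}
    {v₁ v₂ v₁' v₂' : ℝ → EuclideanSpace ℝ (Fin l)} {x : ℝ → EuclideanSpace ℝ (Fin n)}
    (h : IsCaratheodorySolution g T x₀ u v₁ v₂ x)
    (h₁ : v₁ =ᵐ[volume.restrict (Icc 0 T)] v₁') (h₂ : v₂ =ᵐ[volume.restrict (Icc 0 T)] v₂') :
    IsCaratheodorySolution g T x₀ u v₁' v₂' x := by
  refine ⟨h.absolutelyContinuous, h.initial, ?_⟩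
  filter_upwards [h.ode, h₁, h₂] with t ht ht₁ ht₂
  rwa [ht₁, ht₂] at ht

/-- Arc-length reparametrization of the graph of a solution for an absolutely continuous control. -/
theorem IsCaratheodorySolution.exists_isSpaceTimeTrajectory (hyp : StandingAssumptions U V g)
    {T : ℝ} (hT : 0 ≤ T) {u : ℝ → EuclideanSpace ℝ (Fin m)}
    {v₁ v₂ : ℝ → EuclideanSpace ℝ (Fin l)} {x : ℝ → EuclideanSpace ℝ (Fin n)}
    (hu : AbsolutelyContinuousOnInterval u 0 T) (huU : MapsTo u (Icc 0 T) U)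
    (hv₁ : Measurable v₁) (hv₁V : ∀ t, v₁ t ∈ V) (hv₂ : Measurable v₂) (hv₂V : ∀ t, v₂ t ∈ V)
    (hx : IsCaratheodorySolution g T x₀ u v₁ v₂ x) :
    ∃ (b q : ℝ → ℝ) (w : ℝ → EuclideanSpace ℝ (Fin m)), Monotone b ∧ (∀ y, b y ∈ Icc 0 T) ∧
      (∀ s ∈ Icc 0 (arcLength u T), arcLength u (b s) = s) ∧
      (∀ t ∈ Icc 0 T, arcLength u t ∈ Icc 0 (arcLength u T) ∧ b (arcLength u t) = t) ∧
      Measure.QuasiMeasurePreserving b (volume.restrict (Icc 0 (arcLength u T)))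
        (volume.restrict (Icc 0 T)) ∧
      IsSpaceTimeTrajectory U V g x₀ (arcLength u T) b q (fun s => u (b s)) w
        (fun s => v₁ (b s)) (fun s => v₂ (b s)) (fun s => x (b s)) := by
  have hud := hu.hasDensityOn hT
  have ha := hud.arcLength
  have ha0 := arcLength_zero u
  have hα : ∀ᵐ t ∂(volume.restrict (Icc 0 T)), 0 ≤ 1 + ‖deriv u t‖ :=
    Eventually.of_forall fun t => by positivity
  have hm := ha.monotoneOn hα
  obtain ⟨b, hb, hbT, hab⟩ := exists_monotone_rightInverse hT ha.continuousOn hm ha0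
  have hmem : ∀ t ∈ Icc 0 T, arcLength u t ∈ Icc 0 (arcLength u T) := fun t ht =>
    ⟨ha0 ▸ hm ⟨le_rfl, hT⟩ ht ht.1, hm ht ⟨hT, le_rfl⟩ ht.2⟩
  have hba : ∀ t ∈ Icc 0 T, b (arcLength u t) = t := fun t ht =>
    (HasDensityOn.id T).eq_of_eq ha (C := 1) (by simp) (hbT _) ht (hab _ (hmem t ht))
  have hbm : ∀ y ∈ Icc 0 (arcLength u T), b y ∈ Icc 0 T ∧ arcLength u (b y) = y :=
    fun y hy => ⟨hbT y, hab y hy⟩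
  -- The density of arc length is at least one, so the condition of `HasDensityOn.comp_rightInverse`
  -- on its zero set is void.
  have hαz : ∀ t, 1 + ‖deriv u t‖ ≠ 0 := fun t => by positivity
  have hb0 : b 0 = 0 := by
    have := hba 0 ⟨le_rfl, hT⟩
    rwa [ha0] at this
  have hlen : 0 ≤ arcLength u T := (hmem T ⟨hT, le_rfl⟩).1
  have hxd := hx.absolutelyContinuous.hasDensityOn hT
  have hxd' : HasDensityOn x (fun t => g 0 (x t) (u t) (v₁ t) +
      ∑ i : Fin m, (deriv u t) i • g i.succ (x t) (u t) (v₂ t)) T :=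
    hxd.congr (fun _ _ => rfl) (hx.ode.mono fun t ht => ht.deriv)
  refine ⟨b, fun y => (1 + ‖deriv u (b y)‖)⁻¹ • (1 : ℝ),
    fun y => (1 + ‖deriv u (b y)‖)⁻¹ • deriv u (b y), hb, hbT, hab,
    fun t ht => ⟨hmem t ht, hba t ht⟩,
    ha.quasiMeasurePreserving_rightInverse hT hα ha0 hb hbm, hlen, ?_, hb0, ?_,
    fun s _ => huU (hbT s), ?_, ?_, ?_, ?_, ?_, ?_, ?_⟩
  · exact (HasDensityOn.id T).comp_rightInverse hT ha hα ha0 hb hbm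
      (Eventually.of_forall fun t h => absurd h (hαz t))
  · exact hud.comp_rightInverse hT ha hα ha0 hb hbm
      (Eventually.of_forall fun t h => absurd h (hαz t))
  · exact Eventually.of_forall fun s => by positivity
  · refine Eventually.of_forall fun s => ?_
    rw [smul_eq_mul, mul_one]
    exact inv_le_one_of_one_le₀ (by linarith [norm_nonneg (deriv u (b s))])
  · refine Eventually.of_forall fun s => ?_
    rw [norm_smul, norm_inv, Real.norm_of_nonneg (by positivity), inv_mul_le_iff₀ (by positivity)]
    linarith
  · exact MemL1Into.of_measurable hyp.compact_V (hv₁.comp hb.measurable) (fun t => hv₁V _) _ _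
  · exact MemL1Into.of_measurable hyp.compact_V (hv₂.comp hb.measurable) (fun t => hv₂V _) _ _
  · refine (hxd'.comp_rightInverse hT ha hα ha0 hb hbm
      (Eventually.of_forall fun t h => absurd h (hαz t))).congr (fun _ _ => rfl)
      (Eventually.of_forall fun s => ?_)
    simp only [spaceTimeField, smul_add, Finset.smul_sum, smul_smul, smul_eq_mul, mul_one,
      PiLp.smul_apply]
  · rw [hb0, hx.initial]

variable {S : ℝ} {φ₀ q : ℝ → ℝ} {φ w : ℝ → EuclideanSpace ℝ (Fin m)}
  {ψ₁ ψ₂ : ℝ → EuclideanSpace ℝ (Fin l)} {ξ : ℝ → EuclideanSpace ℝ (Fin n)}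

/-- Arc-length reparametrization of a trajectory of the space-time system yields a graph
completion solution. -/
theorem IsSpaceTimeTrajectory.isGraphCompletionSolution (hyp : StandingAssumptions U V g)
    {T : ℝ} (hT : 0 < T) {u₀ : EuclideanSpace ℝ (Fin m)} {u : ℝ → EuclideanSpace ℝ (Fin m)}
    {v₁ v₂ v₁' : ℝ → EuclideanSpace ℝ (Fin l)} {x : ℝ → EuclideanSpace ℝ (Fin n)} {σ : ℝ → ℝ}
    (h : IsSpaceTimeTrajectory U V g x₀ S φ₀ q φ w (fun s => v₁' (φ₀ s)) ψ₂ ξ)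
    (hv₁' : Measurable v₁') (hv₁'V : ∀ t, v₁' t ∈ V)
    (hv₁ : v₁ =ᵐ[volume.restrict (Icc 0 T)] v₁')
    (hψ₂ : Measurable ψ₂) (hψ₂V : ∀ t, ψ₂ t ∈ V)
    (hend : φ₀ S = T) (hφ0 : φ 0 = u₀)
    (hσ : ∀ t ∈ Icc 0 T, σ t ∈ Icc 0 S ∧ φ₀ (σ t) = t) (hσ0 : σ 0 = 0) (hσT : σ T = S)
    (hσu : ∀ t ∈ Icc 0 T, φ (σ t) = u t) (hσx : ∀ t ∈ Icc 0 T, ξ (σ t) = x t)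
    (hσv₂ : ∀ᵐ t ∂(volume.restrict (Icc 0 T)), ψ₂ (σ t) = v₂ t) :
    IsGraphCompletionSolution U V g T x₀ u₀ u v₁ v₂ x := by
  have hS := h.nonneg
  have h00 : (0 : ℝ) ∈ Icc 0 S := ⟨le_rfl, hS⟩
  have hSS : S ∈ Icc 0 S := ⟨hS, le_rfl⟩
  -- `α` is the speed of the space-time curve. The densities of time, control and state are bounded
  -- by multiples of `α`, so all three curves factor through `a` and have speed normalized after
  -- composition with `b`.
  set α : ℝ → ℝ := fun s => q s + ‖w s‖ with hαdef
  set a : ℝ → ℝ := fun s => ∫ τ in (0 : ℝ)..s, α τ with hadef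
  have ha : HasDensityOn a α S := ⟨h.time.1.add h.control.1.norm, fun s _ => by simp [hadef]⟩
  have ha0 : a 0 = 0 := by simp [hadef]
  have hα : ∀ᵐ s ∂(volume.restrict (Icc 0 S)), 0 ≤ α s :=
    h.q_nonneg.mono fun s hs => add_nonneg hs (norm_nonneg _)
  have hm := ha.monotoneOn hα
  obtain ⟨b, hb, hbS, hab⟩ := exists_monotone_rightInverse hS ha.continuousOn hm ha0
  have hbm : ∀ y ∈ Icc 0 (a S), b y ∈ Icc 0 S ∧ a (b y) = y := fun y hy => ⟨hbS y, hab y hy⟩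
  have hmem : ∀ s ∈ Icc 0 S, a s ∈ Icc 0 (a S) := fun s hs =>
    ⟨ha0 ▸ hm h00 hs hs.1, hm hs hSS hs.2⟩
  -- the three densities are dominated by `α`
  obtain ⟨C, hC⟩ := hyp.exists_trajectory_bound x₀ S
  obtain ⟨M, hM, hg⟩ := hyp.exists_linear_growth
  have hdq : ∀ᵐ s ∂(volume.restrict (Icc 0 S)), ‖q s‖ ≤ 1 * α s := h.q_nonneg.mono fun s hs => by
    rw [Real.norm_of_nonneg hs, one_mul]; simp [hαdef]
  have hdw : ∀ᵐ s ∂(volume.restrict (Icc 0 S)), ‖w s‖ ≤ 1 * α s := h.q_nonneg.mono fun s hs => by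
    rw [one_mul]; simp [hαdef, hs]
  have hdξ : ∀ᵐ s ∂(volume.restrict (Icc 0 S)),
      ‖spaceTimeField g (q s) (w s) (ξ s) (φ s) (v₁' (φ₀ s)) (ψ₂ s)‖ ≤
        ((m + 1) * (M * (1 + C))) * α s := by
    filter_upwards [hdq, hdw, ae_restrict_mem measurableSet_Icc] with s h1 h2 h3
    rw [one_mul] at h1 h2
    have hb : ∀ i, ∀ v ∈ V, ‖g i (ξ s) (φ s) v‖ ≤ M * (1 + C) := fun i v hv =>
      (hg i (ξ s) (φ s) (h.mapsTo h3) v hv).trans (by gcongr; exact (hC h le_rfl).1 s h3)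
    have := norm_smul_add_sum_smul_le (D := M * (1 + C)) (Q := α s) h1 h2
      (hb 0 _ (hv₁'V (φ₀ s))) (fun i => hb i.succ _ (hψ₂V s))
    refine this.trans_eq (by ring)
  have hzero : ∀ {E : Type} [NormedAddCommGroup E] {p : ℝ → E} {K : ℝ},
      (∀ᵐ s ∂(volume.restrict (Icc 0 S)), ‖p s‖ ≤ K * α s) →
      ∀ᵐ s ∂(volume.restrict (Icc 0 S)), α s = 0 → p s = 0 := fun hp => hp.mono fun s hs h0 => by
    rw [h0, mul_zero] at hs; exact norm_le_zero_iff.1 hs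
  have htime := h.time.comp_rightInverse hS ha hα ha0 hb hbm (hzero hdq)
  have hcontrol := h.control.comp_rightInverse hS ha hα ha0 hb hbm (hzero hdw)
  have hstate := h.state.comp_rightInverse hS ha hα ha0 hb hbm (hzero hdξ)
  have hbt : ∀ s ∈ Icc 0 S, φ₀ (b (a s)) = φ₀ s := fun s hs =>
    h.time.eq_of_eq ha hdq (hbS _) hs (hab _ (hmem s hs))
  have hbc : ∀ s ∈ Icc 0 S, φ (b (a s)) = φ s := fun s hs =>
    h.control.eq_of_eq ha hdw (hbS _) hs (hab _ (hmem s hs))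
  have hbx : ∀ s ∈ Icc 0 S, ξ (b (a s)) = ξ s := fun s hs =>
    h.state.eq_of_eq ha hdξ (hbS _) hs (hab _ (hmem s hs))
  have hquasi := ha.quasiMeasurePreserving_rightInverse hS hα ha0 hb hbm
  have hne := ha.ae_density_ne_zero hS hα ha0 hb hbm
  have hqn := hquasi.ae h.q_nonneg
  -- the densities of the normalized parametrization
  have hderiv : ∀ᵐ y ∂(volume.restrict (Icc 0 (a S))),
      deriv (fun y => φ₀ (b y)) y = (α (b y))⁻¹ • q (b y) ∧
      deriv (fun y => φ (b y)) y = (α (b y))⁻¹ • w (b y) := by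
    filter_upwards [htime.ae_hasDerivAt, hcontrol.ae_hasDerivAt] with y h1 h2
    exact ⟨h1.deriv, h2.deriv⟩
  have hαpos : ∀ᵐ y ∂(volume.restrict (Icc 0 (a S))), 0 < α (b y) := by
    filter_upwards [hne, hquasi.ae hα] with y h1 h2
    exact lt_of_le_of_ne h2 (Ne.symm h1)
  have hTS : T ≤ a S := by
    have := h.time.norm_sub_le_mul ha hdq h00 hSS hS
    rw [h.time_zero, ha0, hend, sub_zero, sub_zero, one_mul] at this
    exact (le_abs_self T).trans this
  have hφ₀nn : ∀ s ∈ Icc 0 S, 0 ≤ φ₀ s := fun s hs =>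
    h.time_zero ▸ h.monotoneOn_time h00 hs hs.1
  have hfeas : IsFeasibleSpaceTimeControl U V T u₀ (fun y => φ₀ (b y)) (fun y => φ (b y))
      (fun y => v₁' (φ₀ (b y))) (fun y => ψ₂ (b y)) (a S) := by
    refine ⟨hT.trans_le hTS, ⟨max 1 1, ?_⟩, fun s _ => hφ₀nn _ (hbS s), fun s _ => h.mapsTo (hbS s),
      ?_, ?_, ?_, ?_, ?_, ?_, ?_⟩
    · refine LipschitzOnWith.prodMk (htime.lipschitzOnWith ?_) (hcontrol.lipschitzOnWith ?_)
      · filter_upwards [hαpos, hquasi.ae hdq] with y h1 h2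
        rw [norm_smul, norm_inv, Real.norm_of_nonneg h1.le, inv_mul_le_iff₀ h1]
        simpa using h2
      · filter_upwards [hαpos, hquasi.ae hdw] with y h1 h2
        rw [norm_smul, norm_inv, Real.norm_of_nonneg h1.le, inv_mul_le_iff₀ h1]
        simpa using h2
    · have := hbt 0 h00
      rw [ha0, h.time_zero] at this
      exact this
    · have := hbc 0 h00
      rw [ha0, hφ0] at this
      exact this
    · have := hbt S hSS
      rw [hend] at this
      exact this
    · filter_upwards [hderiv, hαpos, hqn] with y h1 h2 h3
      rw [h1.1]
      exact mul_nonneg (inv_nonneg.2 h2.le) h3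
    · filter_upwards [hderiv, hαpos] with y h1 h2
      rw [h1.1, h1.2, norm_smul, norm_inv, Real.norm_of_nonneg h2.le, smul_eq_mul, ← mul_add]
      exact inv_mul_cancel₀ h2.ne'
    · obtain ⟨B, hB⟩ := hyp.compact_V.isBounded.exists_norm_le
      refine ⟨Integrable.of_bound (C := B) ?_ (by simp [hB _ (hv₁'V _)]), by simp [hv₁'V]⟩
      exact (hv₁'.comp_aemeasurable
        (htime.continuousOn.aemeasurable measurableSet_Icc)).aestronglyMeasurable
    · exact MemL1Into.of_measurable hyp.compact_V (hψ₂.comp hb.measurable) (fun t => hψ₂V _) _ _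
  have hσ' : ∀ t ∈ Icc 0 (φ₀ S), σ t ∈ Icc 0 S ∧ φ₀ (σ t) = t := by rwa [hend]
  -- The new clock is `a ∘ σ`. For almost every `t` the parameter `σ t` lies where time flows, so
  -- `α` is positive there and `b` returns exactly `σ t`; hence `ψ₂` can be matched with `v₂ t`.
  have hbaσ : ∀ᵐ t ∂(volume.restrict (Icc 0 T)), b (a (σ t)) = σ t := by
    rw [← hend]
    refine h.time.ae_comp_rightInverse hS h.q_nonneg h.time_zero hσ' (P := fun s => b (a s) = s) ?_
    filter_upwards [ha.ae_rightInverse_comp hα fun s hs => hbm _ (hmem s hs), h.q_nonneg]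
      with s h1 h2 h3
    refine h1 (ne_of_gt ?_)
    exact add_pos_of_pos_of_nonneg (lt_of_le_of_ne h2 (Ne.symm h3)) (norm_nonneg _)
  refine ⟨a S, fun y => φ₀ (b y), fun y => φ (b y), fun y => v₁' (φ₀ (b y)), fun y => ψ₂ (b y),
    fun t => a (σ t), fun y => ξ (b y), ⟨hfeas, fun t ht => ?_, ?_⟩, ⟨?_, ?_, ?_, fun t ht => ?_⟩,
    ⟨hstate.absolutelyContinuousOnInterval (hT.le.trans hTS), ?_, ?_⟩, fun t ht => ?_⟩
  · refine ⟨a (σ t), hmem _ (hσ t ht).1, ?_, ?_⟩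
    · rw [hbt _ (hσ t ht).1, (hσ t ht).2]
    · rw [hbc _ (hσ t ht).1, hσu t ht]
  · filter_upwards [ae_restrict_mem measurableSet_Icc, hbaσ, hv₁, hσv₂] with t ht h1 h2 h3
    refine ⟨a (σ t), hmem _ (hσ t ht).1, ?_⟩
    rw [h1, (hσ t ht).2, hσu t ht, h2, h3]
    exact ⟨rfl, rfl, rfl, rfl⟩
  · refine strictMonoOn_of_rightInverse (S := a S) (a := fun y => φ₀ (b y)) ?_ fun t ht =>
      ⟨hmem _ (hσ t ht).1, by rw [hbt _ (hσ t ht).1, (hσ t ht).2]⟩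
    exact fun y _ z _ hyz => h.monotoneOn_time (hbS y) (hbS z) (hb hyz)
  · rw [hσ0, ha0]
  · rw [hσT]
  · rw [hbt _ (hσ t ht).1, (hσ t ht).2, hbc _ (hσ t ht).1, hσu t ht]
    exact ⟨rfl, rfl⟩
  · have := hbx 0 h00
    rw [ha0, h.initial] at this
    exact this
  · filter_upwards [hstate.ae_hasDerivAt, hderiv] with y h1 h2
    rw [h2.1, h2.2]
    simpa only [spaceTimeField, smul_add, Finset.smul_sum, smul_smul, smul_eq_mul,
      PiLp.smul_apply] using h1
  · beta_reduce
    rw [hbx _ (hσ t ht).1, hσx t ht]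

end

/-! ### From limit solutions to graph completion solutions -/

section

variable {n m l : ℕ} {U : Set (EuclideanSpace ℝ (Fin m))} {V : Set (EuclideanSpace ℝ (Fin l))}
  {g : Fin (m + 1) → EuclideanSpace ℝ (Fin n) → EuclideanSpace ℝ (Fin m) →
    EuclideanSpace ℝ (Fin l) → EuclideanSpace ℝ (Fin n)}
  {x₀ : EuclideanSpace ℝ (Fin n)}

theorem LipschitzOnWith.lipschitzWith_clamp {E : Type*} [PseudoMetricSpace E] {f : ℝ → E}
    {K : ℝ≥0} {S : ℝ} (hS : 0 ≤ S) (h : LipschitzOnWith K f (Icc 0 S)) :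
    LipschitzWith K fun s => f (max 0 (min s S)) := by
  have hproj : ∀ τ, max 0 (min τ S) ∈ Icc 0 S := fun τ =>
    ⟨le_max_left _ _, max_le hS (min_le_right _ _)⟩
  refine LipschitzWith.of_dist_le_mul fun x y => ?_
  refine (h.dist_le_mul _ (hproj x) _ (hproj y)).trans ?_
  gcongr
  rw [Real.dist_eq, Real.dist_eq]
  have h1 := abs_max_sub_max_le_max 0 (min x S) 0 (min y S)
  have h2 := abs_min_sub_min_le_max x S y S
  simp only [sub_self, abs_zero] at h1 h2
  rw [max_eq_right (abs_nonneg (min x S - min y S))] at h1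
  rw [max_eq_left (abs_nonneg (x - y))] at h2
  exact h1.trans h2

/-- Compactness of trajectories of bounded length. -/
theorem StandingAssumptions.exists_subseq_tendsto (hyp : StandingAssumptions U V g) {T R : ℝ}
    {Sk : ℕ → ℝ} {φ₀k qk : ℕ → ℝ → ℝ} {φk wk : ℕ → ℝ → EuclideanSpace ℝ (Fin m)}
    {ψ₁k ψ₂k : ℕ → ℝ → EuclideanSpace ℝ (Fin l)} {ξk : ℕ → ℝ → EuclideanSpace ℝ (Fin n)}
    (hk : ∀ k, IsSpaceTimeTrajectory U V g x₀ (Sk k) (φ₀k k) (qk k) (φk k) (wk k)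
      (ψ₁k k) (ψ₂k k) (ξk k)) (hR : ∀ k, Sk k ≤ R) (hend : ∀ k, φ₀k k (Sk k) = T) :
    ∃ θ : ℕ → ℕ, StrictMono θ ∧ ∃ (S : ℝ) (φ₀ : ℝ → ℝ) (φ : ℝ → EuclideanSpace ℝ (Fin m))
      (ξ : ℝ → EuclideanSpace ℝ (Fin n)), Tendsto (fun k => Sk (θ k)) atTop (𝓝 S) ∧
      (∀ s ∈ Icc 0 S, Tendsto (fun k => φ₀k (θ k) (min s (Sk (θ k)))) atTop (𝓝 (φ₀ s))) ∧
      (∀ s ∈ Icc 0 S, Tendsto (fun k => φk (θ k) (min s (Sk (θ k)))) atTop (𝓝 (φ s))) ∧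
      (∀ s ∈ Icc 0 S, Tendsto (fun k => ξk (θ k) (min s (Sk (θ k)))) atTop (𝓝 (ξ s))) := by
  obtain ⟨S, -, θ₁, hθ₁, hS⟩ := isCompact_Icc.tendsto_subseq
    (fun k => (⟨(hk k).nonneg, hR k⟩ : Sk k ∈ Icc 0 R))
  obtain ⟨C, hC⟩ := hyp.exists_trajectory_bound x₀ R
  obtain ⟨B, hB⟩ := hyp.compact_U.isBounded.exists_norm_le
  have hproj : ∀ k τ, max 0 (min τ (Sk k)) ∈ Icc 0 (Sk k) := fun k τ =>
    ⟨le_max_left _ _, max_le (hk k).nonneg (min_le_right _ _)⟩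
  -- Clamping puts all curves on the whole line, and treating time, control and state as one
  -- product-valued map requires a single extraction.
  obtain ⟨θ₂, hθ₂, F, -, hF⟩ := exists_subseq_tendsto_of_lipschitzWith
    (f := fun k s => (φ₀k (θ₁ k) (max 0 (min s (Sk (θ₁ k)))),
      φk (θ₁ k) (max 0 (min s (Sk (θ₁ k)))), ξk (θ₁ k) (max 0 (min s (Sk (θ₁ k))))))
    (K := max 1 (max 1 C)) (C := max T (max B C))
    (fun k => ((hk _).lipschitzOnWith_time.lipschitzWith_clamp (hk _).nonneg).prodMk
      (((hk _).lipschitzOnWith_control.lipschitzWith_clamp (hk _).nonneg).prodMk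
        ((hC (hk _) (hR _)).2.lipschitzWith_clamp (hk _).nonneg)))
    (fun k s => by
      have hp := hproj (θ₁ k) s
      rw [Prod.norm_def, Prod.norm_def]
      refine max_le_max ?_ (max_le_max (hB _ ((hk _).mapsTo hp)) ((hC (hk _) (hR _)).1 _ hp))
      have h0 : 0 ≤ φ₀k (θ₁ k) (max 0 (min s (Sk (θ₁ k)))) := by
        have := (hk (θ₁ k)).monotoneOn_time ⟨le_rfl, (hk _).nonneg⟩ hp hp.1
        rwa [(hk (θ₁ k)).time_zero] at this
      rw [Real.norm_of_nonneg h0, ← hend (θ₁ k)]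
      exact (hk _).monotoneOn_time hp ⟨(hk _).nonneg, le_rfl⟩ hp.2)
  have hmin : ∀ s ∈ Icc 0 S, ∀ k, max 0 (min s (Sk k)) = min s (Sk k) := fun s hs k =>
    max_eq_right (le_min hs.1 (hk k).nonneg)
  refine ⟨θ₁ ∘ θ₂, hθ₁.comp hθ₂, S, fun s => (F s).1, fun s => (F s).2.1, fun s => (F s).2.2,
    hS.comp hθ₂.tendsto_atTop, fun s hs => ?_, fun s hs => ?_, fun s hs => ?_⟩
  · have := (continuous_fst.tendsto _).comp (hF s)
    simpa only [Function.comp_def, hmin s hs] using this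
  · have := ((continuous_fst.comp continuous_snd).tendsto _).comp (hF s)
    simpa only [Function.comp_def, hmin s hs] using this
  · have := ((continuous_snd.comp continuous_snd).tendsto _).comp (hF s)
    simpa only [Function.comp_def, hmin s hs] using this

theorem exists_subseq_ae_tendsto {E : Type*} [NormedAddCommGroup E] {μ : Measure ℝ}
    {fk : ℕ → ℝ → E} {f : ℝ → E} (hfk : ∀ k, AEStronglyMeasurable (fk k) μ)
    (hf : AEStronglyMeasurable f μ)
    (h : Tendsto (fun k => ∫⁻ t, ‖fk k t - f t‖ₑ ∂μ) atTop (𝓝 0)) :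
    ∃ θ : ℕ → ℕ, StrictMono θ ∧ ∀ᵐ t ∂μ, Tendsto (fun k => fk (θ k) t) atTop (𝓝 (f t)) := by
  refine (tendstoInMeasure_of_tendsto_eLpNorm (p := 1) one_ne_zero hfk hf ?_).exists_seq_tendsto_ae
  simpa only [eLpNorm_one_eq_lintegral_enorm, Pi.sub_apply] using h

theorem MemL1Into.nonempty {v : ℝ → EuclideanSpace ℝ (Fin l)} {T : ℝ} (hT : 0 < T)
    (h : MemL1Into v (Icc 0 T) V) : V.Nonempty := by
  have hne : (ae (volume.restrict (Icc (0 : ℝ) T))).NeBot := by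
    rw [ae_neBot]
    intro h0
    have := congrArg (fun μ : Measure ℝ => μ univ) h0
    simp at this
    linarith
  obtain ⟨t, ht⟩ := h.2.exists
  exact ⟨v t, ht⟩

theorem IsEBVSLimitSolution.isGraphCompletionSolution (hyp : StandingAssumptions U V g)
    {T : ℝ} (hT : 0 < T) {u₀ : EuclideanSpace ℝ (Fin m)} {u : ℝ → EuclideanSpace ℝ (Fin m)}
    {v₁ v₂ : ℝ → EuclideanSpace ℝ (Fin l)}
    (hv₁ : MemL1Into v₁ (Icc 0 T) V) (hv₂ : MemL1Into v₂ (Icc 0 T) V)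
    {x : ℝ → EuclideanSpace ℝ (Fin n)} (h : IsEBVSLimitSolution U V g T x₀ u₀ u v₁ v₂ x) :
    IsGraphCompletionSolution U V g T x₀ u₀ u v₁ v₂ x := by
  obtain ⟨-, uk, v₁k, v₂k, xk, hreg, ⟨K, hK⟩, hsol, hlim, -, -, hv₁lim, hv₂lim, ψ₂, hψ₂loc, hψ₂V,
    hψ₂lim⟩ := h
  have hV := hyp.compact_V
  have hne : V.Nonempty := hv₁.nonempty hT
  -- Borel representatives
  choose v₁k' hv₁k'm hv₁k'V hv₁k' using fun k => (hreg k).2.2.2.1.exists_measurable hV hne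
  choose v₂k' hv₂k'm hv₂k'V hv₂k' using fun k => (hreg k).2.2.2.2.exists_measurable hV hne
  obtain ⟨v₁', hv₁'m, hv₁'V, hv₁'⟩ := hv₁.exists_measurable hV hne
  set R : ℝ := T + K with hRdef
  have hψ₂R : MemL1Into ψ₂ (Icc 0 R) V :=
    ⟨hψ₂loc.integrableOn_compact_subset Icc_subset_Ici_self isCompact_Icc,
      ae_restrict_of_ae_restrict_of_subset Icc_subset_Ici_self hψ₂V⟩
  obtain ⟨ψ, hψm, hψV, hψ⟩ := hψ₂R.exists_measurable hV hne
  -- arc-length parametrizations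
  choose b qk wk hbmono hbT hab hba hquasi htraj using fun k =>
    ((hsol k).congr_ae (hv₁k' k) (hv₂k' k)).exists_isSpaceTimeTrajectory hyp hT.le (hreg k).1
      (hreg k).2.1 (hv₁k'm k) (hv₁k'V k) (hv₂k'm k) (hv₂k'V k)
  set Sk : ℕ → ℝ := fun k => arcLength (uk k) T with hSkdef
  have hSkR : ∀ k, Sk k ≤ R := fun k => by
    have := ENNReal.toReal_mono ENNReal.coe_ne_top (hK k)
    simp only [hSkdef, arcLength, hRdef]
    simpa using this
  have hTT : T ∈ Icc 0 T := ⟨hT.le, le_rfl⟩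
  have h0T : (0 : ℝ) ∈ Icc 0 T := ⟨le_rfl, hT.le⟩
  have hsubR : ∀ k, Icc 0 (Sk k) ⊆ Icc 0 R := fun k => Icc_subset_Icc le_rfl (hSkR k)
  have hend : ∀ k, b k (Sk k) = T := fun k => (hba k T hTT).2
  have hud : ∀ k, HasDensityOn (uk k) (deriv (uk k)) T := fun k => (hreg k).1.hasDensityOn hT.le
  have hexp : ∀ k, ∀ s ∈ Icc 0 T, ∀ t ∈ Icc 0 T, s ≤ t →
      t - s ≤ arcLength (uk k) t - arcLength (uk k) s := fun k s hs t ht hst =>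
    (hud k).sub_le_arcLength_sub hs ht hst
  -- convergence of the controls `v_{2,k}` along the arc length
  have hψlim : Tendsto (fun k => ∫⁻ s in Icc 0 (Sk k), ‖v₂k' k (b k s) - ψ s‖ₑ) atTop (𝓝 0) := by
    refine hψ₂lim.congr fun k => ?_
    rw [eLpNorm_one_eq_lintegral_enorm]
    refine lintegral_congr_ae ?_
    filter_upwards [(hquasi k).ae (hv₂k' k), ae_restrict_mem measurableSet_Icc,
      ae_restrict_of_ae_restrict_of_subset (hsubR k) hψ] with s h1 h2 h3
    have h4 : arcLengthInv (uk k) T s = b k s := by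
      have := eqOn_arcLengthInv (hud k) (hbT k s)
      rwa [hab k s h2] at this
    rw [h4, h1, h3]
  have hv₁lim' : Tendsto (fun k => ∫⁻ t in Icc 0 T, ‖v₁k' k t - v₁' t‖ₑ) atTop (𝓝 0) := by
    refine hv₁lim.congr fun k => ?_
    rw [eLpNorm_one_eq_lintegral_enorm]
    refine lintegral_congr_ae ?_
    filter_upwards [hv₁k' k, hv₁'] with t h1 h2
    rw [Pi.sub_apply, h1, h2]
  have hv₂lim' : Tendsto (fun k => ∫⁻ t in Icc 0 T, ‖v₂k' k t - v₂ t‖ₑ) atTop (𝓝 0) := by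
    refine hv₂lim.congr fun k => ?_
    rw [eLpNorm_one_eq_lintegral_enorm]
    refine lintegral_congr_ae ?_
    filter_upwards [hv₂k' k] with t h1
    rw [Pi.sub_apply, h1]
  -- extraction of subsequences
  obtain ⟨θ₁, hθ₁, hae₁⟩ := exists_subseq_ae_tendsto
    (fun k => (hv₁k'm k).aestronglyMeasurable) hv₁'m.aestronglyMeasurable hv₁lim'
  classical
  -- Filling with `ψ` beyond `Sk` places all the controls on the fixed interval `[0, R]` without
  -- changing the `L¹` distance.
  have hψlim' : Tendsto (fun k => ∫⁻ s in Icc 0 R,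
      ‖(Icc 0 (Sk (θ₁ k))).piecewise (fun s => v₂k' (θ₁ k) (b (θ₁ k) s)) ψ s - ψ s‖ₑ)
      atTop (𝓝 0) := by
    refine (hψlim.comp hθ₁.tendsto_atTop).congr fun k => ?_
    simp only [Function.comp_apply]
    rw [← lintegral_indicator measurableSet_Icc, ← lintegral_indicator measurableSet_Icc]
    congr 1
    ext s
    by_cases hs : s ∈ Icc 0 (Sk (θ₁ k))
    · rw [indicator_of_mem hs, indicator_of_mem (hsubR _ hs), piecewise_eq_of_mem _ _ _ hs]
    · rw [indicator_of_notMem hs]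
      by_cases hs' : s ∈ Icc 0 R
      · rw [indicator_of_mem hs', piecewise_eq_of_notMem _ _ _ hs]; simp
      · rw [indicator_of_notMem hs']
  obtain ⟨θ₂, hθ₂, hae₂⟩ := exists_subseq_ae_tendsto (fun k =>
    (Measurable.piecewise measurableSet_Icc ((hv₂k'm (θ₁ k)).comp (hbmono _).measurable)
      hψm).aestronglyMeasurable) hψm.aestronglyMeasurable hψlim'
  obtain ⟨θ₃, hθ₃, S, φ₀, φ, ξ, hSlim, hφ₀lim, hφlim, hξlim⟩ := hyp.exists_subseq_tendsto
    (fun k => htraj (θ₁ (θ₂ k))) (fun k => hSkR (θ₁ (θ₂ k))) (fun k => hend (θ₁ (θ₂ k)))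
  set θ : ℕ → ℕ := fun k => θ₁ (θ₂ (θ₃ k)) with hθdef
  have hθ : Tendsto θ atTop atTop :=
    hθ₁.tendsto_atTop.comp (hθ₂.tendsto_atTop.comp hθ₃.tendsto_atTop)
  change Tendsto (fun k => Sk (θ k)) atTop (𝓝 S) at hSlim
  have hS0 : 0 ≤ S := ge_of_tendsto' hSlim fun k => (htraj _).nonneg
  have hSR : S ≤ R := le_of_tendsto' hSlim fun k => hSkR _
  obtain ⟨C, hC⟩ := hyp.exists_trajectory_bound x₀ R
  have hmin : ∀ s ∈ Icc 0 S, ∀ k, min s (Sk (θ k)) ∈ Icc 0 (Sk (θ k)) := fun s hs k =>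
    ⟨le_min hs.1 (htraj _).nonneg, min_le_right _ _⟩
  -- cluster points of the arc lengths
  have hcluster : ∀ (𝒱 : Ultrafilter ℕ), (𝒱 : Filter ℕ) ≤ atTop → ∀ t ∈ Icc 0 T, ∀ s,
      Tendsto (fun k => arcLength (uk (θ k)) t) 𝒱 (𝓝 s) →
      s ∈ Icc 0 S ∧ φ₀ s = t ∧ φ s = u t ∧ ξ s = x t := by
    intro 𝒱 h𝒱 t ht s hs
    have hsS : s ∈ Icc 0 S :=
      ⟨ge_of_tendsto' hs fun k => (hba _ t ht).1.1,
        le_of_tendsto_of_tendsto' hs (hSlim.mono_left h𝒱) fun k => (hba _ t ht).1.2⟩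
    have hd : Tendsto (fun k => arcLength (uk (θ k)) t - min s (Sk (θ k))) 𝒱 (𝓝 0) := by
      have := hs.sub ((tendsto_const_nhds (x := s)).min (hSlim.mono_left h𝒱))
      rwa [min_eq_left hsS.2, sub_self] at this
    refine ⟨hsS, ?_, ?_, ?_⟩
    · have h1 := tendsto_apply_of_lipschitzOnWith (fun k => (htraj (θ k)).lipschitzOnWith_time)
        (hmin s hsS) (fun k => (hba _ t ht).1) ((hφ₀lim s hsS).mono_left h𝒱) hd
      refine tendsto_nhds_unique h1 (tendsto_const_nhds.congr fun k => ?_)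
      exact (hba _ t ht).2.symm
    · have h1 := tendsto_apply_of_lipschitzOnWith (fun k => (htraj (θ k)).lipschitzOnWith_control)
        (hmin s hsS) (fun k => (hba _ t ht).1) ((hφlim s hsS).mono_left h𝒱) hd
      refine tendsto_nhds_unique h1 ((((hlim t ht).2.comp hθ).mono_left h𝒱).congr fun k => ?_)
      simp only [Function.comp_apply]
      rw [(hba _ t ht).2]
    · have h1 := tendsto_apply_of_lipschitzOnWith (fun k => (hC (htraj (θ k)) (hSkR _)).2)
        (hmin s hsS) (fun k => (hba _ t ht).1) ((hξlim s hsS).mono_left h𝒱) hd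
      refine tendsto_nhds_unique h1 ((((hlim t ht).1.comp hθ).mono_left h𝒱).congr fun k => ?_)
      simp only [Function.comp_apply]
      rw [(hba _ t ht).2]
  have hultra : ∀ (𝒱 : Ultrafilter ℕ), ∀ t ∈ Icc 0 T, ∃ s,
      Tendsto (fun k => arcLength (uk (θ k)) t) 𝒱 (𝓝 s) := by
    intro 𝒱 t ht
    obtain ⟨s, -, hs⟩ := (isCompact_Icc (a := (0 : ℝ)) (b := R)).ultrafilter_le_nhds
      (𝒱.map fun k => arcLength (uk (θ k)) t)
      (tendsto_principal.2 (Eventually.of_forall fun k => hsubR _ (hba _ t ht).1))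
    exact ⟨s, hs⟩
  -- the clock
  set 𝒰 : Ultrafilter ℕ := hyperfilter ℕ with h𝒰def
  have h𝒰 : (𝒰 : Filter ℕ) ≤ atTop := by
    rw [← Nat.cofinite_eq_atTop]; exact hyperfilter_le_cofinite
  -- Where `φ₀` is flat, the sequence of arc lengths may have several cluster points. The
  -- ultrafilter chooses one for every `t` simultaneously, and by `hcluster` any choice is
  -- compatible with `u` and `x`.
  choose! σ hσlim using hultra 𝒰
  have hσ := fun t ht => hcluster 𝒰 h𝒰 t ht _ (hσlim t ht)
  have hσ0 : σ 0 = 0 := by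
    refine tendsto_nhds_unique (hσlim 0 h0T) ?_
    simp only [arcLength_zero]
    exact tendsto_const_nhds
  have hσT : σ T = S := tendsto_nhds_unique (hσlim T hTT) (hSlim.mono_left h𝒰)
  -- regularity of the limit time change
  have hφ₀m : MonotoneOn φ₀ (Icc 0 S) := fun s hs t ht hst =>
    le_of_tendsto_of_tendsto' (hφ₀lim s hs) (hφ₀lim t ht) fun k =>
      (htraj (θ k)).monotoneOn_time (hmin s hs k) (hmin t ht k) (by gcongr)
  have hφ₀L : LipschitzOnWith 1 φ₀ (Icc 0 S) := by
    refine LipschitzOnWith.of_dist_le_mul fun s hs t ht => ?_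
    refine le_of_tendsto ((hφ₀lim s hs).dist (hφ₀lim t ht)) (Eventually.of_forall fun k => ?_)
    refine ((htraj (θ k)).lipschitzOnWith_time.dist_le_mul _ (hmin s hs k) _ (hmin t ht k)).trans ?_
    gcongr
    rw [Real.dist_eq, Real.dist_eq]
    exact (abs_min_sub_min_le_max s _ t _).trans (by simp)
  have hφ₀d : HasDensityOn φ₀ (deriv φ₀) S :=
    (LipschitzOnWith.absolutelyContinuousOnInterval
      (by rwa [uIcc_of_le hS0])).hasDensityOn_real hS0
  have hφ₀0 : φ₀ 0 = 0 := by simpa only [hσ0] using (hσ 0 h0T).2.1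
  have hφ₀S : φ₀ S = T := by simpa only [hσT] using (hσ T hTT).2.1
  have hσr : ∀ t ∈ Icc 0 T, σ t ∈ Icc 0 S ∧ φ₀ (σ t) = t := fun t ht =>
    ⟨(hσ t ht).1, (hσ t ht).2.1⟩
  -- For almost every `t` the equation `φ₀ s = t` has only the solution `σ t`, so all ultrafilters
  -- give the same cluster point and the sequence itself converges.
  have haeσ : ∀ᵐ t ∂(volume.restrict (Icc 0 T)),
      Tendsto (fun k => arcLength (uk (θ k)) t) atTop (𝓝 (σ t)) := by
    have h1 : ∀ᵐ t ∂(volume.restrict (Icc 0 T)), ∀ s ∈ Icc 0 S, φ₀ s = φ₀ (σ t) → s = σ t := by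
      rw [← hφ₀S]
      exact hφ₀d.ae_comp_rightInverse hS0 hφ₀m.ae_deriv_nonneg hφ₀0 (by rwa [hφ₀S])
        (P := fun r => ∀ s ∈ Icc 0 S, φ₀ s = φ₀ r → s = r)
        (hφ₀d.ae_eq_of_apply_eq hφ₀m.ae_deriv_nonneg)
    filter_upwards [h1, ae_restrict_mem measurableSet_Icc] with t h2 ht
    rw [tendsto_iff_ultrafilter]
    intro 𝒱 h𝒱
    obtain ⟨s, hs⟩ := hultra 𝒱 t ht
    have h3 := hcluster 𝒱 h𝒱 t ht s hs
    rw [← h2 s h3.1 (by rw [h3.2.1, (hσr t ht).2])]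
    exact hs
  have haev : ∀ᵐ s ∂(volume.restrict (Icc 0 S)),
      Tendsto (fun k => v₂k' (θ k) (b (θ k) s)) atTop (𝓝 (ψ s)) := by
    -- A parameter `s < S` eventually lies in `[0, Sk (θ k)]`, where the filling by `ψ` is not used.
    have hneS : ∀ᵐ s : ℝ, s ≠ S := by simp [ae_iff, measure_singleton]
    filter_upwards [ae_restrict_of_ae_restrict_of_subset (Icc_subset_Icc le_rfl hSR) hae₂,
      ae_restrict_mem measurableSet_Icc, ae_restrict_of_ae hneS] with s h1 h2 h3
    refine (h1.comp hθ₃.tendsto_atTop).congr' ?_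
    filter_upwards [hSlim.eventually (lt_mem_nhds (lt_of_le_of_ne h2.2 h3))] with k hk
    exact piecewise_eq_of_mem _ _ _ ⟨h2.1, le_of_lt hk⟩
  have htrajlim := hyp.isSpaceTimeTrajectory_of_tendsto (σ := σ)
    (σk := fun k => arcLength (uk (θ k)))
    (fun k => htraj (θ k)) hT.le (fun k => hend (θ k)) hSlim (fun k t ht => hba (θ k) t ht)
    (fun k => hv₁k'm _) (fun k => hv₁k'V _) hv₁'m hv₁'V
    (MemL1Into.of_measurable hV hψm hψV 0 S) hφ₀lim hφlim hξlim hσr haeσ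
    (by
      filter_upwards [hae₁] with t h1
      exact h1.comp (hθ₂.tendsto_atTop.comp hθ₃.tendsto_atTop)) haev
  -- identification of `v₂`
  have hsm : StrictMonoOn σ (Icc 0 T) := strictMonoOn_of_rightInverse hφ₀m hσr
  have hσmeas : AEMeasurable σ (volume.restrict (Icc 0 T)) :=
    aemeasurable_restrict_of_monotoneOn measurableSet_Icc hsm.monotoneOn
  have hkmono : ∀ k, MonotoneOn (arcLength (uk k)) (Icc 0 T) := fun k s hs t ht hst => by
    linarith [hexp k s hs t ht hst]
  have hkmeas : ∀ k, AEMeasurable (arcLength (uk k)) (volume.restrict (Icc 0 T)) := fun k =>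
    aemeasurable_restrict_of_monotoneOn measurableSet_Icc (hkmono k)
  -- Arc lengths and their limit expand distances, so `L¹` estimates in the arc-length variable
  -- carry over to time. In `L¹` of time, `v₂k' - ψ ∘ σ_k → 0` and `ψ ∘ σ_k → ψ ∘ σ`, where `σ_k` is
  -- the arc length of `uk`; hence `ψ ∘ σ = v₂` almost everywhere.
  have hmapk : ∀ k, Measure.map (arcLength (uk k)) (volume.restrict (Icc 0 T)) ≤
      volume.restrict (Icc 0 (Sk k)) := fun k =>
    map_restrict_le_of_expanding (fun t ht => (hba k t ht).1) (hexp k)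
  have hmapσ : Measure.map σ (volume.restrict (Icc 0 T)) ≤ volume.restrict (Icc 0 R) :=
    map_restrict_le_of_expanding
      (fun t ht => Icc_subset_Icc le_rfl hSR (hσr t ht).1)
      fun s hs t ht hst => ge_of_tendsto' ((hσlim t ht).sub (hσlim s hs)) fun k =>
        hexp _ s hs t ht hst
  have hI₁ : Tendsto (fun k => ∫⁻ t in Icc 0 T, ‖ψ (arcLength (uk (θ k)) t) - ψ (σ t)‖ₑ) atTop
      (𝓝 0) :=
    tendsto_lintegral_comp_sub (MemL1Into.of_measurable hV hψm hψV 0 R).1 (fun k => hkmeas _)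
      hσmeas (fun k => (hmapk _).trans (Measure.restrict_mono (hsubR _) le_rfl)) hmapσ haeσ
  have hI₂ : Tendsto (fun k => ∫⁻ t in Icc 0 T, ‖v₂k' (θ k) t - ψ (arcLength (uk (θ k)) t)‖ₑ) atTop
      (𝓝 0) := by
    refine tendsto_of_tendsto_of_tendsto_of_le_of_le tendsto_const_nhds (hψlim.comp hθ)
      (fun _ => zero_le) fun k => ?_
    have hm : Measurable fun s => ‖v₂k' (θ k) (b (θ k) s) - ψ s‖ₑ :=
      (((hv₂k'm _).comp (hbmono _).measurable).sub hψm).enorm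
    refine le_trans (le_of_eq ?_) (lintegral_mono' (hmapk (θ k)) le_rfl)
    rw [lintegral_map' hm.aemeasurable (hkmeas _)]
    refine lintegral_congr_ae ?_
    filter_upwards [ae_restrict_mem measurableSet_Icc] with t ht
    rw [(hba _ t ht).2]
  have hψσm : AEStronglyMeasurable (fun t => ψ (σ t)) (volume.restrict (Icc 0 T)) :=
    (hψm.comp_aemeasurable hσmeas).aestronglyMeasurable
  have hzero : ∫⁻ t in Icc 0 T, ‖ψ (σ t) - v₂ t‖ₑ = 0 := by
    have hsum := (hI₁.add hI₂).add (hv₂lim'.comp hθ)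
    simp only [add_zero] at hsum
    refine le_antisymm (ge_of_tendsto' hsum fun k => ?_) (zero_le)
    have hm1 : AEMeasurable (fun t => ‖ψ (arcLength (uk (θ k)) t) - ψ (σ t)‖ₑ)
        (volume.restrict (Icc 0 T)) :=
      ((hψm.comp_aemeasurable (hkmeas _)).aestronglyMeasurable.sub hψσm).enorm
    have hm2 : AEMeasurable (fun t => ‖v₂k' (θ k) t - ψ (arcLength (uk (θ k)) t)‖ₑ)
        (volume.restrict (Icc 0 T)) :=
      ((hv₂k'm _).aestronglyMeasurable.sub
        (hψm.comp_aemeasurable (hkmeas _)).aestronglyMeasurable).enorm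
    have hm12 : AEMeasurable (fun t => ‖ψ (arcLength (uk (θ k)) t) - ψ (σ t)‖ₑ +
        ‖v₂k' (θ k) t - ψ (arcLength (uk (θ k)) t)‖ₑ) (volume.restrict (Icc 0 T)) := hm1.add hm2
    simp only [Function.comp_apply]
    rw [← lintegral_add_left' hm1, ← lintegral_add_left' hm12]
    refine lintegral_mono fun t => ?_
    have : ψ (σ t) - v₂ t = (v₂k' (θ k) t - v₂ t) - (ψ (arcLength (uk (θ k)) t) - ψ (σ t))
      - (v₂k' (θ k) t - ψ (arcLength (uk (θ k)) t)) := by abel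
    rw [this]
    refine (enorm_sub_le.trans (add_le_add enorm_sub_le le_rfl)).trans (le_of_eq ?_)
    ring
  have hψσ : ∀ᵐ t ∂(volume.restrict (Icc 0 T)), ψ (σ t) = v₂ t := by
    have hm : AEMeasurable (fun t => ‖ψ (σ t) - v₂ t‖ₑ) (volume.restrict (Icc 0 T)) :=
      (hψσm.sub hv₂.1.aestronglyMeasurable).enorm
    rw [lintegral_eq_zero_iff' hm] at hzero
    filter_upwards [hzero] with t ht
    simpa [sub_eq_zero] using ht
  refine htrajlim.isGraphCompletionSolution hyp hT hv₁'m hv₁'V hv₁' hψm hψV hφ₀S ?_ hσr hσ0 hσT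
    (fun t ht => (hσ t ht).2.2.1) (fun t ht => (hσ t ht).2.2.2) hψσ
  have h00 : (0 : ℝ) ∈ Icc 0 S := ⟨le_rfl, hS0⟩
  refine tendsto_nhds_unique (hφlim 0 h00) (tendsto_const_nhds.congr fun k => ?_)
  have h1 : b (θ k) 0 = 0 := (htraj (θ k)).time_zero
  have h2 : min 0 (Sk (θ k)) = 0 := min_eq_left (htraj _).nonneg
  change u₀ = uk (θ k) (b (θ k) (min 0 (Sk (θ k))))
  rw [h2, h1, (hreg _).2.2.1]

end

/-! ### Existence of Carathéodory solutions -/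

/-- Existence for a Carathéodory differential equation whose right-hand side is bounded and
Lipschitz in the state, by Picard iteration. -/
theorem exists_hasDensityOn_of_lipschitz {E : Type*} [NormedAddCommGroup E] [NormedSpace ℝ E]
    [CompleteSpace E] {F : ℝ → E → E} {T L D : ℝ} (hT : 0 ≤ T) (hL : 0 ≤ L) (x₀ : E)
    (hm : ∀ y : ℝ → E, ContinuousOn y (Icc 0 T) →
      AEStronglyMeasurable (fun t => F t (y t)) (volume.restrict (Icc 0 T)))
    (hD : ∀ᵐ t ∂(volume.restrict (Icc 0 T)), ∀ y, ‖F t y‖ ≤ D)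
    (hF : ∀ᵐ t ∂(volume.restrict (Icc 0 T)), ∀ y z, ‖F t y - F t z‖ ≤ L * ‖y - z‖) :
    ∃ x : ℝ → E, x 0 = x₀ ∧ HasDensityOn x (fun t => F t (x t)) T := by
  have hInt : ∀ y : ℝ → E, ContinuousOn y (Icc 0 T) →
      IntegrableOn (fun t => F t (y t)) (Icc 0 T) := fun y hy =>
    Integrable.of_bound (hm y hy) D (hD.mono fun t h => h _)
  let X : ℕ → ℝ → E := fun k => Nat.rec (fun _ => x₀)
    (fun _ y t => x₀ + ∫ τ in (0 : ℝ)..t, F τ (y τ)) k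
  have hXs : ∀ k t, X (k + 1) t = x₀ + ∫ τ in (0 : ℝ)..t, F τ (X k τ) := fun k t => rfl
  have hstep : ∀ y : ℝ → E, ContinuousOn y (Icc 0 T) →
      HasDensityOn (fun t => x₀ + ∫ τ in (0 : ℝ)..t, F τ (y τ)) (fun t => F t (y t)) T :=
    fun y hy => ⟨hInt y hy, fun s _ => by simp⟩
  have hXc : ∀ k, ContinuousOn (X k) (Icc 0 T) := by
    intro k
    induction k with
    | zero => exact continuousOn_const
    | succ k ih => exact (hstep _ ih).continuousOn
  obtain ⟨B, hB⟩ : ∃ B : ℝ, ∀ t ∈ Icc 0 T, ‖X 1 t - X 0 t‖ ≤ B :=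
    (isCompact_Icc.bddAbove_image ((hXc 1).sub (hXc 0)).norm).imp fun B hB t ht =>
      hB ⟨t, ht, rfl⟩
  -- The factorial makes the increments summable for every `T`, so no subdivision of the interval is
  -- needed.
  have hest : ∀ k, ∀ t ∈ Icc 0 T, ‖X (k + 1) t - X k t‖ ≤ B * ((L * t) ^ k / k.factorial) := by
    intro k
    induction k with
    | zero => intro t ht; simpa using hB t ht
    | succ k ih =>
      intro t ht
      have h0 : (0 : ℝ) ∈ Icc 0 T := ⟨le_rfl, hT⟩
      have e : X (k + 1 + 1) t - X (k + 1) t =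
          ∫ τ in (0 : ℝ)..t, (F τ (X (k + 1) τ) - F τ (X k τ)) := by
        rw [intervalIntegral.integral_sub ((hstep _ (hXc (k + 1))).intervalIntegrable h0 ht)
          ((hstep _ (hXc k)).intervalIntegrable h0 ht), hXs (k + 1), hXs k]
        abel
      rw [e]
      have hc : IntervalIntegrable (fun τ : ℝ => L * (B * ((L * τ) ^ k / k.factorial)))
          volume 0 t := by
        apply Continuous.intervalIntegrable; fun_prop
      refine (intervalIntegral.norm_integral_le_of_norm_le ht.1 ?_ hc).trans (le_of_eq ?_)
      · rw [← ae_restrict_iff' measurableSet_Ioc]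
        have hsub : Ioc 0 t ⊆ Icc 0 T := fun τ hτ => ⟨hτ.1.le, hτ.2.trans ht.2⟩
        filter_upwards [ae_restrict_of_ae_restrict_of_subset hsub hF,
          ae_restrict_mem measurableSet_Ioc] with τ h1 h2
        exact (h1 _ _).trans (mul_le_mul_of_nonneg_left (ih τ (hsub h2)) hL)
      · have e2 : (fun τ : ℝ => L * (B * ((L * τ) ^ k / k.factorial))) =
            fun τ => (B * L ^ (k + 1) / k.factorial) * τ ^ k := by
          ext τ; rw [mul_pow]; ring
        rw [e2, intervalIntegral.integral_const_mul, integral_pow, Nat.factorial_succ]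
        have : (k.factorial : ℝ) ≠ 0 := by positivity
        push_cast
        field_simp
        ring
  have hcau : ∀ t ∈ Icc 0 T, ∃ y, Tendsto (fun k => X k t) atTop (𝓝 y) := by
    intro t ht
    refine cauchySeq_tendsto_of_complete (cauchySeq_of_summable_dist ?_)
    refine Summable.of_nonneg_of_le (fun _ => dist_nonneg) (fun k => ?_)
      ((Real.summable_pow_div_factorial (L * t)).mul_left B)
    rw [dist_comm, dist_eq_norm]
    exact hest k t ht
  choose! x hx using hcau
  have hx0 : x 0 = x₀ := by
    refine tendsto_nhds_unique (hx 0 ⟨le_rfl, hT⟩) (tendsto_const_nhds.congr fun k => ?_)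
    cases k with
    | zero => rfl
    | succ k => simp [hXs]
  have hFlim : ∀ᵐ t ∂(volume.restrict (Icc 0 T)),
      Tendsto (fun k => F t (X k t)) atTop (𝓝 (F t (x t))) := by
    filter_upwards [hF, ae_restrict_mem measurableSet_Icc] with t h1 h2
    rw [tendsto_iff_norm_sub_tendsto_zero]
    have h3 := ((tendsto_iff_norm_sub_tendsto_zero.1 (hx t h2)).const_mul L)
    rw [mul_zero] at h3
    exact squeeze_zero (fun _ => norm_nonneg _) (fun k => h1 _ _) h3
  have hlimint : IntegrableOn (fun t => F t (x t)) (Icc 0 T) :=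
    Integrable.of_bound (aestronglyMeasurable_of_tendsto_ae atTop (fun k => hm _ (hXc k)) hFlim) D
      (hD.mono fun t h => h _)
  refine ⟨x, hx0, hlimint, fun s hs => ?_⟩
  rw [hx0]
  have h1 := tendsto_intervalIntegral_of_tendsto (fun k => hm _ (hXc k))
    (fun k => hD.mono fun t h => h _) hFlim (tk := fun _ => s) (fun _ => hs) tendsto_const_nhds
  exact tendsto_nhds_unique ((tendsto_add_atTop_iff_nat 1).2 (hx s hs)) (h1.const_add x₀)

/-- A bounded nonexpansive retraction onto a neighbourhood of a ball. -/
theorem exists_bounded_retraction (n : ℕ) {R : ℝ} (hR : 0 ≤ R) :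
    ∃ (ρ : EuclideanSpace ℝ (Fin n) → EuclideanSpace ℝ (Fin n)) (B : ℝ), Continuous ρ ∧
      (∀ x y, ‖ρ x - ρ y‖ ≤ ‖x - y‖) ∧ (∀ x, ‖x‖ ≤ R → ρ x = x) ∧ (∀ x, ‖ρ x‖ ≤ B) ∧
      ∀ x, ‖ρ x‖ ≤ ‖x‖ := by
  -- Coordinatewise clamping retracts onto the cube of half-side `R`, which contains the ball of
  -- radius `R`.
  let ρ : EuclideanSpace ℝ (Fin n) → EuclideanSpace ℝ (Fin n) := fun x =>
    WithLp.toLp 2 fun i => max (-R) (min (x i) R)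
  have hlip : ∀ x y, ‖ρ x - ρ y‖ ≤ ‖x - y‖ := by
    intro x y
    rw [EuclideanSpace.norm_eq, EuclideanSpace.norm_eq]
    gcongr with i
    simp only [ρ, PiLp.sub_apply, Real.norm_eq_abs]
    have h1 := abs_max_sub_max_le_max (-R) (min (x i) R) (-R) (min (y i) R)
    have h2 := abs_min_sub_min_le_max (x i) R (y i) R
    simp only [sub_self, abs_zero] at h1 h2
    rw [max_eq_right (abs_nonneg (min (x i) R - min (y i) R))] at h1
    rw [max_eq_left (abs_nonneg (x i - y i))] at h2
    exact h1.trans h2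
  have hfix : ∀ x, ‖x‖ ≤ R → ρ x = x := by
    intro x hx
    ext i
    have h1 : |x i| ≤ R := (PiLp.norm_apply_le x i).trans hx
    simp only [ρ]
    rw [min_eq_left (abs_le.1 h1).2, max_eq_right (abs_le.1 h1).1]
  refine ⟨ρ, √(∑ _i : Fin n, R ^ 2), ?_, hlip, hfix, fun x => ?_, fun x => ?_⟩
  · refine (LipschitzWith.of_dist_le_mul (K := 1) fun x y => ?_).continuous
    simpa [dist_eq_norm] using hlip x y
  · rw [EuclideanSpace.norm_eq]
    gcongr with i
    simp only [ρ, Real.norm_eq_abs]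
    exact abs_le.2 ⟨le_max_left _ _, max_le (by linarith) (min_le_right _ _)⟩
  · have := hlip x 0
    rwa [hfix 0 (by simpa using hR), sub_zero, sub_zero] at this

section

variable {n m l : ℕ} {U : Set (EuclideanSpace ℝ (Fin m))} {V : Set (EuclideanSpace ℝ (Fin l))}
  {g : Fin (m + 1) → EuclideanSpace ℝ (Fin n) → EuclideanSpace ℝ (Fin m) →
    EuclideanSpace ℝ (Fin l) → EuclideanSpace ℝ (Fin n)}

/-- Existence of solutions for Lipschitz controls. -/
theorem StandingAssumptions.exists_isCaratheodorySolution (hyp : StandingAssumptions U V g)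
    {T : ℝ} (hT : 0 ≤ T) (x₀ : EuclideanSpace ℝ (Fin n)) {K : ℝ≥0}
    {u : ℝ → EuclideanSpace ℝ (Fin m)} (hu : LipschitzOnWith K u (Icc 0 T))
    (huU : MapsTo u (Icc 0 T) U) {v₁ v₂ : ℝ → EuclideanSpace ℝ (Fin l)}
    (hv₁ : Measurable v₁) (hv₁V : ∀ t, v₁ t ∈ V) (hv₂ : Measurable v₂) (hv₂V : ∀ t, v₂ t ∈ V) :
    ∃ x, IsCaratheodorySolution g T x₀ u v₁ v₂ x := by
  obtain ⟨M, hM, hgrowth⟩ := hyp.exists_linear_growth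
  set Q : ℝ := max 1 K
  have hQ : 0 ≤ Q := le_trans zero_le_one (le_max_left _ _)
  set c : ℝ := (m + 1) * Q * M
  have hc : 0 ≤ c := by positivity
  set R : ℝ := (‖x₀‖ + c * T) * Real.exp (c * T)
  have hR : 0 ≤ R := by positivity
  -- Composed with `ρ`, the fields become bounded and globally Lipschitz in the state. Since `‖ρ y‖
  -- ≤ ‖y‖`, the growth bound survives and keeps the solution in the ball of radius `R`, where `ρ`
  -- is the identity and the original equation holds.
  obtain ⟨ρ, B, hρc, hρlip, hρfix, hρB, hρle⟩ := exists_bounded_retraction n hR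
  obtain ⟨L, hL, hlip⟩ := hyp.exists_lipschitz B
  have hud : HasDensityOn u (deriv u) T :=
    (LipschitzOnWith.absolutelyContinuousOnInterval
      (by rwa [uIcc_of_le hT])).hasDensityOn hT
  have hu' : ∀ᵐ t ∂(volume.restrict (Icc 0 T)), ‖deriv u t‖ ≤ Q :=
    hu.ae_norm_deriv_le.mono fun t h => h.trans (le_max_right _ _)
  have h1Q : |(1 : ℝ)| ≤ Q := by simp [Q]
  have hmem : ∀ᵐ t ∂(volume.restrict (Icc 0 T)), u t ∈ U := by
    filter_upwards [ae_restrict_mem measurableSet_Icc] with t ht using huU ht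
  obtain ⟨x, hx0, hx⟩ := exists_hasDensityOn_of_lipschitz
    (F := fun t y => spaceTimeField g 1 (deriv u t) (ρ y) (u t) (v₁ t) (v₂ t))
    (D := (m + 1) * Q * (M * (1 + B))) (L := (m + 1) * Q * L) hT (by positivity) x₀
    (fun y hy => hyp.aestronglyMeasurable_spaceTimeField aemeasurable_const
      hud.1.aestronglyMeasurable.aemeasurable
      ((hρc.comp_continuousOn hy).aemeasurable measurableSet_Icc)
      (hu.continuousOn.aemeasurable measurableSet_Icc) hmem hv₁.aemeasurable
      (Eventually.of_forall hv₁V) hv₂.aemeasurable (Eventually.of_forall hv₂V))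
    (by
      filter_upwards [hu', hmem] with t h1 h2 y
      have h3 : M * (1 + ‖ρ y‖) ≤ M * (1 + B) := by gcongr; exact hρB y
      exact norm_smul_add_sum_smul_le h1Q h1 ((hgrowth _ _ _ h2 _ (hv₁V t)).trans h3)
        fun i => (hgrowth _ _ _ h2 _ (hv₂V t)).trans h3)
    (by
      filter_upwards [hu', hmem] with t h1 h2 y z
      rw [spaceTimeField_sub, mul_assoc _ L]
      have h3 : L * ‖ρ y - ρ z‖ ≤ L * ‖y - z‖ := by gcongr; exact hρlip y z
      exact norm_smul_add_sum_smul_le h1Q h1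
        ((hlip _ _ _ (hρB y) (hρB z) _ h2 _ (hv₁V t)).trans h3)
        fun i => (hlip _ _ _ (hρB y) (hρB z) _ h2 _ (hv₂V t)).trans h3)
  have hbound : ∀ t ∈ Icc 0 T, ‖x t‖ ≤ R := by
    intro t ht
    have := hx.norm_le_of_linear_growth hc (by
      filter_upwards [hu', hmem] with t h1 h2
      have h3 : M * (1 + ‖ρ (x t)‖) ≤ M * (1 + ‖x t‖) := by gcongr; exact hρle _
      refine (norm_smul_add_sum_smul_le h1Q h1 ((hgrowth _ _ _ h2 _ (hv₁V t)).trans h3)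
        fun i => (hgrowth _ _ _ h2 _ (hv₂V t)).trans h3).trans (le_of_eq ?_)
      simp only [c]; ring) ht
    rwa [hx0] at this
  refine ⟨x, hx.absolutelyContinuousOnInterval hT, hx0, ?_⟩
  filter_upwards [hx.ae_hasDerivAt, ae_restrict_mem measurableSet_Icc] with t h1 h2
  simpa only [spaceTimeField, hρfix _ (hbound t h2), one_smul] using h1

end

/-! ### Lipschitz approximation of clocks and convergence of inverses -/

/-- A monotone function agrees on any finite set with a monotone Lipschitz function. -/
theorem exists_monotone_lipschitzWith_eq_on_finset {σ : ℝ → ℝ} {s : Set ℝ} (hσ : MonotoneOn σ s)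
    {F : Finset ℝ} (hF : F.Nonempty) (hFs : (F : Set ℝ) ⊆ s) :
    ∃ (f : ℝ → ℝ) (K : ℝ≥0), Monotone f ∧ LipschitzWith K f ∧ ∀ p ∈ F, f p = σ p := by
  classical
  obtain ⟨L, hL⟩ := ((F ×ˢ F).image fun z : ℝ × ℝ => (σ z.1 - σ z.2) / (z.1 - z.2)).bddAbove
  set K : ℝ := max 0 L
  have hK0 : 0 ≤ K := le_max_left _ _
  have hK : ∀ p ∈ F, ∀ q ∈ F, q < p → σ p ≤ σ q + K * (p - q) := by
    intro p hp q hq hqp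
    have h1 : (σ p - σ q) / (p - q) ≤ K :=
      (hL (Finset.mem_coe.2 (Finset.mem_image.2
        ⟨(p, q), Finset.mem_product.2 ⟨hp, hq⟩, rfl⟩))).trans (le_max_right _ _)
    rw [div_le_iff₀ (sub_pos.2 hqp)] at h1
    linarith
  -- A lower envelope of monotone `K`-Lipschitz functions; `K` dominates all slopes of `σ` between
  -- points of `F`, so no competitor falls below `σ p` at `p`.
  let f : ℝ → ℝ := fun t => F.inf' hF fun p => σ p + K * max (t - p) 0
  have hle : ∀ t, ∀ p ∈ F, f t ≤ σ p + K * max (t - p) 0 := fun t p hp =>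
    Finset.inf'_le (fun p => σ p + K * max (t - p) 0) hp
  have hex : ∀ t, ∃ p ∈ F, f t = σ p + K * max (t - p) 0 := fun t => Finset.exists_mem_eq_inf' hF _
  refine ⟨f, K.toNNReal, fun s t hst => ?_, LipschitzWith.of_le_add_mul _ fun t s => ?_,
    fun p hp => le_antisymm ?_ ?_⟩
  · obtain ⟨p, hp, h⟩ := hex t
    rw [h]
    refine (hle s p hp).trans ?_
    gcongr
  · obtain ⟨p, hp, h⟩ := hex s
    rw [h, Real.coe_toNNReal _ hK0, add_assoc, ← mul_add]
    refine (hle t p hp).trans ?_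
    gcongr
    rw [Real.dist_eq]
    refine max_le ?_ (add_nonneg (le_max_right _ _) (abs_nonneg _))
    linarith [le_max_left (s - p) 0, le_abs_self (t - s)]
  · simpa using hle p p hp
  · obtain ⟨q, hq, h⟩ := hex p
    rw [h]
    rcases lt_or_ge q p with hqp | hqp
    · rw [max_eq_left (sub_nonneg.2 hqp.le)]
      exact hK p hp q hq hqp
    · rw [max_eq_right (sub_nonpos.2 hqp), mul_zero, add_zero]
      exact hσ (hFs hp) (hFs hq) hqp

/-- A monotone function on a compact interval is the pointwise limit, at every point, of monotone
Lipschitz functions with the same values at the endpoints. -/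
theorem MonotoneOn.exists_lipschitzWith_tendsto {σ : ℝ → ℝ} {T : ℝ} (hT : 0 < T)
    (hσ : MonotoneOn σ (Icc 0 T)) :
    ∃ (f : ℕ → ℝ → ℝ) (K : ℕ → ℝ≥0), (∀ k, Monotone (f k)) ∧ (∀ k, LipschitzWith (K k) (f k)) ∧
      (∀ k, f k 0 = σ 0) ∧ (∀ k, f k T = σ T) ∧
      ∀ t ∈ Icc 0 T, Tendsto (fun k => f k t) atTop (𝓝 (σ t)) := by
  classical
  have h0T : (0 : ℝ) ∈ Icc 0 T := ⟨le_rfl, hT.le⟩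
  have hTT : T ∈ Icc 0 T := ⟨hT.le, le_rfl⟩
  -- `D` is countable, so `f k` can be made to agree with `σ` on growing finite subsets exhausting
  -- it. Outside `D` the function `σ` is continuous, and monotonicity squeezes `f k t` between its
  -- values at nearby rationals, which belong to `D`.
  set D : Set ℝ := {t | t ∈ Icc 0 T ∧ ¬ContinuousWithinAt σ (Icc 0 T) t} ∪
    ({0, T} ∪ range ((↑) : ℚ → ℝ) ∩ Icc 0 T) with hDdef
  have hDc : D.Countable := hσ.countable_not_continuousWithinAt.union
    (((finite_singleton T).insert 0).countable.union
      ((countable_range _).mono inter_subset_left))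
  have hD0 : (0 : ℝ) ∈ D := Or.inr (Or.inl (Or.inl rfl))
  have hDT : T ∈ D := Or.inr (Or.inl (Or.inr rfl))
  have hDs : D ⊆ Icc 0 T := by
    rintro t (h | (rfl | rfl) | h)
    · exact h.1
    · exact h0T
    · exact hTT
    · exact h.2
  obtain ⟨e, he⟩ := hDc.exists_eq_range ⟨0, hD0⟩
  set F : ℕ → Finset ℝ := fun k => insert 0 (insert T ((Finset.range k).image e)) with hFdef
  have hFs : ∀ k, (F k : Set ℝ) ⊆ Icc 0 T := by
    intro k t ht
    simp only [hFdef, Finset.coe_insert, Finset.coe_image, mem_insert_iff, mem_image] at ht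
    rcases ht with rfl | rfl | ⟨i, -, rfl⟩
    · exact h0T
    · exact hTT
    · exact hDs (he ▸ mem_range_self i)
  choose f K hmono hlip heq using fun k =>
    exists_monotone_lipschitzWith_eq_on_finset hσ (F := F k) (Finset.insert_nonempty _ _) (hFs k)
  have hev : ∀ p ∈ D, ∀ᶠ k in atTop, f k p = σ p := by
    intro p hp
    rw [he] at hp
    obtain ⟨i, rfl⟩ := hp
    filter_upwards [eventually_gt_atTop i] with k hk
    refine heq k _ ?_
    simp only [hFdef, Finset.mem_insert, Finset.mem_image, Finset.mem_range]
    exact Or.inr (Or.inr ⟨i, hk, rfl⟩)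
  refine ⟨f, K, hmono, hlip, fun k => heq k 0 (by simp [hFdef]),
    fun k => heq k T (by simp [hFdef]), fun t ht => ?_⟩
  by_cases htD : t ∈ D
  · exact tendsto_const_nhds.congr' ((hev t htD).mono fun k hk => hk.symm)
  · have hc : ContinuousWithinAt σ (Icc 0 T) t := by
      by_contra h
      exact htD (Or.inl ⟨ht, h⟩)
    have ht0 : 0 < t := lt_of_le_of_ne ht.1 fun h => htD (h ▸ hD0)
    have htT : t < T := lt_of_le_of_ne ht.2 fun h => htD (h ▸ hDT)
    have hc' : ContinuousAt σ t := hc.continuousAt (Icc_mem_nhds ht0 htT)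
    refine tendsto_order.2 ⟨fun a ha => ?_, fun a ha => ?_⟩
    · obtain ⟨c, d, hcd, hsub⟩ := mem_nhds_iff_exists_Ioo_subset.1 (hc'.eventually (lt_mem_nhds ha))
      obtain ⟨r, hr1, hr2⟩ := exists_rat_btwn (max_lt hcd.1 ht0)
      have hrD : (r : ℝ) ∈ D := Or.inr (Or.inr ⟨mem_range_self r,
        ((le_max_right _ _).trans hr1.le), hr2.le.trans ht.2⟩)
      filter_upwards [hev _ hrD] with k hk
      have h1 : a < σ r := hsub ⟨(le_max_left _ _).trans_lt hr1, hr2.trans hcd.2⟩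
      rw [← hk] at h1
      exact h1.trans_le (hmono k hr2.le)
    · obtain ⟨c, d, hcd, hsub⟩ := mem_nhds_iff_exists_Ioo_subset.1 (hc'.eventually (gt_mem_nhds ha))
      obtain ⟨r, hr1, hr2⟩ := exists_rat_btwn (lt_min hcd.2 htT)
      have hrD : (r : ℝ) ∈ D := Or.inr (Or.inr ⟨mem_range_self r,
        ht.1.trans hr1.le, hr2.le.trans (min_le_right _ _)⟩)
      filter_upwards [hev _ hrD] with k hk
      have h1 : σ r < a := hsub ⟨hcd.1.trans hr1, hr2.trans_le (min_le_left _ _)⟩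
      rw [← hk] at h1
      exact (hmono k hr1.le).trans_lt h1

/-- Monotone functions with a continuous limit converge along moving points too: `f k (tk k)` is
compared with the value of `f k` at a fixed point on either side of `t`. -/
theorem tendsto_apply_of_monotoneOn {T : ℝ} {f : ℕ → ℝ → ℝ}
    (hf : ∀ k, MonotoneOn (f k) (Icc 0 T))
    (hlim : ∀ t ∈ Icc 0 T, Tendsto (fun k => f k t) atTop (𝓝 t)) {tk : ℕ → ℝ} {t : ℝ}
    (htk : ∀ k, tk k ∈ Icc 0 T) (ht : Tendsto tk atTop (𝓝 t)) :
    Tendsto (fun k => f k (tk k)) atTop (𝓝 t) := by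
  have htT : t ∈ Icc 0 T := isClosed_Icc.mem_of_tendsto ht (Eventually.of_forall htk)
  refine tendsto_order.2 ⟨fun a ha => ?_, fun a ha => ?_⟩
  · have h1 : (a + t) / 2 < t := by linarith
    have hp : max 0 ((a + t) / 2) ∈ Icc 0 T :=
      ⟨le_max_left _ _, max_le (htT.1.trans htT.2) (h1.le.trans htT.2)⟩
    have h2 : a < max 0 ((a + t) / 2) := lt_max_of_lt_right (by linarith)
    filter_upwards [ht.eventually (lt_mem_nhds h1), (hlim _ hp).eventually (lt_mem_nhds h2)]
      with k h3 h4
    exact h4.trans_le (hf k hp (htk k) (max_le (htk k).1 (le_of_lt h3)))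
  · have h1 : t < (a + t) / 2 := by linarith
    have hp : min T ((a + t) / 2) ∈ Icc 0 T :=
      ⟨le_min (htT.1.trans htT.2) (htT.1.trans h1.le), min_le_left _ _⟩
    have h2 : min T ((a + t) / 2) < a := min_lt_of_right_lt (by linarith)
    filter_upwards [ht.eventually (gt_mem_nhds h1), (hlim _ hp).eventually (gt_mem_nhds h2)]
      with k h3 h4
    exact (hf k (htk k) hp (le_min (htk k).2 (le_of_lt h3))).trans_lt h4

/-- If monotone functions converge pointwise to a right inverse of the monotone function `a`, their
left inverses converge pointwise to `a`. -/
theorem tendsto_leftInverse_of_tendsto_rightInverse {T S : ℝ} {a σ : ℝ → ℝ} {b A : ℕ → ℝ → ℝ}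
    (ha : MonotoneOn a (Icc 0 S)) (hσ : ∀ t ∈ Icc 0 T, σ t ∈ Icc 0 S ∧ a (σ t) = t)
    (hb : ∀ k, Monotone (b k)) (hbT : ∀ k s, b k s ∈ Icc 0 T)
    (hbA : ∀ k, ∀ t ∈ Icc 0 T, b k (A k t) = t)
    (hlim : ∀ t ∈ Icc 0 T, Tendsto (fun k => A k t) atTop (𝓝 (σ t)))
    {s : ℝ} (hs : s ∈ Icc 0 S) (has : a s ∈ Icc 0 T) :
    Tendsto (fun k => b k s) atTop (𝓝 (a s)) := by
  refine tendsto_order.2 ⟨fun c hc => ?_, fun c hc => ?_⟩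
  · rcases lt_or_ge c 0 with h0 | h0
    · exact Eventually.of_forall fun k => h0.trans_le (hbT k s).1
    -- At the midpoint `p` between `c` and `a s` one has `σ p < s`, hence eventually `A k p < s` and
    -- `b k s ≥ b k (A k p) = p > c`. The upper bound is symmetric.
    · have hp : (c + a s) / 2 ∈ Icc 0 T := ⟨by linarith, by linarith [has.2]⟩
      have h1 : σ ((c + a s) / 2) < s := by
        by_contra! h
        have := ha hs (hσ _ hp).1 h
        rw [(hσ _ hp).2] at this
        linarith
      filter_upwards [(hlim _ hp).eventually (gt_mem_nhds h1)] with k hk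
      have := hb k (le_of_lt hk)
      rw [hbA k _ hp] at this
      linarith
  · rcases lt_or_ge T c with h0 | h0
    · exact Eventually.of_forall fun k => (hbT k s).2.trans_lt h0
    · have hp : (c + a s) / 2 ∈ Icc 0 T := ⟨by linarith [has.1], by linarith⟩
      have h1 : s < σ ((c + a s) / 2) := by
        by_contra! h
        have := ha (hσ _ hp).1 hs h
        rw [(hσ _ hp).2] at this
        linarith
      filter_upwards [(hlim _ hp).eventually (lt_mem_nhds h1)] with k hk
      have := hb k (le_of_lt hk)
      rw [hbA k _ hp] at this
      linarith

theorem tendsto_eLpNorm_one_sub_of_tendsto {E : Type*} [NormedAddCommGroup E] {μ : Measure ℝ}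
    [IsFiniteMeasure μ] {fk : ℕ → ℝ → E} {f : ℝ → E} {C : ℝ}
    (hm : ∀ k, AEStronglyMeasurable (fk k) μ) (hC : ∀ k, ∀ᵐ t ∂μ, ‖fk k t‖ ≤ C)
    (hlim : ∀ᵐ t ∂μ, Tendsto (fun k => fk k t) atTop (𝓝 (f t))) :
    Tendsto (fun k => eLpNorm (fk k - f) 1 μ) atTop (𝓝 0) := by
  have := tendsto_lintegral_norm_of_dominated_convergence hm
    (integrable_const (μ := μ) C).hasFiniteIntegral hC hlim
  simpa only [eLpNorm_one_eq_lintegral_enorm, Pi.sub_apply, ofReal_norm] using this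

/-- The variation of a control along a Lipschitz clock. -/
theorem HasDensityOn.eVariationOn_comp {E : Type*} [NormedAddCommGroup E] [NormedSpace ℝ E]
    [CompleteSpace E] {φ p : ℝ → E} {a α σ : ℝ → ℝ} {S t : ℝ} (h : HasDensityOn φ p S)
    (ha : HasDensityOn a α S) (ha0 : a 0 = 0)
    (hp : ∀ᵐ s ∂(volume.restrict (Icc 0 S)), α s + ‖p s‖ = 1)
    (hσ : MonotoneOn σ (Icc 0 t)) (hσc : ContinuousOn σ (Icc 0 t)) (ht : 0 ≤ t) (hσ0 : σ 0 = 0)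
    (hσt : σ t ∈ Icc 0 S) :
    eVariationOn (fun τ => φ (σ τ)) (Icc 0 t) = ENNReal.ofReal (σ t - a (σ t)) := by
  -- A continuous clock covers `[0, σ t]`, so the variation is that of `φ` there, and `φ` has speed
  -- `1 - α`.
  have himage : σ '' Icc 0 t = Icc 0 (σ t) := by
    refine Subset.antisymm ?_ ?_
    · rintro _ ⟨τ, hτ, rfl⟩
      refine ⟨?_, hσ hτ ⟨ht, le_rfl⟩ hτ.2⟩
      rw [← hσ0]
      exact hσ ⟨le_rfl, ht⟩ hτ hτ.1
    · have := intermediate_value_Icc ht hσc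
      rwa [hσ0] at this
  have h1 := eVariationOn.comp_eq_of_monotoneOn φ σ hσ
  rw [himage, h.eVariationOn_Icc hσt] at h1
  rw [show (fun τ => φ (σ τ)) = φ ∘ σ from rfl, h1]
  congr 1
  have h0 : (0 : ℝ) ∈ Icc 0 S := ⟨le_rfl, hσt.1.trans hσt.2⟩
  have h2 : ∫ τ in (0 : ℝ)..σ t, ‖p τ‖ = ∫ τ in (0 : ℝ)..σ t, (1 - α τ) := by
    refine intervalIntegral.integral_congr_ae ?_
    rw [uIoc_of_le hσt.1, ← ae_restrict_iff' measurableSet_Ioc]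
    have hsub : Ioc 0 (σ t) ⊆ Icc 0 S := fun τ hτ => ⟨hτ.1.le, hτ.2.trans hσt.2⟩
    filter_upwards [ae_restrict_of_ae_restrict_of_subset hsub hp] with τ hτ
    linarith
  rw [h2, intervalIntegral.integral_sub (by simp) (ha.intervalIntegrable h0 hσt), ha.2 _ hσt, ha0]
  simp

/-! ### From graph completion solutions to limit solutions -/

section

variable {n m l : ℕ} {U : Set (EuclideanSpace ℝ (Fin m))} {V : Set (EuclideanSpace ℝ (Fin l))}
  {g : Fin (m + 1) → EuclideanSpace ℝ (Fin n) → EuclideanSpace ℝ (Fin m) →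
    EuclideanSpace ℝ (Fin l) → EuclideanSpace ℝ (Fin n)}
  {x₀ : EuclideanSpace ℝ (Fin n)} {T S : ℝ} {u₀ : EuclideanSpace ℝ (Fin m)} {φ₀ : ℝ → ℝ}
  {u φ : ℝ → EuclideanSpace ℝ (Fin m)} {v₁ v₂ ψ₁ ψ₂ : ℝ → EuclideanSpace ℝ (Fin l)}

theorem IsFeasibleSpaceTimeControl.hasDensityOn_time
    (h : IsFeasibleSpaceTimeControl U V T u₀ φ₀ φ ψ₁ ψ₂ S) : HasDensityOn φ₀ (deriv φ₀) S := by
  obtain ⟨L, hL⟩ := h.lipschitz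
  refine (LipschitzOnWith.absolutelyContinuousOnInterval (K := 1 * L) ?_).hasDensityOn_real h.pos.le
  rw [uIcc_of_le h.pos.le]
  exact LipschitzWith.prod_fst.comp_lipschitzOnWith hL

theorem IsFeasibleSpaceTimeControl.hasDensityOn_control
    (h : IsFeasibleSpaceTimeControl U V T u₀ φ₀ φ ψ₁ ψ₂ S) : HasDensityOn φ (deriv φ) S := by
  obtain ⟨L, hL⟩ := h.lipschitz
  refine (LipschitzOnWith.absolutelyContinuousOnInterval (K := 1 * L) ?_).hasDensityOn h.pos.le
  rw [uIcc_of_le h.pos.le]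
  exact LipschitzWith.prod_snd.comp_lipschitzOnWith hL

/-- A property that holds at almost every time holds along a time change wherever time flows. -/
theorem IsFeasibleSpaceTimeControl.ae_comp_time
    (h : IsFeasibleSpaceTimeControl U V T u₀ φ₀ φ ψ₁ ψ₂ S) {P : ℝ → Prop}
    (hP : ∀ᵐ t ∂(volume.restrict (Icc 0 T)), P t) :
    ∀ᵐ s ∂(volume.restrict (Icc 0 S)), deriv φ₀ s ≠ 0 → P (φ₀ s) := by
  have hd := h.hasDensityOn_time
  rw [← h.time_end, ← hd.map_withDensity h.pos.le h.deriv_nonneg h.time_zero] at hP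
  have h1 := ae_of_ae_map (hd.aemeasurable_withDensity _) hP
  rw [ae_withDensity_iff' (measurable_deriv φ₀).ennreal_ofReal.aemeasurable] at h1
  filter_upwards [h1, h.deriv_nonneg] with s h2 h3 h4
  exact h2 (by simpa using lt_of_le_of_ne h3 (Ne.symm h4))

/-- In a graph completion the ordinary controls are determined wherever time flows. -/
theorem IsGraphCompletion.ae_eq (h : IsGraphCompletion U V T u₀ u v₁ v₂ φ₀ φ ψ₁ ψ₂ S) :
    ∀ᵐ s ∂(volume.restrict (Icc 0 S)), deriv φ₀ s ≠ 0 →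
      ψ₁ s = v₁ (φ₀ s) ∧ ψ₂ s = v₂ (φ₀ s) := by
  have hd := h.feasible.hasDensityOn_time
  filter_upwards [h.feasible.ae_comp_time h.graph_ae,
    hd.ae_eq_of_apply_eq h.feasible.deriv_nonneg] with s h4 h5 h7
  obtain ⟨r, hr, hrs, -, hr1, hr2⟩ := h4 h7
  -- Since time flows at `s`, no other parameter is mapped to the same time; the matching parameter
  -- is `s` itself.
  obtain rfl := h5 h7 r hr hrs
  exact ⟨hr1, hr2⟩

/-- The drift control `ψ₁` acts only where `φ₀' ≠ 0`, and there it equals `v₁ ∘ φ₀`; it may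
therefore be replaced by a function of time, the form required by the closure theorem. -/
theorem IsSpaceTimeSolution.isSpaceTimeTrajectory (hyp : StandingAssumptions U V g)
    {v₁' ψ : ℝ → EuclideanSpace ℝ (Fin l)} {ξ : ℝ → EuclideanSpace ℝ (Fin n)}
    (h : IsSpaceTimeSolution g x₀ φ₀ φ ψ₁ ψ₂ S ξ)
    (hgc : IsGraphCompletion U V T u₀ u v₁ v₂ φ₀ φ ψ₁ ψ₂ S)
    (hv₁'m : Measurable v₁') (hv₁'V : ∀ t, v₁' t ∈ V)
    (hv₁' : ∀ᵐ s ∂(volume.restrict (Icc 0 S)), deriv φ₀ s ≠ 0 → v₁ (φ₀ s) = v₁' (φ₀ s))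
    (hψ : ψ₂ =ᵐ[volume.restrict (Icc 0 S)] ψ) :
    IsSpaceTimeTrajectory U V g x₀ S φ₀ (deriv φ₀) φ (deriv φ) (fun s => v₁' (φ₀ s)) ψ ξ := by
  have hf := hgc.feasible
  have hd := hf.hasDensityOn_time
  refine ⟨hf.pos.le, hd, hf.time_zero, hf.hasDensityOn_control, hf.mapsTo, hf.deriv_nonneg, ?_, ?_,
    ?_, hf.memL1_snd.congr hψ, ?_, h.initial⟩
  · filter_upwards [hf.arc_length] with s hs
    linarith [norm_nonneg (deriv φ s)]
  · filter_upwards [hf.arc_length, hf.deriv_nonneg] with s hs h0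
    linarith
  · obtain ⟨C, hC⟩ := hyp.compact_V.isBounded.exists_norm_le
    refine ⟨Integrable.of_bound (hv₁'m.comp_aemeasurable
      (hd.continuousOn.aemeasurable measurableSet_Icc)).aestronglyMeasurable C
      (Eventually.of_forall fun s => hC _ (hv₁'V _)), Eventually.of_forall fun s => hv₁'V _⟩
  · refine (h.absolutelyContinuous.hasDensityOn hf.pos.le).congr (fun _ _ => rfl) ?_
    filter_upwards [h.ode, hgc.ae_eq, hv₁', hψ] with s h1 h2 h3 h4
    rw [h1.deriv, spaceTimeField, h4]
    by_cases h0 : deriv φ₀ s = 0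
    · rw [h0, zero_smul, zero_smul]
    · rw [(h2 h0).1, h3 h0]

theorem IsGraphCompletionSolution.isEBVSLimitSolution (hyp : StandingAssumptions U V g)
    (hT : 0 < T) (hv₁ : MemL1Into v₁ (Icc 0 T) V)
    {x : ℝ → EuclideanSpace ℝ (Fin n)}
    (h : IsGraphCompletionSolution U V g T x₀ u₀ u v₁ v₂ x) :
    IsEBVSLimitSolution U V g T x₀ u₀ u v₁ v₂ x := by
  obtain ⟨S, φ₀, φ, ψ₁, ψ₂, σ, ξ, hgc, hclock, hsol, hxσ⟩ := h
  have hf := hgc.feasible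
  have hV := hyp.compact_V
  have hne : V.Nonempty := hv₁.nonempty hT
  have h0T : (0 : ℝ) ∈ Icc 0 T := ⟨le_rfl, hT.le⟩
  have hTT : T ∈ Icc 0 T := ⟨hT.le, le_rfl⟩
  -- Borel representatives
  obtain ⟨v₁', hv₁'m, hv₁'V, hv₁'⟩ := hv₁.exists_measurable hV hne
  obtain ⟨ψ, hψm, hψV, hψ⟩ := hf.memL1_snd.exists_measurable hV hne
  -- the graph completion as a trajectory
  have hd := hf.hasDensityOn_time
  have htraj := hsol.isSpaceTimeTrajectory hyp hgc hv₁'m hv₁'V (hf.ae_comp_time hv₁') hψ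
  have hφ₀m := htraj.monotoneOn_time
  have hφ₀c : ContinuousOn φ₀ (Icc 0 S) := htraj.time.continuousOn
  have hφc : ContinuousOn φ (Icc 0 S) := htraj.control.continuousOn
  have hσmono := hclock.strictMono.monotoneOn
  have hσ : ∀ t ∈ Icc 0 T, σ t ∈ Icc 0 S ∧ φ₀ (σ t) = t := by
    refine fun t ht => ⟨⟨?_, ?_⟩, (hclock.graph t ht).1⟩
    · rw [← hclock.zero]; exact hσmono h0T ht ht.1
    · rw [← hclock.final]; exact hσmono ht hTT ht.2
  have hv₂σ : ∀ᵐ t ∂(volume.restrict (Icc 0 T)), ψ (σ t) = v₂ t := by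
    -- For almost every `t` the parameter `σ t` lies where time flows, and there the graph
    -- completion determines `ψ₂`.
    have h1 := hd.ae_comp_rightInverse hf.pos.le hf.deriv_nonneg hf.time_zero
      (by rwa [hf.time_end]) (P := fun s => ψ s = v₂ (φ₀ s)) (by
        filter_upwards [hgc.ae_eq, hψ] with s h1 h2 h3
        rw [← h2, (h1 h3).2])
    rw [hf.time_end] at h1
    filter_upwards [h1, ae_restrict_mem measurableSet_Icc] with t h2 h3
    rw [h2, (hσ t h3).2]
  -- Lipschitz approximations of the clock
  obtain ⟨σk, K, hσkm, hσkL, hσk0, hσkT, hσklim⟩ := hσmono.exists_lipschitzWith_tendsto hT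
  simp only [hclock.zero] at hσk0
  simp only [hclock.final] at hσkT
  have hσkS : ∀ k, ∀ t ∈ Icc 0 T, σk k t ∈ Icc 0 S := by
    refine fun k t ht => ⟨?_, ?_⟩
    · rw [← hσk0 k]; exact hσkm k ht.1
    · rw [← hσkT k]; exact hσkm k ht.2
  set uk : ℕ → ℝ → EuclideanSpace ℝ (Fin m) := fun k t => φ (σk k t) with hukdef
  have hukL : ∀ k, LipschitzOnWith (1 * K k) (uk k) (Icc 0 T) := fun k =>
    htraj.lipschitzOnWith_control.comp ((hσkL k).lipschitzOnWith (s := Icc 0 T)) (hσkS k)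
  have hukac : ∀ k, AbsolutelyContinuousOnInterval (uk k) 0 T := fun k =>
    LipschitzOnWith.absolutelyContinuousOnInterval (K := 1 * K k)
      (by rw [uIcc_of_le hT.le]; exact hukL k)
  have hukU : ∀ k, MapsTo (uk k) (Icc 0 T) U := fun k t ht => hf.mapsTo (hσkS k t ht)
  have hud : ∀ k, HasDensityOn (uk k) (deriv (uk k)) T := fun k => (hukac k).hasDensityOn hT.le
  have huklim : ∀ t ∈ Icc 0 T, Tendsto (fun k => uk k t) atTop (𝓝 (u t)) := by
    intro t ht
    rw [← (hclock.graph t ht).2]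
    exact (hφc _ (hσ t ht).1).tendsto.comp (tendsto_nhdsWithin_iff.2
      ⟨hσklim t ht, Eventually.of_forall fun k => hσkS k t ht⟩)
  have hφ₀σk : ∀ t ∈ Icc 0 T, Tendsto (fun k => φ₀ (σk k t)) atTop (𝓝 t) := by
    intro t ht
    have := (hφ₀c _ (hσ t ht).1).tendsto.comp (tendsto_nhdsWithin_iff.2
      ⟨hσklim t ht, Eventually.of_forall fun k => hσkS k t ht⟩)
    rwa [(hσ t ht).2] at this
  have hvar : ∀ k, ∀ t ∈ Icc 0 T,
      eVariationOn (uk k) (Icc 0 t) = ENNReal.ofReal (σk k t - φ₀ (σk k t)) := fun k t ht =>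
    htraj.control.eVariationOn_comp htraj.time hf.time_zero hf.arc_length
      ((hσkm k).monotoneOn _) (hσkL k).continuous.continuousOn ht.1 (hσk0 k) (hσkS k t ht)
  have hφ₀le : ∀ s ∈ Icc 0 S, φ₀ s ≤ s := by
    intro s hs
    have h1 := htraj.lipschitzOnWith_time.dist_le_mul s hs 0 ⟨le_rfl, hf.pos.le⟩
    rw [hf.time_zero, Real.dist_eq, Real.dist_eq, sub_zero, sub_zero, NNReal.coe_one, one_mul,
      abs_of_nonneg hs.1] at h1
    exact (le_abs_self _).trans h1
  have harc : ∀ k, ∀ t ∈ Icc 0 T, arcLength (uk k) t = t + (σk k t - φ₀ (σk k t)) := by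
    intro k t ht
    rw [arcLength, hvar k t ht, ENNReal.toReal_ofReal (sub_nonneg.2 (hφ₀le _ (hσkS k t ht)))]
  -- As `σk k T = S` and `φ₀ S = T`, every approximating curve has the same total length, and all of
  -- them live on `[0, S]`.
  have harcT : ∀ k, arcLength (uk k) T = S := fun k => by
    rw [harc k T hTT, hσkT, hf.time_end]; ring
  have harclim : ∀ t ∈ Icc 0 T, Tendsto (fun k => arcLength (uk k) t) atTop (𝓝 (σ t)) := by
    intro t ht
    have := ((hσklim t ht).sub (hφ₀σk t ht)).const_add t
    rw [add_sub_cancel] at this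
    exact this.congr fun k => (harc k t ht).symm
  -- approximating controls and trajectories
  have hexp : ∀ k, ∀ s ∈ Icc 0 T, ∀ t ∈ Icc 0 T, s ≤ t →
      t - s ≤ arcLength (uk k) t - arcLength (uk k) s := fun k s hs t ht hst =>
    (hud k).sub_le_arcLength_sub hs ht hst
  have hproj : ∀ t : ℝ, max 0 (min t T) ∈ Icc 0 T := fun t =>
    ⟨le_max_left _ _, max_le hT.le (min_le_right _ _)⟩
  have hprojeq : ∀ t ∈ Icc 0 T, max 0 (min t T) = t := fun t ht => by
    rw [min_eq_left ht.2, max_eq_right ht.1]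
  -- Read in the arc-length variable, this control is exactly `ψ`, so the distance in condition (ii)
  -- is zero for every `k`. The clamping only serves measurability on the whole line.
  set v₂k : ℕ → ℝ → EuclideanSpace ℝ (Fin l) := fun k t =>
    ψ (arcLength (uk k) (max 0 (min t T))) with hv₂kdef
  have hv₂km : ∀ k, Measurable (v₂k k) := by
    intro k
    have hm : Monotone fun t => arcLength (uk k) (max 0 (min t T)) := by
      intro s t hst
      have h1 : max 0 (min s T) ≤ max 0 (min t T) := by gcongr
      linarith [hexp k _ (hproj s) _ (hproj t) h1]
    exact hψm.comp hm.measurable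
  have hv₂kV : ∀ k t, v₂k k t ∈ V := fun k t => hψV _
  have hv₂keq : ∀ k, ∀ t ∈ Icc 0 T, v₂k k t = ψ (arcLength (uk k) t) := fun k t ht => by
    simp only [hv₂kdef, hprojeq t ht]
  choose xk hxk using fun k => hyp.exists_isCaratheodorySolution hT.le x₀ (hukL k) (hukU k)
    hv₁'m hv₁'V (hv₂km k) (hv₂kV k)
  choose b qk wk hbmono hbT hab hba _ htrajk using fun k =>
    (hxk k).exists_isSpaceTimeTrajectory hyp hT.le (hukac k) (hukU k) hv₁'m hv₁'V (hv₂km k)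
      (hv₂kV k)
  simp only [harcT] at hab hba htrajk
  have hbend : ∀ k, b k S = T := fun k => by
    have := (hba k T hTT).2
    rwa [harcT] at this
  -- convergence of the parametrizations
  have hφ₀T : ∀ s ∈ Icc 0 S, φ₀ s ∈ Icc 0 T := by
    refine fun s hs => ⟨hf.nonneg s hs, ?_⟩
    rw [← hf.time_end]
    exact hφ₀m hs ⟨hf.pos.le, le_rfl⟩ hs.2
  have hblim : ∀ s ∈ Icc 0 S, Tendsto (fun k => b k s) atTop (𝓝 (φ₀ s)) := fun s hs =>
    tendsto_leftInverse_of_tendsto_rightInverse hφ₀m hσ hbmono hbT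
      (fun k t ht => (hba k t ht).2) harclim hs (hφ₀T s hs)
  have hφlim : ∀ s ∈ Icc 0 S, Tendsto (fun k => uk k (b k s)) atTop (𝓝 (φ s)) := by
    intro s hs
    have h1 : Tendsto (fun k => φ₀ (σk k (b k s))) atTop (𝓝 (φ₀ s)) :=
      tendsto_apply_of_monotoneOn (f := fun k t => φ₀ (σk k t))
        (fun k p hp r hr hpr => hφ₀m (hσkS k p hp) (hσkS k r hr) (hσkm k hpr)) hφ₀σk
        (fun k => hbT k s) (hblim s hs)
    -- At `t = b k s` the arc-length formula reads `s = b k s + σ_k(b k s) - φ₀(σ_k(b k s))`, and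
    -- the first and last terms both have limit `φ₀ s` up to sign.
    have h2 : Tendsto (fun k => σk k (b k s)) atTop (𝓝 s) := by
      have h3 := ((hblim s hs).const_sub s).add h1
      rw [sub_add_cancel] at h3
      refine h3.congr fun k => ?_
      have h4 := harc k _ (hbT k s)
      rw [hab k s hs] at h4
      linarith
    exact (hφc s hs).tendsto.comp (tendsto_nhdsWithin_iff.2
      ⟨h2, Eventually.of_forall fun k => hσkS k _ (hbT k s)⟩)
  obtain ⟨C, hC⟩ := hyp.exists_trajectory_bound x₀ S
  -- convergence of the states
  have hxlim : ∀ t ∈ Icc 0 T, Tendsto (fun k => xk k t) atTop (𝓝 (x t)) := by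
    intro t ht
    rw [hxσ t ht]
    -- Along any subsequence, compactness gives a further one whose states converge. The limit
    -- solves the same space-time system as `ξ`, so uniqueness identifies it and the whole sequence
    -- converges.
    refine tendsto_of_subseq_tendsto fun ns hns => ?_
    obtain ⟨θ, hθ, S', -, -, η, hS', -, -, hη⟩ := hyp.exists_subseq_tendsto
      (fun k => htrajk (ns k)) (fun _ => le_rfl) (fun k => hbend (ns k))
    obtain rfl : S = S' := tendsto_nhds_unique tendsto_const_nhds hS'
    have hθ' : Tendsto (fun k => ns (θ k)) atTop atTop := hns.comp hθ.tendsto_atTop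
    have hmin : ∀ s ∈ Icc 0 S, min s S = s := fun s hs => min_eq_left hs.2
    have htraj' := hyp.isSpaceTimeTrajectory_of_tendsto (σ := σ) (φ₀ := φ₀) (φ := φ) (ξ := η)
      (ψ₂ := ψ) (v₁ := v₁') (v₁k := fun _ => v₁')
      (σk := fun k => arcLength (uk (ns (θ k)))) (fun k => htrajk (ns (θ k))) hT.le
      (fun k => hbend _) hS' (fun k t ht => hba _ t ht) (fun _ => hv₁'m) (fun _ => hv₁'V) hv₁'m
      hv₁'V (MemL1Into.of_measurable hV hψm hψV 0 S)
      (fun s hs => by simpa only [hmin s hs, Function.comp_def] using (hblim s hs).comp hθ')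
      (fun s hs => by simpa only [hmin s hs, Function.comp_def] using (hφlim s hs).comp hθ') hη hσ
      (by
        filter_upwards [ae_restrict_mem measurableSet_Icc] with t ht
        exact (harclim t ht).comp hθ')
      (Eventually.of_forall fun t => tendsto_const_nhds)
      (by
        filter_upwards [ae_restrict_mem measurableSet_Icc] with s hs
        refine tendsto_const_nhds.congr fun k => ?_
        rw [hv₂keq _ _ (hbT _ s), hab _ s hs])
    have heq := htraj.eqOn hyp htraj' (hσ t ht).1
    refine ⟨θ, ?_⟩
    rw [heq]
    have h1 := tendsto_apply_of_lipschitzOnWith (L := atTop)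
      (fun k => (hC (htrajk (ns (θ k))) le_rfl).2) (fun k => (hσ t ht).1)
      (fun k => (hba (ns (θ k)) t ht).1)
      (by simpa only [hmin _ (hσ t ht).1] using hη _ (hσ t ht).1)
      (by
        have := ((harclim t ht).comp hθ').sub_const (σ t)
        rwa [sub_self] at this)
    exact h1.congr fun k => by rw [(hba _ t ht).2]
  have hxkB : ∀ k, ∀ t ∈ Icc 0 T, ‖xk k t‖ ≤ C := by
    intro k t ht
    have := (hC (htrajk k) le_rfl).1 _ (hba k t ht).1
    rwa [(hba k t ht).2] at this
  have hxkm : ∀ k, AEStronglyMeasurable (xk k) (volume.restrict (Icc 0 T)) := fun k =>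
    ((hxk k).absolutelyContinuous.hasDensityOn hT.le).continuousOn.aestronglyMeasurable
      measurableSet_Icc
  have hxB : ∀ t ∈ Icc 0 T, ‖x t‖ ≤ C := fun t ht =>
    le_of_tendsto' (hxlim t ht).norm fun k => hxkB k t ht
  obtain ⟨CU, hCU⟩ := hyp.compact_U.isBounded.exists_norm_le
  obtain ⟨CV, hCV⟩ := hV.isBounded.exists_norm_le
  have haex : ∀ᵐ t ∂(volume.restrict (Icc 0 T)), Tendsto (fun k => xk k t) atTop (𝓝 (x t)) := by
    filter_upwards [ae_restrict_mem measurableSet_Icc] with t ht using hxlim t ht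
  refine ⟨Integrable.of_bound (aestronglyMeasurable_of_tendsto_ae atTop hxkm haex) C ?_, uk,
    fun _ => v₁', v₂k, xk, fun k => ⟨hukac k, hukU k, ?_, MemL1Into.of_measurable hV hv₁'m hv₁'V 0 T,
      MemL1Into.of_measurable hV (hv₂km k) (hv₂kV k) 0 T⟩, ⟨(S - T).toNNReal, fun k => ?_⟩, hxk,
    fun t ht => ⟨hxlim t ht, huklim t ht⟩, ?_, ?_, ?_, ?_, ψ, ?_, Eventually.of_forall hψV, ?_⟩
  · filter_upwards [ae_restrict_mem measurableSet_Icc] with t ht using hxB t ht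
  · simp only [hukdef, hσk0, hf.control_zero]
  -- The variation of `uk` equals `S - T` for every `k`.
  · rw [hvar k T hTT, hσkT, hf.time_end]
    exact le_rfl
  · refine tendsto_eLpNorm_one_sub_of_tendsto hxkm (C := C) (fun k => ?_) haex
    filter_upwards [ae_restrict_mem measurableSet_Icc] with t ht using hxkB k t ht
  · refine tendsto_eLpNorm_one_sub_of_tendsto (C := CU) (fun k =>
      (hukL k).continuousOn.aestronglyMeasurable measurableSet_Icc) (fun k => ?_) ?_
    · filter_upwards [ae_restrict_mem measurableSet_Icc] with t ht using hCU _ (hukU k ht)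
    · filter_upwards [ae_restrict_mem measurableSet_Icc] with t ht using huklim t ht
  · refine tendsto_const_nhds.congr fun k => ?_
    have : v₁' - v₁ =ᵐ[volume.restrict (Icc 0 T)] 0 := by
      filter_upwards [hv₁'] with t ht
      simp [ht]
    rw [eLpNorm_congr_ae this, eLpNorm_zero]
  -- Here `v₂k` is `ψ` composed with the arc lengths, which expand distances and converge to `σ`,
  -- while `ψ ∘ σ = v₂` almost everywhere.
  · have hmapk : ∀ k, Measure.map (arcLength (uk k)) (volume.restrict (Icc 0 T)) ≤
        volume.restrict (Icc 0 S) := fun k =>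
      map_restrict_le_of_expanding (fun t ht => (hba k t ht).1) (hexp k)
    have hmapσ : Measure.map σ (volume.restrict (Icc 0 T)) ≤ volume.restrict (Icc 0 S) :=
      map_restrict_le_of_expanding (fun t ht => (hσ t ht).1)
        fun s hs t ht hst => ge_of_tendsto' ((harclim t ht).sub (harclim s hs)) fun k =>
          hexp _ s hs t ht hst
    have hkmono : ∀ k, MonotoneOn (arcLength (uk k)) (Icc 0 T) := fun k s hs t ht hst => by
      linarith [hexp k s hs t ht hst]
    have h1 := tendsto_lintegral_comp_sub (MemL1Into.of_measurable hV hψm hψV 0 S).1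
      (fun k => aemeasurable_restrict_of_monotoneOn measurableSet_Icc (hkmono k))
      (aemeasurable_restrict_of_monotoneOn measurableSet_Icc hσmono) hmapk hmapσ
      (by filter_upwards [ae_restrict_mem measurableSet_Icc] with t ht using harclim t ht)
    refine h1.congr fun k => ?_
    rw [eLpNorm_one_eq_lintegral_enorm]
    refine lintegral_congr_ae ?_
    filter_upwards [hv₂σ, ae_restrict_mem measurableSet_Icc] with t h2 ht
    rw [Pi.sub_apply, hv₂keq k t ht, h2]
  · rw [locallyIntegrableOn_iff isClosed_Ici.isLocallyClosed]
    intro k _ hk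
    exact Measure.integrableOn_of_bounded hk.measure_lt_top.ne hψm.aestronglyMeasurable
      (Eventually.of_forall fun s => hCV _ (hψV s))
  · refine tendsto_const_nhds.congr fun k => ?_
    have hend : T + (eVariationOn (uk k) (Icc 0 T)).toReal = S := harcT k
    rw [hend]
    have : (fun s => v₂k k (arcLengthInv (uk k) T s) - ψ s) =ᵐ[volume.restrict (Icc 0 S)] 0 := by
      filter_upwards [ae_restrict_mem measurableSet_Icc] with s hs
      have h1 := eqOn_arcLengthInv (hud k) (hbT k s)
      rw [hab k s hs] at h1
      rw [h1, hv₂keq k _ (hbT k s), hab k s hs, sub_self, Pi.zero_apply]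
    rw [eLpNorm_congr_ae this, eLpNorm_zero]

end

theorem theorem5p1 {n m l : ℕ} (U : Set (EuclideanSpace ℝ (Fin m)))
    (V : Set (EuclideanSpace ℝ (Fin l)))
    (g : Fin (m + 1) → EuclideanSpace ℝ (Fin n) → EuclideanSpace ℝ (Fin m) →
      EuclideanSpace ℝ (Fin l) → EuclideanSpace ℝ (Fin n))
    (hyp : StandingAssumptions U V g)
    (T : ℝ) (hT : 0 < T)
    (x₀ : EuclideanSpace ℝ (Fin n)) (u₀ : EuclideanSpace ℝ (Fin m)) (hu₀ : u₀ ∈ U)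
    (u : ℝ → EuclideanSpace ℝ (Fin m)) (hu : MapsTo u (Icc 0 T) U)
    (hBV : BoundedVariationOn u (Icc 0 T)) (hu0 : u 0 = u₀)
    (v₁ v₂ : ℝ → EuclideanSpace ℝ (Fin l))
    (hv₁ : MemL1Into v₁ (Icc 0 T) V) (hv₂ : MemL1Into v₂ (Icc 0 T) V)
    (x : ℝ → EuclideanSpace ℝ (Fin n)) :
    IsEBVSLimitSolution U V g T x₀ u₀ u v₁ v₂ x ↔
      IsGraphCompletionSolution U V g T x₀ u₀ u v₁ v₂ x :=
  ⟨fun h => h.isGraphCompletionSolution hyp hT hv₁ hv₂, fun h => h.isEBVSLimitSolution hyp hT hv₁⟩
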